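/- **Theorem (Overall complexities of the biased randomized smoothed RSG scheme).** *Game.* Let $N\ge 1$, $n_i\ge 1$. Player $i\in[N]$ solves $\min_{x_i\in X_i}\ h_i(x_i,y_i(x_i))+m_i(x_i,x_{-i})$ with $h_i(x_i,y_i(x_i))=\mathbb E[\tilde h_i(x_i,y_i(x_i),\xi)]$, $m_i(x)=\mathbb E[\tilde m_i(x,\xi)]$, where $X_i\subseteq\mathbb R^{n_i}$ is nonempty, compact and convex, and $y_i(x_i)$ solves the variational inequality $\mathrm{VI}(\mathbb E[\tilde F_i(x_i,\cdot,\xi)],Y_i)$, $Y_i\subseteq\mathbb R^{k_i}$ closed and convex. Put $X=\prod_iX_i$, let $\mathbb B$ be the closed unit ball, $\eta\in(0,1]$, and let $h_i^\eta(x_i)=\mathbb E[h_i(x_i+\eta u_i,y_i(x_i+\eta u_i))]$ with $u_i$ uniform on $\mathbb B$. The smoothed objectives are $f_i^{\mathrm{HI},\eta}=h_i^\eta+m_i$; $F^{\mathrm{HI},\eta}=(\nabla_{x_i}f_i^{\mathrm{HI},\eta})_i$ and $G_\gamma^{\mathrm{HI},\eta}(x)=\gamma^{-1}(x-\Pi_X[x-\gamma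 F^{\mathrm{HI},\eta}(x)])$. *Assumptions.* All integrands are measurable, and the expectations used exist. (a) $P^{\mathrm{HI},\eta}=P_m+\sum_ih_i^\eta$ is a potential function, over $X$, of the smoothed game. $P_m$ is $L_m^0$-Lipschitz on $X$, and differentiable at the points of $X$ with $\nabla P_m$ $L_m^1$-Lipschitz on $X$. $\operatorname{diam}X\le D_X$, and $\max_XP^{\mathrm{HI},\eta}-\min_XP^{\mathrm{HI},\eta}\ge p>0$. (b) $\tilde m_i(\cdot,x_{-i},\xi)$ is $C^1$ near the points of $X_i$; for $x\in X$, $\mathbb E[\nabla_{x_i}\tilde m_i(x,\xi)]=\nabla_{x_i}m_i(x)$ and $\mathbb E\|\nabla_{x_i}\tilde m_i(x,\xi)-\nabla_{x_i}m_i(x)\|^2\le\sigma_m^2$, $\sigma_m>0$. (c) For each $\xi$, $\tilde h_i(\cdot,y_i(\cdot),\xi)$ is $L_i$-Lipschitz on an open set containing $X_i+\eta\mathbb B$. For $x_i\in X_i+\eta\mathbb B$ and each $\xi$, the lower-level problem is solvable, $\tilde h_i(x_i,\cdot,\xi)$ is $L_i^y$-Lipschitz on $Y_i$, and $\tilde F_i(x_i,\cdot,\xi)$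 is $\mu_i$-strongly monotone on $Y_i$, $\mu_i>0$. (d) For $x_i\in X_i+\eta\mathbb B$, $y\in Y_i$: $\|\mathbb E\tilde F_i(x_i,y,\xi)\|\le c_{F_i}$ and $\mathbb E\|\tilde F_i(x_i,y,\xi)-\mathbb E\tilde F_i(x_i,y,\xi)\|^2\le v_i^2$. With $\alpha_0>1/(2\mu_i)$ for all $i$, $\Gamma>0$ and $y_i^0\in Y_i$, $$\max_i\max\Big\{\tfrac{(c_{F_i}^2+v_i^2)\alpha_0^2}{2\mu_i\alpha_0-1},\ \Gamma\sup_{y\in Y_i}\|y_i^0-y\|^2\Big\}\le c_{\max}<\infty .$$ (e) Write $L_{\max}=\max_iL_i$, $L^y_{\max}=\max_iL^y_i$, $n_{\max}=\max_in_i$. Then $L_{\max},L_{\max}^y\ge\ell>0$. *Algorithm.* Fix $\delta>0$, $t_k=\lceil(k+1)^{1+\delta}\rceil$, $\epsilon^{\mathrm{up}}>0$ with $c_{\max}/(t_k+\Gamma)\le\epsilon^{\mathrm{up}}$ for all $k\ge0$, and $L^{\mathrm{HI}}(\eta)=L_m^1+L_{\max}\sqrt{n_{\max}N}/\eta$, $D^{\mathrm{HI}}(\eta)^2=(\max_XP^{\mathrm{HI},\eta}-\min_XP^{\mathrm{HI},\eta})/L^{\mathrm{HI}}(\eta)$,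 $(\sigma^{\mathrm{HI}})^2=4n_{\max}^2(L^y_{\max})^2\epsilon^{\mathrm{up}}/\eta^2+64\sqrt{2\pi}L_{\max}^2n_{\max}+2\sigma_m^2$, $\gamma=1/(2L^{\mathrm{HI}}(\eta))$. Given a budget of $M_0$ zeroth-order calls (values of $\tilde h_i$) and $M_1$ first-order calls (values of $\nabla_{x_i}\tilde m_i$), let $B=\min\{M_0/2,M_1\}$, $S=\lceil\sigma^{\mathrm{HI}}\sqrt{6B}/(4L^{\mathrm{HI}}(\eta)D^{\mathrm{HI}}(\eta))\rceil$, $T=\min\{\lfloor M_0/(2SN)\rfloor,\lfloor M_1/(SN)\rfloor\}$. Let $R$ be uniform on $\{1,\dots,T\}$. From a fixed $x^0\in X$, iterate for $k=0,\dots,R-1$ and all $i$: $x_i^{k+1}=\Pi_{X_i}[x_i^k-\gamma\Delta_i^k]$, where $\Delta_i^k$ is the average over $l=1,\dots,S$ of $$\tfrac{n_i}{2\eta}\big(\tilde h_i(x_i^k+v,\hat y_+,\xi)-\tilde h_i(x_i^k-v,\hat y_-,\xi)\big)\tfrac{v}{\|v\|}+\nabla_{x_i}\tilde m_i(x^k,\xi),$$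 with fresh $\xi=\xi^k_{i,l}$ and $v=v^k_{i,l}$ uniform on the sphere of radius $\eta$ in $\mathbb R^{n_i}$. Here $\hat y_\pm=y^{t_k}$ is obtained from $y^0=y_i^0$ by the $t_k$ steps $y^{t+1}=\Pi_{Y_i}[y^t-\tfrac{\alpha_0}{t+\Gamma}\tilde F_i(x_i^k\pm v,y^t,\xi^t)]$, with fresh samples $\xi^t$ in each run. All draws, including $R$, are independent. The output is $x^R$. *Claim.* Put $\mathcal L_{\max}^2=L_{\max}(L_{\max}^y)^2(L_{\max}^y+L_{\max})$. There is a constant $C$, depending only on $\delta,L_m^0,L_m^1,D_X,\sigma_m,c_{\max},\Gamma,\epsilon^{\mathrm{up}},p,\ell$, such that for every such game, every $\eta\in(0,1]$ for which the assumptions hold, and every $\epsilon\in(0,1]$, there is an $M\in\mathbb N$ such that for all budgets with $\min\{M_0/2,M_1\}\ge M$ one has $T\ge1$, the calls stay within the budgets, and $\mathbb E\|G_\gamma^{\mathrm{HI},\eta}(x^R)\|\le\epsilon$; and for $M_0=2M$, $M_1=M$: (i) the upper-level sample complexity satisfies $M_0+M_1=3M\le C\,\mathcal L_{\max}^4n_{\max}^{13/2}N^5\eta^{-7}\epsilon^{-4}$;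 (ii) the upper-level iteration complexity satisfies $T\le C\,\mathcal L_{\max}^2L_{\max}n_{\max}^{7/2}N^2\eta^{-4}\epsilon^{-2}$; (iii) the total numbers of lower-level samples and of lower-level iterations are both at most $C\,\mathcal L_{\max}^{8+2\delta}L_{\max}^{1/2+\delta}(L_{\max}^y)^{-2}n_{\max}^{45/4+7\delta/2}N^{29/4+2\delta}\eta^{-(12+4\delta)}\epsilon^{-(6+2\delta)}$. -/

import Mathlib

open MeasureTheory ProbabilityTheory Filter Topology
open scoped Pointwise RealInnerProductSpace

noncomputable section

namespace HierarchicalGame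

/-- Euclidean space `ℝ^d`. -/
abbrev Vec (d : ℕ) : Type := EuclideanSpace ℝ (Fin d)

/-- The space of strategy profiles `x = (x₁, …, x_N)`, `x_i ∈ ℝ^{n_i}`, with its Euclidean norm. -/
abbrev Profile {N : ℕ} (n : Fin N → ℕ) : Type := PiLp 2 (fun i : Fin N => Vec (n i))

/-- The profile `(z, x_{-i})`. -/
def deviate {N : ℕ} {n : Fin N → ℕ} (x : Profile n) (i : Fin N) (z : Vec (n i)) : Profile n :=
  WithLp.toLp 2 (Function.update x.ofLp i z)

/-- A nearest point of `K` to `x`: the Euclidean projection `Π_K[x]` (unique when `K` is nonempty,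
closed and convex). -/
def proj {E : Type*} [NormedAddCommGroup E] (K : Set E) (x : E) : E :=
  Classical.epsilon (fun p => p ∈ K ∧ ∀ q ∈ K, ‖x - p‖ ≤ ‖x - q‖)

/-- Solution set of the variational inequality `VI(K, Φ)`. -/
def solVI {d : ℕ} (K : Set (Vec d)) (Φ : Vec d → Vec d) : Set (Vec d) :=
  {y | y ∈ K ∧ ∀ z ∈ K, 0 ≤ ⟪Φ y, z - y⟫}

/-- Randomized smoothing `f^η(x) = 𝔼[f(x + η u)]`, `u` uniform on the closed unit ball. -/
def smoothing {d : ℕ} (η : ℝ) (f : Vec d → ℝ) (x : Vec d) : ℝ :=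
  ⨍ u in Metric.closedBall (0 : Vec d) 1, f (x + η • u)

/-- The uniform probability distribution on the sphere of radius `η` centered at `0`. -/
def sphereLaw (d : ℕ) (η : ℝ) : Measure (Vec d) :=
  Measure.map (fun u : Metric.sphere (0 : Vec d) 1 => η • (u : Vec d))
    (((volume : Measure (Vec d)).toSphere Set.univ)⁻¹ • (volume : Measure (Vec d)).toSphere)

/-! ### The game -/

/-- Data of a stochastic `N`-player hierarchical game. -/
structure Game (N : ℕ) (Ξ : Type*) [MeasurableSpace Ξ] where
  /-- law of the random variable `ξ` -/
  law : Measure Ξ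
  /-- dimension of the decision of player `i` -/
  n : Fin N → ℕ
  /-- dimension of the lower-level variable of player `i` -/
  d : Fin N → ℕ
  /-- strategy sets -/
  X : ∀ i, Set (Vec (n i))
  /-- lower-level feasible sets -/
  Y : ∀ i, Set (Vec (d i))
  /-- the integrand of the private hierarchical term -/
  h : ∀ i, Vec (n i) → Vec (d i) → Ξ → ℝ
  /-- the integrand of the coupling term -/
  m : Fin N → Profile n → Ξ → ℝ
  /-- the integrand of the lower-level map -/
  F : ∀ i, Vec (n i) → Vec (d i) → Ξ → Vec (d i)

namespace Game

variable {N : ℕ} {Ξ : Type*} [MeasurableSpace Ξ] (G : Game N Ξ)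

/-- `X = ∏ X_i`. -/
def feasible : Set (Profile G.n) := {x | ∀ i, x i ∈ G.X i}

/-- `X_i + η 𝔹`. -/
def enlarged (η : ℝ) (i : Fin N) : Set (Vec (G.n i)) := G.X i + Metric.closedBall 0 η

/-- The expected lower-level map `𝔼[F̃_i(x_i, y, ξ)]`. -/
def meanF (i : Fin N) (x : Vec (G.n i)) (y : Vec (G.d i)) : Vec (G.d i) :=
  ∫ ξ, G.F i x y ξ ∂G.law

/-- The lower-level solution set at `x_i`. -/
def lowerSol (i : Fin N) (x : Vec (G.n i)) : Set (Vec (G.d i)) := solVI (G.Y i) (G.meanF i x)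

/-- The lower-level solution `y_i(x_i)` (an element of `lowerSol i x` whenever there is one). -/
def y (i : Fin N) (x : Vec (G.n i)) : Vec (G.d i) :=
  Classical.epsilon (fun z => z ∈ G.lowerSol i x)

/-- The implicit function `h_i(x_i, y_i(x_i)) = 𝔼[h̃_i(x_i, y_i(x_i), ξ)]`. -/
def hval (i : Fin N) (x : Vec (G.n i)) : ℝ := ∫ ξ, G.h i x (G.y i x) ξ ∂G.law

/-- `m_i(x) = 𝔼[m̃_i(x, ξ)]`. -/
def mval (i : Fin N) (x : Profile G.n) : ℝ := ∫ ξ, G.m i x ξ ∂G.law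

/-- `∇_{x_i} m̃_i(x_i, x_{-i}, ξ)`. -/
def gradM (i : Fin N) (x : Profile G.n) (ξ : Ξ) : Vec (G.n i) :=
  gradient (fun z => G.m i (deviate x i z) ξ) (x i)

/-- Objective of player `i` in the smoothed game,
`f_i^{HI,η}(x) = h_i^η(x_i, y_i(x_i)) + m_i(x)`. -/
def fSmooth (η : ℝ) (i : Fin N) (x : Profile G.n) : ℝ :=
  smoothing η (G.hval i) (x i) + G.mval i x

/-- `F^{HI,η}(x) = (∇_{x_i} f_i^{HI,η}(x_i, x_{-i}))_i`. -/
def gradMap (η : ℝ) (x : Profile G.n) : Profile G.n :=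
  WithLp.toLp 2 (fun i => gradient (fun z => G.fSmooth η i (deviate x i z)) (x i))

/-- The residual `G_γ^{HI,η}(x) = (x - Π_X[x - γ F^{HI,η}(x)]) / γ`. -/
def residual (η γ : ℝ) (x : Profile G.n) : Profile G.n :=
  γ⁻¹ • (x - proj G.feasible (x - γ • G.gradMap η x))

/-- `P` is a potential function, over `∏ X_i`, of the game with objectives `f_i`. -/
def IsPotential (f : Fin N → Profile G.n → ℝ) (P : Profile G.n → ℝ) : Prop :=
  ∀ x ∈ G.feasible, ∀ i, ∀ z ∈ G.X i, P (deviate x i z) - P x = f i (deviate x i z) - f i x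

/-- `P^{HI,η}(x) = P_m(x) + ∑ h_i^η(x_i, y_i(x_i))`. -/
def potential (η : ℝ) (Pm : Profile G.n → ℝ) (x : Profile G.n) : ℝ :=
  Pm x + ∑ i, smoothing η (G.hval i) (x i)

/-- `P^{HI,η}_max - P^{HI,η}_min`, over `X`. -/
def potentialGap (η : ℝ) (Pm : Profile G.n → ℝ) : ℝ :=
  sSup (G.potential η Pm '' G.feasible) - sInf (G.potential η Pm '' G.feasible)

/-- `n_max`. -/
def nMax : ℕ := Finset.univ.sup G.n

end Game

/-! ### Parameters and assumptions -/

/-- The constants hidden in the `O`-notation. -/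
structure HiddenConstants where
  /-- exponent in the number of lower-level iterations -/
  δ : ℝ
  /-- Lipschitz constant of `P_m` -/
  Lm0 : ℝ
  /-- Lipschitz constant of `∇ P_m` -/
  Lm1 : ℝ
  /-- diameter of `X` -/
  DX : ℝ
  /-- standard deviation of `∇ m̃_i` -/
  σm : ℝ
  /-- constant in the lower-level error bound -/
  cmax : ℝ
  /-- offset of the lower-level stepsizes -/
  Γ : ℝ
  /-- uniform bound on the lower-level inexactness -/
  εup : ℝ
  /-- positive lower bound on the variation of the potential -/
  gap : ℝ
  /-- positive lower bound on the largest Lipschitz constants -/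
  Lmin : ℝ
  δ_pos : 0 < δ
  Lm0_nonneg : 0 ≤ Lm0
  Lm1_nonneg : 0 ≤ Lm1
  DX_pos : 0 < DX
  σm_pos : 0 < σm
  cmax_pos : 0 < cmax
  Γ_pos : 0 < Γ
  εup_pos : 0 < εup
  gap_pos : 0 < gap
  Lmin_pos : 0 < Lmin

/-- `t_k = ⌈(k+1)^{1+δ}⌉`. -/
def lowerIters (δ : ℝ) (k : ℕ) : ℕ := ⌈((k : ℝ) + 1) ^ (1 + δ)⌉₊

/-- Problem parameters attached to a game, and the inputs of the algorithm. -/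
structure Params {N : ℕ} {Ξ : Type*} [MeasurableSpace Ξ] (G : Game N Ξ) where
  /-- Lipschitz constants of `h̃_i(•, y_i(•), ξ)` -/
  L : Fin N → ℝ
  /-- Lipschitz constants of `h̃_i(x_i, •, ξ)` -/
  Ly : Fin N → ℝ
  /-- strong monotonicity constants of the lower level -/
  μ : Fin N → ℝ
  /-- bounds on `‖𝔼[F̃_i]‖` -/
  cF : Fin N → ℝ
  /-- standard deviations of `F̃_i` -/
  vF : Fin N → ℝ
  /-- the smooth part of the potential -/
  Pm : Profile G.n → ℝ
  /-- starting point of the upper level -/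
  x0 : Profile G.n
  /-- starting points of the lower level -/
  y0 : ∀ i, Vec (G.d i)
  /-- lower-level stepsize numerator -/
  α0 : ℝ

section Derived

variable {N : ℕ} {Ξ : Type*} [MeasurableSpace Ξ] {G : Game N Ξ}

/-- `L_max`. -/
def Params.Lmax (Q : Params G) : ℝ := ⨆ i, Q.L i

/-- `L^y_max`. -/
def Params.LyMax (Q : Params G) : ℝ := ⨆ i, Q.Ly i

/-- `𝓛_max`, where `𝓛_max² = L_max (L^y_max)² (L^y_max + L_max)`. -/
def Params.scriptL (Q : Params G) : ℝ :=
  Real.sqrt (Q.Lmax * Q.LyMax ^ 2 * (Q.LyMax + Q.Lmax))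

/-- `L^{HI}(η) = L_m^1 + L_max √n_max √N / η`. -/
def Params.LHI (Q : Params G) (K : HiddenConstants) (η : ℝ) : ℝ :=
  K.Lm1 + Q.Lmax * Real.sqrt G.nMax * Real.sqrt N / η

/-- `D^{HI}(η) = ((P_max - P_min) / L^{HI}(η))^{1/2}`. -/
def Params.DHI (Q : Params G) (K : HiddenConstants) (η : ℝ) : ℝ :=
  Real.sqrt (G.potentialGap η Q.Pm / Q.LHI K η)

/-- `σ^{HI}`. -/
def Params.σHI (Q : Params G) (K : HiddenConstants) (η : ℝ) : ℝ :=
  Real.sqrt (4 * (G.nMax : ℝ) ^ 2 * Q.LyMax ^ 2 * K.εup / η ^ 2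
    + 64 * Real.sqrt (2 * Real.pi) * Q.Lmax ^ 2 * G.nMax + 2 * K.σm ^ 2)

/-- The stepsize `γ = 1 / (2 L^{HI}(η))`. -/
def Params.γ (Q : Params G) (K : HiddenConstants) (η : ℝ) : ℝ := 1 / (2 * Q.LHI K η)

/-- `M = min {M₀/2, M₁}` for a budget of `M₀` zeroth-order and `M₁` first-order calls. -/
def budget (M0 M1 : ℕ) : ℝ := min ((M0 : ℝ) / 2) M1

/-- The batch size `S = ⌈σ^{HI} √(6M) / (4 L^{HI}(η) D^{HI}(η))⌉`. -/
def Params.batch (Q : Params G) (K : HiddenConstants) (η : ℝ) (M0 M1 : ℕ) : ℕ :=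
  ⌈Q.σHI K η * Real.sqrt (6 * budget M0 M1) / (4 * Q.LHI K η * Q.DHI K η)⌉₊

/-- The iteration limit `T = min {⌊(M₀/2)/(SN)⌋, ⌊M₁/(SN)⌋}`. -/
def Params.horizon (Q : Params G) (K : HiddenConstants) (η : ℝ) (M0 M1 : ℕ) : ℕ :=
  min ⌊((M0 : ℝ) / 2) / ((Q.batch K η M0 M1 : ℝ) * N)⌋₊
    ⌊(M1 : ℝ) / ((Q.batch K η M0 M1 : ℝ) * N)⌋₊

end Derived

/-- The standing assumptions on the game, at smoothing parameter `η`. -/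
structure Assumptions {N : ℕ} {Ξ : Type*} [MeasurableSpace Ξ] (G : Game N Ξ) (Q : Params G)
    (K : HiddenConstants) (η : ℝ) : Prop where
  prob : IsProbabilityMeasure G.law
  players : 1 ≤ N
  dims : ∀ i, 1 ≤ G.n i
  -- feasible sets
  X_convex : ∀ i, Convex ℝ (G.X i)
  X_compact : ∀ i, IsCompact (G.X i)
  X_diam : Metric.diam G.feasible ≤ K.DX
  Y_convex : ∀ i, Convex ℝ (G.Y i)
  Y_closed : ∀ i, IsClosed (G.Y i)
  x0_mem : Q.x0 ∈ G.feasible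
  y0_mem : ∀ i, Q.y0 i ∈ G.Y i
  -- measurability of the stochastic oracles
  h_meas : ∀ i, Measurable
    (fun p : (G.enlarged η i × G.Y i) × Ξ => G.h i p.1.1 p.1.2 p.2)
  F_meas : ∀ i, Measurable
    (fun p : (G.enlarged η i × G.Y i) × Ξ => G.F i p.1.1 p.1.2 p.2)
  gradM_meas : ∀ i, Measurable (fun p : G.feasible × Ξ => G.gradM i p.1 p.2)
  -- the lower-level problem has a solution
  lower_solvable : ∀ i, ∀ x ∈ G.enlarged η i, (G.lowerSol i x).Nonempty
  -- `h̃_i(•, y_i(•), ξ)` is `L_i`-Lipschitz on an open set containing `X_i + η 𝔹`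
  L_nonneg : ∀ i, 0 ≤ Q.L i
  h_lip : ∀ i, ∃ O : Set (Vec (G.n i)), IsOpen O ∧ G.enlarged η i ⊆ O ∧
    (∀ x ∈ O, Integrable (fun ξ => G.h i x (G.y i x) ξ) G.law) ∧
    ∀ ξ, ∀ x ∈ O, ∀ x' ∈ O,
      |G.h i x (G.y i x) ξ - G.h i x' (G.y i x') ξ| ≤ Q.L i * ‖x - x'‖
  -- `m̃_i(•, x_{-i}, ξ)` is continuously differentiable
  m_smooth : ∀ i, ∀ x ∈ G.feasible, ∀ ξ,
    ContDiffAt ℝ 1 (fun z => G.m i (deviate x i z) ξ) (x i)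
  m_integrable : ∀ i, ∀ x ∈ G.feasible,
    ∀ᶠ z in 𝓝 (x i), Integrable (fun ξ => G.m i (deviate x i z) ξ) G.law
  -- potentiality
  is_potential : G.IsPotential (G.fSmooth η) (G.potential η Q.Pm)
  Pm_lip : ∀ x ∈ G.feasible, ∀ x' ∈ G.feasible, |Q.Pm x - Q.Pm x'| ≤ K.Lm0 * ‖x - x'‖
  Pm_diff : ∀ x ∈ G.feasible, DifferentiableAt ℝ Q.Pm x
  Pm_smooth : ∀ x ∈ G.feasible, ∀ x' ∈ G.feasible,
    ‖gradient Q.Pm x - gradient Q.Pm x'‖ ≤ K.Lm1 * ‖x - x'‖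
  gap_le : K.gap ≤ G.potentialGap η Q.Pm
  -- unbiasedness and bounded second moment of `∇ m̃_i`
  gradM_memLp : ∀ i, ∀ x ∈ G.feasible, MemLp (G.gradM i x) 2 G.law
  unbiased : ∀ i, ∀ x ∈ G.feasible,
    HasGradientAt (fun z => G.mval i (deviate x i z)) (∫ ξ, G.gradM i x ξ ∂G.law) (x i)
  second_moment : ∀ i, ∀ x ∈ G.feasible,
    ∫ ξ, ‖G.gradM i x ξ - gradient (fun z => G.mval i (deviate x i z)) (x i)‖ ^ 2 ∂G.law
      ≤ K.σm ^ 2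
  -- strong monotonicity of the lower level
  μ_pos : ∀ i, 0 < Q.μ i
  strong_mono : ∀ i, ∀ x ∈ G.enlarged η i, ∀ ξ, ∀ y ∈ G.Y i, ∀ y' ∈ G.Y i,
    Q.μ i * ‖y - y'‖ ^ 2 ≤ ⟪G.F i x y ξ - G.F i x y' ξ, y - y'⟫
  -- Lipschitz continuity in the lower-level variable
  Ly_nonneg : ∀ i, 0 ≤ Q.Ly i
  h_lip_y : ∀ i, ∀ x ∈ G.enlarged η i, ∀ ξ, ∀ y ∈ G.Y i, ∀ y' ∈ G.Y i,
    |G.h i x y ξ - G.h i x y' ξ| ≤ Q.Ly i * ‖y - y'‖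
  -- lower-level oracle: bounded mean and bounded variance
  F_memLp : ∀ i, ∀ x ∈ G.enlarged η i, ∀ y ∈ G.Y i, MemLp (G.F i x y) 2 G.law
  F_mean : ∀ i, ∀ x ∈ G.enlarged η i, ∀ y ∈ G.Y i, ‖G.meanF i x y‖ ≤ Q.cF i
  F_var : ∀ i, ∀ x ∈ G.enlarged η i, ∀ y ∈ G.Y i,
    ∫ ξ, ‖G.F i x y ξ - G.meanF i x y‖ ^ 2 ∂G.law ≤ Q.vF i ^ 2
  -- lower-level stepsizes, `c_max` and `ε^up`
  α0_large : ∀ i, 1 / (2 * Q.μ i) < Q.α0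
  cmax_var : ∀ i, (Q.cF i ^ 2 + Q.vF i ^ 2) * Q.α0 ^ 2 / (2 * Q.μ i * Q.α0 - 1) ≤ K.cmax
  cmax_init : ∀ i, ∀ y ∈ G.Y i, K.Γ * ‖Q.y0 i - y‖ ^ 2 ≤ K.cmax
  εup_le : ∀ k : ℕ, K.cmax / ((lowerIters K.δ k : ℝ) + K.Γ) ≤ K.εup
  -- the Lipschitz constants are bounded away from zero
  Lmin_le_Lmax : K.Lmin ≤ Q.Lmax
  Lmin_le_LyMax : K.Lmin ≤ Q.LyMax

/-! ### The algorithm -/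

/-- State of the lower-level scheme: current point, samples drawn, iterations done. -/
structure LowerState (d : ℕ) where
  point : Vec d
  samples : ℕ
  iters : ℕ

/-- `t` steps of the lower-level stochastic approximation scheme
`y^{t+1} = Π_Y[y^t - α_t F̃(y^t, ξ^t)]`, `α_t = α₀ / (t + Γ)`. -/
def lowerRun {d : ℕ} {Ξ : Type*} (Y : Set (Vec d)) (F : Vec d → Ξ → Vec d) (α0 Γ : ℝ)
    (y0 : Vec d) (ζ : ℕ → Ξ) : ℕ → LowerState d
  | 0 => ⟨y0, 0, 0⟩
  | t + 1 =>
    let s := lowerRun Y F α0 Γ y0 ζ t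
    ⟨proj Y (s.point - (α0 / ((t : ℝ) + Γ)) • F s.point (ζ t)), s.samples + 1, s.iters + 1⟩

/-- The random draws of the algorithm: samples `ξ^k_{i,l}`, directions `v^k_{i,l}`, lower-level
samples `ζ^{k,t}_{i,l,±}` (a fresh stream for each lower-level call), and the index `R`. -/
structure Draws {N : ℕ} (n : Fin N → ℕ) (Ξ Ω : Type*) where
  ξ : ℕ → Fin N → ℕ → Ω → Ξ
  v : ℕ → (i : Fin N) → ℕ → Ω → Vec (n i)
  ζ : ℕ → Fin N → ℕ → Bool → ℕ → Ω → Ξ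
  R : Ω → ℕ

/-- Names of the individual draws. -/
inductive DrawName (N : ℕ) : Type where
  | sample (k : ℕ) (i : Fin N) (l : ℕ)
  | direction (k : ℕ) (i : Fin N) (l : ℕ)
  | lower (k : ℕ) (i : Fin N) (l : ℕ) (b : Bool) (t : ℕ)
  | index

/-- The σ-algebra generated by one draw. -/
@[reducible]
def Draws.sigma {N : ℕ} {n : Fin N → ℕ} {Ξ Ω : Type*} [MeasurableSpace Ξ] (D : Draws n Ξ Ω) :
    DrawName N → MeasurableSpace Ω
  | .sample k i l => MeasurableSpace.comap (D.ξ k i l) inferInstance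
  | .direction k i l => MeasurableSpace.comap (D.v k i l) inferInstance
  | .lower k i l b t => MeasurableSpace.comap (D.ζ k i l b t) inferInstance
  | .index => MeasurableSpace.comap D.R ⊤

/-- The draws are mutually independent; samples follow `law`, the directions of player `i` are
uniform on the sphere of radius `η` in `ℝ^{n_i}`, and `R` is uniform on `{1, …, T}`. -/
structure Draws.Valid {N : ℕ} {n : Fin N → ℕ} {Ξ Ω : Type*} [MeasurableSpace Ξ]
    [MeasurableSpace Ω] (D : Draws n Ξ Ω) (P : Measure Ω) (law : Measure Ξ) (η : ℝ) (T : ℕ) :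
    Prop where
  ξ_meas : ∀ k i l, Measurable (D.ξ k i l)
  v_meas : ∀ k i l, Measurable (D.v k i l)
  ζ_meas : ∀ k i l b t, Measurable (D.ζ k i l b t)
  R_meas : Measurable D.R
  ξ_law : ∀ k i l, P.map (D.ξ k i l) = law
  v_law : ∀ k i l, P.map (D.v k i l) = sphereLaw (n i) η
  ζ_law : ∀ k i l b t, P.map (D.ζ k i l b t) = law
  R_law : ∀ k ∈ Finset.Icc 1 T, P (D.R ⁻¹' {k}) = (T : ENNReal)⁻¹
  indep : iIndep D.sigma P

/-- State of the upper-level scheme: the iterate, and counters for upper-level iterations,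
zeroth-order calls, first-order calls, lower-level samples and lower-level iterations. -/
structure UpperState {N : ℕ} (n : Fin N → ℕ) where
  x : Profile n
  iters : ℕ
  zo : ℕ
  fo : ℕ
  lowerSamples : ℕ
  lowerIters : ℕ

section Algorithm

variable {N : ℕ} {Ξ Ω : Type*} [MeasurableSpace Ξ] {G : Game N Ξ}

/-- The evaluation point `x^k_i + v^k_{i,l}` (`b = true`) or `x^k_i - v^k_{i,l}` (`b = false`). -/
def evalPoint (D : Draws G.n Ξ Ω) (ω : Ω) (k : ℕ) (x : Profile G.n) (i : Fin N) (l : ℕ)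
    (b : Bool) : Vec (G.n i) :=
  if b then x i + D.v k i l ω else x i - D.v k i l ω

/-- The lower-level call at an evaluation point, with `t_k` iterations. -/
def lowerCall (Q : Params G) (K : HiddenConstants) (D : Draws G.n Ξ Ω) (ω : Ω) (k : ℕ)
    (x : Profile G.n) (i : Fin N) (l : ℕ) (b : Bool) : LowerState (G.d i) :=
  lowerRun (G.Y i) (G.F i (evalPoint D ω k x i l b)) Q.α0 K.Γ (Q.y0 i)
    (fun t => D.ζ k i l b t ω) (lowerIters K.δ k)

/-- The inexact value `h̃_i(x̂, y_i^{ε_k}(x̂), ξ^k_{i,l})`: one zeroth-order call. -/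
def zoValue (Q : Params G) (K : HiddenConstants) (D : Draws G.n Ξ Ω) (ω : Ω) (k : ℕ)
    (x : Profile G.n) (i : Fin N) (l : ℕ) (b : Bool) : ℝ :=
  G.h i (evalPoint D ω k x i l b) (lowerCall Q K D ω k x i l b).point (D.ξ k i l ω)

/-- The two-point estimator `Δ^{k,h}_{i,l,ε_k}`. -/
def deltaH (Q : Params G) (K : HiddenConstants) (η : ℝ) (D : Draws G.n Ξ Ω) (ω : Ω) (k : ℕ)
    (x : Profile G.n) (i : Fin N) (l : ℕ) : Vec (G.n i) :=
  ((G.n i : ℝ) / (2 * η) * (zoValue Q K D ω k x i l true - zoValue Q K D ω k x i l false)) •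
    (‖D.v k i l ω‖⁻¹ • D.v k i l ω)

/-- The mini-batch gradient `Δ^{k,f}_{i,S,ε_k}`. -/
def deltaF (Q : Params G) (K : HiddenConstants) (η : ℝ) (S : ℕ) (D : Draws G.n Ξ Ω) (ω : Ω)
    (k : ℕ) (x : Profile G.n) (i : Fin N) : Vec (G.n i) :=
  (S : ℝ)⁻¹ • ∑ l ∈ Finset.range S, deltaH Q K η D ω k x i l
    + (S : ℝ)⁻¹ • ∑ l ∈ Finset.range S, G.gradM i x (D.ξ k i l ω)

/-- The biased randomized smoothed scheme with batch size `S`: the state after `k` upper-level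
iterations. -/
def upperRun (Q : Params G) (K : HiddenConstants) (η : ℝ) (S : ℕ) (D : Draws G.n Ξ Ω) (ω : Ω) :
    ℕ → UpperState G.n
  | 0 => ⟨Q.x0, 0, 0, 0, 0, 0⟩
  | k + 1 =>
    let s := upperRun Q K η S D ω k
    { x := WithLp.toLp 2 (fun i =>
        proj (G.X i) (s.x i - Q.γ K η • deltaF Q K η S D ω k s.x i))
      iters := s.iters + 1
      zo := s.zo + ∑ _i : Fin N, ∑ _l ∈ Finset.range S, 2
      fo := s.fo + ∑ _i : Fin N, ∑ _l ∈ Finset.range S, 1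
      lowerSamples := s.lowerSamples + ∑ i : Fin N, ∑ l ∈ Finset.range S, ∑ b : Bool,
        (lowerCall Q K D ω k s.x i l b).samples
      lowerIters := s.lowerIters + ∑ i : Fin N, ∑ l ∈ Finset.range S, ∑ b : Bool,
        (lowerCall Q K D ω k s.x i l b).iters }

/-- The state at termination: the loop stops after `R` iterations. -/
def output (Q : Params G) (K : HiddenConstants) (η : ℝ) (S : ℕ) (D : Draws G.n Ξ Ω) (ω : Ω) :
    UpperState G.n :=
  upperRun Q K η S D ω (D.R ω)

end Algorithm

end HierarchicalGame

end

open HierarchicalGame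

/-! ### Divergence theorem on the unit ball, by radial cutoffs. -/

namespace HierarchicalGame

/-! The scheme is projected gradient descent on the potential, run with an inexact gradient, and the
proof is the nonconvex descent argument with careful bookkeeping of the error.

Smoothness. For Lipschitz `g` the divergence theorem on the ball gives `∇ g^η(x) = (d/η²) 𝔼[g(x+v)
v]` with `v` uniform on the sphere of radius `η` (`hasGradientAt_smoothing`). A Cauchy–Schwarz
estimate makes this gradient Lipschitz with constant `C√d/η` (`norm_sphereGrad_sub_le`), and the
formula makes the two-point estimator with exact lower-level solutions unbiased
(`integral_integral_exactEst`). Hence the potential satisfies a descent inequality with constant `L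
= L^{HI}(η)` (`potential_le`).

Descent. One step with `γ = 1/(2L)` and gradient error `e_k` gives `‖G_γ(x^k)‖² ≤ 8L (P(x^k) -
P(x^{k+1})) + 6‖e_k‖²` (`norm_residual_sq_le`). Averaging over the independent uniform index
telescopes the potential, so `𝔼‖G_γ(x^R)‖²` is at most `T⁻¹ (8L·gap + 6 ∑ 𝔼‖e_k‖²)`
(`residual_output`).

Error. Given the past, the samples of a mini-batch are centered and mutually orthogonal, so the
noise has variance of order `V/S` (`noise_draw`). The bias comes from stopping the lower level after
`t_k` steps. A Robbins–Monro recursion bounds the mean-square lower-level error by `32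
c_max/(t_k+Γ)`, and since `t_k ≥ (k+1)^{1+δ}` the squared biases have a sum bounded independently of
`T` (`sum_biasBound_le`).

Arithmetic. As functions of the budget `B` alone, `S` and `T` are both of order `√B`, so the squared
residual is `O(B^{-1/2})` and a budget of order `ε⁻⁴` suffices, with `T` of order `ε⁻²`. Normalizing
`L_max`, `L^y_max` by their lower bound, and using `√n_max`, `√N`, `1/η`, `1/ε`, makes every
parameter at least `1`, so the required inequalities reduce to comparing exponents of monomials
(`budget_requirements`). The lower level makes at most `2·TSN ≤ 2B` runs, each of length at most
`2T^{1+δ}`.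

Two measure-theoretic points need care. The lower-level solution is measurable because it is a
pointwise limit of deterministic iterates (`measurable_y`). The oracles are measurable only over the
enlarged sets, so the directions are first altered on a null set to lie on the sphere for every
outcome (`Draws.fix`). -/

theorem integral_shell_homogeneous {d : ℕ} (hd : 1 ≤ d) (k : Vec d → ℝ) {a b : ℝ} (ha : 0 < a)
    (hab : a ≤ b) :
    ∫ u : Vec d, (Set.Ico a b).indicator (fun _ => (1 : ℝ)) ‖u‖ * k (‖u‖⁻¹ • u) =
      ((b ^ d - a ^ d) / d) * ∫ u, k u ∂(volume : Measure (Vec d)).toSphere := by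
  have : Nonempty (Fin d) := ⟨⟨0, hd⟩⟩
  set μ : Measure (Vec d) := volume
  have hfin : Module.finrank ℝ (Vec d) = d := by simp
  set f : Metric.sphere (0 : Vec d) 1 × Set.Ioi (0 : ℝ) → ℝ :=
    fun p => k p.1 * (Set.Ico a b).indicator (fun _ => (1 : ℝ)) p.2
  -- Polar coordinates turn Lebesgue measure off the origin into surface measure times `r^{d-1} dr`,
  -- and the integrand is a product. No integrability of `k` is needed, because `integral_prod_mul`
  -- is unconditional.
  have h1 : ∫ u : Vec d, (Set.Ico a b).indicator (fun _ => (1 : ℝ)) ‖u‖ * k (‖u‖⁻¹ • u) =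
      ∫ p, f p ∂(μ.toSphere.prod (Measure.volumeIoiPow (d - 1))) := by
    have := μ.measurePreserving_homeomorphUnitSphereProd.integral_comp
      (Homeomorph.measurableEmbedding _) f
    rw [hfin] at this
    rw [← this]
    have h2 := integral_subtype_comap (μ := μ) (measurableSet_singleton (0 : Vec d)).compl
      (fun u : Vec d => (Set.Ico a b).indicator (fun _ => (1 : ℝ)) ‖u‖ * k (‖u‖⁻¹ • u))
    rw [restrict_compl_singleton] at h2
    rw [← h2]
    refine integral_congr_ae (Eventually.of_forall fun x => ?_)
    simp [f, mul_comm]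
  rw [h1, integral_prod_mul (μ := μ.toSphere) (ν := Measure.volumeIoiPow (d - 1)) (fun p => k p)
    (fun r => (Set.Ico a b).indicator (fun _ => (1 : ℝ)) (r : ℝ)), mul_comm]
  congr 1
  have h3 : (fun r : Set.Ioi (0 : ℝ) => (Set.Ico a b).indicator (fun _ => (1 : ℝ)) (r : ℝ)) =
      (Set.Iio (⟨b, Set.mem_Ioi.2 (ha.trans_le hab)⟩ : Set.Ioi (0 : ℝ)) \ Set.Iio ⟨a, Set.mem_Ioi.2 ha⟩).indicator 1 := by
    ext r
    simp only [Set.indicator, Set.mem_Ico, Set.mem_sdiff, Set.mem_Iio, Pi.one_apply, ← Subtype.coe_lt_coe, not_lt]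
    congr 1
    simp [and_comm]
  rw [h3, integral_indicator_one (measurableSet_Iio.diff measurableSet_Iio), measureReal_sdiff
    (Set.Iio_subset_Iio (show (⟨a, Set.mem_Ioi.2 ha⟩ : Set.Ioi (0 : ℝ)) ≤ ⟨b, _⟩ from hab)) measurableSet_Iio
    (by rw [Measure.volumeIoiPow_apply_Iio]; exact ENNReal.ofReal_ne_top)]
  have hd' : ((d - 1 : ℕ) : ℝ) + 1 = d := by rw [Nat.cast_sub hd]; simp
  have hb := ha.trans_le hab
  simp only [measureReal_def, Measure.volumeIoiPow_apply_Iio, hd', Nat.sub_add_cancel hd]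
  rw [ENNReal.toReal_ofReal (by positivity), ENNReal.toReal_ofReal (by positivity)]
  ring

/-- Radial cutoff equal to `1` on the unit ball and to `0` outside the ball of radius `1 + ε`. -/
noncomputable def radialCutoff {d : ℕ} (ε : ℝ) (u : Vec d) : ℝ :=
  min 1 (max ((1 + ε - ‖u‖) / ε) 0)

theorem lipschitzWith_radialCutoff {d : ℕ} {ε : ℝ} (hε : 0 < ε) :
    LipschitzWith (Real.toNNReal ε⁻¹) (radialCutoff (d := d) ε) := by
  unfold radialCutoff
  refine LipschitzWith.const_min (LipschitzWith.max_const ?_ _) _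
  refine LipschitzWith.of_dist_le_mul fun x y => ?_
  rw [Real.coe_toNNReal _ (by positivity), Real.dist_eq, dist_eq_norm, ← sub_div, abs_div,
    abs_of_pos hε, div_eq_inv_mul]
  gcongr
  have : (1 + ε - ‖x‖) - (1 + ε - ‖y‖) = -(‖x‖ - ‖y‖) := by ring
  rw [this, abs_neg]
  exact abs_norm_sub_norm_le x y

theorem radialCutoff_of_le {d : ℕ} {ε : ℝ} (hε : 0 < ε) {u : Vec d} (hu : ‖u‖ ≤ 1) :
    radialCutoff ε u = 1 := by
  unfold radialCutoff
  refine min_eq_left (le_max_of_le_left ?_)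
  rw [le_div_iff₀ hε]; linarith

theorem radialCutoff_of_ge {d : ℕ} {ε : ℝ} (hε : 0 < ε) {u : Vec d} (hu : 1 + ε ≤ ‖u‖) :
    radialCutoff ε u = 0 := by
  unfold radialCutoff
  rw [max_eq_right, min_eq_right zero_le_one]
  exact div_nonpos_of_nonpos_of_nonneg (by linarith) hε.le

theorem radialCutoff_mem {d : ℕ} (ε : ℝ) (u : Vec d) : radialCutoff ε u ∈ Set.Icc (0 : ℝ) 1 :=
  ⟨le_min zero_le_one (le_max_right _ _), min_le_left _ _⟩

theorem hasCompactSupport_radialCutoff {d : ℕ} {ε : ℝ} (hε : 0 < ε) :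
    HasCompactSupport (radialCutoff (d := d) ε) := by
  refine HasCompactSupport.intro (isCompact_closedBall (0 : Vec d) (1 + ε)) fun u hu => ?_
  refine radialCutoff_of_ge hε ?_
  simp at hu; exact hu.le

/-- Off the two kink spheres the cutoff is locally constant or affine in `‖u‖`, so its derivative
lives on the shell. Integration by parts produces the direction `-e`, for which the sign is
positive. -/
theorem lineDeriv_radialCutoff {d : ℕ} {ε : ℝ} (hε : 0 < ε) (e u : Vec d) (h1 : ‖u‖ ≠ 1)
    (h2 : ‖u‖ ≠ 1 + ε) :
    lineDeriv ℝ (radialCutoff ε) u (-e) =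
      (Set.Ico 1 (1 + ε)).indicator (fun _ => (1 : ℝ)) ‖u‖ * (ε⁻¹ * ⟪‖u‖⁻¹ • u, e⟫) := by
  have hc : ContinuousAt (fun v : Vec d => ‖v‖) u := continuous_norm.continuousAt
  rcases lt_or_gt_of_ne h1 with h | h
  · rw [Set.indicator_of_notMem (by simp [h]), zero_mul]
    have : radialCutoff ε =ᶠ[𝓝 u] fun _ => 1 := by
      filter_upwards [hc.eventually_lt_const h] with v hv using radialCutoff_of_le hε hv.le
    rw [this.lineDeriv_eq]; simp [lineDeriv]
  rcases lt_or_gt_of_ne h2 with h' | h'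
  · rw [Set.indicator_of_mem (by simp [h.le, h']), one_mul]
    have : radialCutoff ε =ᶠ[𝓝 u] fun v => (1 + ε - ‖v‖) / ε := by
      filter_upwards [hc.eventually_const_lt h, hc.eventually_lt_const h'] with v hv hv'
      unfold radialCutoff
      rw [max_eq_left (div_nonneg (by linarith) hε.le), min_eq_right]
      rw [div_le_one hε]; linarith
    rw [this.lineDeriv_eq]
    have hu : u ≠ 0 := by rintro rfl; simp at h; linarith
    have hd : HasFDerivAt (fun v : Vec d => ‖v‖) (‖u‖⁻¹ • innerSL ℝ u) u := by
      have := (hasStrictFDerivAt_norm_sq u).hasFDerivAt.sqrt (by positivity)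
      simp only [Real.sqrt_sq (norm_nonneg _)] at this
      refine this.congr_fderiv ?_
      have := norm_pos_iff.2 hu
      ext v
      simp
      field_simp
    have hd2 := (((hd.const_sub (1 + ε)).mul_const ε⁻¹).hasLineDerivAt (-e)).lineDeriv
    simp only [div_eq_mul_inv]
    rw [hd2]
    simp [inner_smul_left]
  · rw [Set.indicator_of_notMem (by simp [h'.le]), zero_mul]
    have : radialCutoff ε =ᶠ[𝓝 u] fun _ => 0 := by
      filter_upwards [hc.eventually_const_lt h'] with v hv using radialCutoff_of_ge hε hv.le
    rw [this.lineDeriv_eq]; simp [lineDeriv]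

theorem tendsto_integral_mul_radialCutoff {d : ℕ} {φ : Vec d → ℝ} (hφ : LocallyIntegrable φ) :
    Tendsto (fun ε : ℝ => ∫ u, φ u * radialCutoff ε u) (𝓝[>] 0)
      (𝓝 (∫ u in Metric.closedBall 0 1, φ u)) := by
  rw [← integral_indicator measurableSet_closedBall]
  refine tendsto_integral_filter_of_dominated_convergence
    ((Metric.closedBall (0 : Vec d) 2).indicator fun u => ‖φ u‖) ?_ ?_ ?_ ?_
  · filter_upwards [self_mem_nhdsWithin] with ε hε
    exact hφ.aestronglyMeasurable.mul (lipschitzWith_radialCutoff hε).continuous.aestronglyMeasurable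
  · filter_upwards [Ioc_mem_nhdsGT zero_lt_one] with ε hε
    filter_upwards with u
    by_cases hu : u ∈ Metric.closedBall (0 : Vec d) 2
    · rw [Set.indicator_of_mem hu, norm_mul]
      refine mul_le_of_le_one_right (norm_nonneg _) ?_
      rw [Real.norm_eq_abs, abs_of_nonneg (radialCutoff_mem ε u).1]
      exact (radialCutoff_mem ε u).2
    · rw [Set.indicator_of_notMem hu, radialCutoff_of_ge hε.1]
      · simp
      · simp at hu; linarith [hε.2]
  · rw [integrable_indicator_iff measurableSet_closedBall]
    exact (hφ.integrableOn_isCompact (isCompact_closedBall _ _)).norm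
  · filter_upwards with u
    by_cases hu : u ∈ Metric.closedBall (0 : Vec d) 1
    · rw [Set.indicator_of_mem hu]
      refine tendsto_const_nhds.congr' ?_
      filter_upwards [self_mem_nhdsWithin] with ε hε
      rw [radialCutoff_of_le hε (by simpa using hu), mul_one]
    · rw [Set.indicator_of_notMem hu]
      refine tendsto_const_nhds.congr' ?_
      simp at hu
      filter_upwards [Ioc_mem_nhdsGT (sub_pos.2 hu)] with ε hε
      rw [radialCutoff_of_ge hε.1 (by linarith [hε.2]), mul_zero]

/-- Replacing `g u` by its value at `‖u‖⁻¹ • u` makes the shell integral exactly computable, as `q ε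
* I` with `q ε → 1`. The replacement costs at most `C ε` pointwise, which cancels the factor `ε⁻¹`;
what remains is the volume of the shell, of order `ε`. -/
theorem tendsto_integral_lineDeriv_radialCutoff {d : ℕ} (hd : 1 ≤ d) {C : NNReal}
    {g : Vec d → ℝ} (hg : LipschitzWith C g) (e : Vec d) :
    Tendsto (fun ε : ℝ => ∫ u, lineDeriv ℝ (radialCutoff ε) u (-e) * g u) (𝓝[>] 0)
      (𝓝 (∫ u, g u * ⟪(u : Vec d), e⟫ ∂(volume : Measure (Vec d)).toSphere)) := by
  have : Nonempty (Fin d) := ⟨⟨0, hd⟩⟩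
  have hd0 : (d : ℝ) ≠ 0 := by positivity
  set I := ∫ u, g u * ⟪(u : Vec d), e⟫ ∂(volume : Measure (Vec d)).toSphere
  set σ := ∫ _u, (1 : ℝ) ∂(volume : Measure (Vec d)).toSphere
  -- The difference quotient of `r ^ d / d` at `r = 1`, hence the limit `1`.
  set q : ℝ → ℝ := fun ε => ε⁻¹ * (((1 + ε) ^ d - 1) / d)
  have hq : Tendsto q (𝓝[>] 0) (𝓝 1) := by
    have h := ((hasDerivAt_id (0 : ℝ)).const_add 1).pow d
    have := (hasDerivWithinAt_iff_tendsto_slope' (by simp)).1 (h.hasDerivWithinAt (s := Set.Ioi 0))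
    have h2 := this.div_const (d : ℝ)
    simp only [id, add_zero, one_pow, mul_one, div_self hd0] at h2
    refine h2.congr fun ε => ?_
    simp [q, slope_def_field]
    ring
  have hε0 : Tendsto (fun ε : ℝ => ε) (𝓝[>] 0) (𝓝 0) := tendsto_nhdsWithin_of_tendsto_nhds tendsto_id
  have main : Tendsto (fun ε => q ε * I) (𝓝[>] 0) (𝓝 I) := by simpa using hq.mul_const I
  have err : Tendsto (fun ε => ε * (C * ‖e‖ * q ε * σ)) (𝓝[>] 0) (𝓝 0) := by
    simpa using hε0.mul ((hq.const_mul (C * ‖e‖ : ℝ)).mul_const σ)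
  refine tendsto_of_tendsto_of_dist main (squeeze_zero' (Eventually.of_forall fun _ => dist_nonneg)
    ?_ err)
  filter_upwards [self_mem_nhdsWithin] with ε hε
  have hε : 0 < ε := hε
  set χ : Vec d → ℝ := fun u => (Set.Ico 1 (1 + ε)).indicator (fun _ => (1 : ℝ)) ‖u‖
  have hχm : Measurable χ := (measurable_const.indicator measurableSet_Ico).comp measurable_norm
  have hχ01 : ∀ u, χ u = 0 ∨ (χ u = 1 ∧ 1 ≤ ‖u‖ ∧ ‖u‖ < 1 + ε) := by
    intro u
    by_cases h : ‖u‖ ∈ Set.Ico 1 (1 + ε)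
    · right; exact ⟨Set.indicator_of_mem h _, h⟩
    · left; exact Set.indicator_of_notMem h _
  have hint : ∀ f : Vec d → ℝ, Measurable f → (∃ B, ∀ u, 1 ≤ ‖u‖ → ‖u‖ < 1 + ε → |f u| ≤ B) →
      Integrable (fun u => χ u * f u) := by
    rintro f hf ⟨B, hB⟩
    refine Integrable.mono' (g := (Metric.closedBall (0 : Vec d) (1 + ε)).indicator fun _ => |B|) ?_
      (hχm.mul hf).aestronglyMeasurable (Eventually.of_forall fun u => ?_)
    · rw [integrable_indicator_iff measurableSet_closedBall]
      exact integrableOn_const (isCompact_closedBall _ _).measure_lt_top.ne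
    · rcases hχ01 u with h | ⟨h, h1, h2⟩
      · rw [h]; simp; exact Set.indicator_nonneg (fun _ _ => abs_nonneg _) _
      · rw [h, one_mul, Set.indicator_of_mem (by simpa using h2.le)]
        exact (hB u h1 h2).trans (le_abs_self B)
  have hunit : ∀ u : Vec d, 1 ≤ ‖u‖ → ‖‖u‖⁻¹ • u‖ = 1 := fun u hu => by
    rw [norm_smul, norm_inv, norm_norm, inv_mul_cancel₀ (by linarith)]
  have hin : ∀ u : Vec d, 1 ≤ ‖u‖ → |⟪‖u‖⁻¹ • u, e⟫| ≤ ‖e‖ := fun u hu => by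
    simpa [hunit u hu] using abs_real_inner_le_norm (‖u‖⁻¹ • u) e
  have hgb : ∀ u : Vec d, ‖u‖ ≤ 1 + ε → |g u| ≤ |g 0| + C * (1 + ε) := fun u hu => by
    have := hg.norm_sub_le u 0
    rw [sub_zero, Real.norm_eq_abs] at this
    have h2 : |g u| ≤ |g 0| + |g u - g 0| := by
      have := abs_add_le (g 0) (g u - g 0); simpa using this
    have : (C : ℝ) * ‖u‖ ≤ C * (1 + ε) := by gcongr
    linarith
  have hgc := hg.continuous
  have e1 : ∫ u, lineDeriv ℝ (radialCutoff ε) u (-e) * g u =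
      ∫ u, χ u * (ε⁻¹ * ⟪‖u‖⁻¹ • u, e⟫ * g u) := by
    refine integral_congr_ae ?_
    have s1 : ∀ r : ℝ, ∀ᵐ u : Vec d, ‖u‖ ≠ r := fun r => by
      have : (volume : Measure (Vec d)) (Metric.sphere 0 r) = 0 := Measure.addHaar_sphere _ _ _
      rw [ae_iff]
      convert this using 2
      ext u; simp
    filter_upwards [s1 1, s1 (1 + ε)] with u h1 h2
    rw [lineDeriv_radialCutoff hε e u h1 h2]
    simp only [χ]; ring
  have e2 : q ε * I = ∫ u, χ u * (ε⁻¹ * ⟪‖u‖⁻¹ • u, e⟫ * g (‖u‖⁻¹ • u)) := by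
    have := integral_shell_homogeneous hd (fun v => ε⁻¹ * (g v * ⟪v, e⟫)) one_pos
      (by linarith : (1 : ℝ) ≤ 1 + ε)
    rw [integral_const_mul] at this
    simp only [q, I, χ]
    rw [one_pow] at this
    calc _ = ((1 + ε) ^ d - 1) / (d : ℝ) * (ε⁻¹ * I) := by simp only [I]; ring
      _ = _ := by
        rw [← this]; congr 1; ext u; ring
  have hm1 : Measurable fun u : Vec d => ⟪‖u‖⁻¹ • u, e⟫ := by fun_prop
  have hm2 : Measurable fun u : Vec d => g (‖u‖⁻¹ • u) := hgc.measurable.comp (by fun_prop)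
  rw [e1, e2, Real.dist_eq, ← integral_sub]
  -- The shell formula again, for a constant: it evaluates the integral of the pointwise error bound
  -- `C ‖e‖`.
  · have e3 : C * ‖e‖ * q ε * σ * ε = ∫ u, χ u * (C * ‖e‖) := by
      have := integral_shell_homogeneous hd (fun _ => C * ‖e‖) one_pos
        (by linarith : (1 : ℝ) ≤ 1 + ε)
      rw [one_pow] at this
      simp only [χ]
      rw [this]
      have : ∫ _u, (C * ‖e‖ : ℝ) ∂(volume : Measure (Vec d)).toSphere = C * ‖e‖ * σ := by
        simp only [σ]; rw [← integral_const_mul]; simp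
      rw [this]; simp only [q]; field_simp
    rw [mul_comm ε, e3]
    refine abs_integral_le_integral_abs.trans (integral_mono_of_nonneg
      (Eventually.of_forall fun _ => abs_nonneg _) (hint _ measurable_const ⟨|C * ‖e‖|, fun _ _ _ => le_rfl⟩)
      (Eventually.of_forall fun u => ?_))
    simp only
    rcases hχ01 u with h | ⟨h, h1, h2⟩
    · simp [h]
    · simp only [h, one_mul]
      rw [← mul_sub, abs_mul, abs_mul, abs_of_pos (inv_pos.2 hε)]
      have hd1 : |g (‖u‖⁻¹ • u) - g u| ≤ C * ε := by
        refine (hg.norm_sub_le _ _).trans ?_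
        have hn : ‖u‖ ≠ 0 := by linarith
        have : ‖u‖⁻¹ • u - u = (1 - ‖u‖) • (‖u‖⁻¹ • u) := by
          rw [smul_smul, sub_mul, mul_inv_cancel₀ hn, one_mul, sub_smul, one_smul]
        rw [this, norm_smul, hunit u h1, mul_one, Real.norm_eq_abs, abs_sub_comm,
          abs_of_nonneg (by linarith)]
        gcongr; linarith
      calc ε⁻¹ * |⟪‖u‖⁻¹ • u, e⟫| * |g (‖u‖⁻¹ • u) - g u| ≤ ε⁻¹ * ‖e‖ * (C * ε) := by
            gcongr; exact hin u h1
        _ = C * ‖e‖ := by field_simp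
  · refine hint _ ((measurable_const.mul hm1).mul hm2) ⟨ε⁻¹ * ‖e‖ * (|g 0| + C * (1 + ε)), fun u h1 h2 => ?_⟩
    rw [abs_mul, abs_mul, abs_of_pos (inv_pos.2 hε)]
    gcongr
    · exact hin u h1
    · exact hgb _ (by rw [hunit u h1]; linarith)
  · refine hint _ ((measurable_const.mul hm1).mul hgc.measurable) ⟨ε⁻¹ * ‖e‖ * (|g 0| + C * (1 + ε)), fun u h1 h2 => ?_⟩
    rw [abs_mul, abs_mul, abs_of_pos (inv_pos.2 hε)]
    gcongr
    · exact hin u h1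
    · exact hgb _ h2.le

/-- Divergence theorem on the unit ball for Lipschitz functions. -/
theorem setIntegral_lineDeriv_closedBall {d : ℕ} (hd : 1 ≤ d) {C : NNReal}
    {g : Vec d → ℝ} (hg : LipschitzWith C g) (e : Vec d) :
    ∫ u in Metric.closedBall 0 1, lineDeriv ℝ g u e =
      ∫ u, g u * ⟪(u : Vec d), e⟫ ∂(volume : Measure (Vec d)).toSphere := by
  refine tendsto_nhds_unique (tendsto_integral_mul_radialCutoff
    (hg.locallyIntegrable_lineDeriv e)) ?_
  refine (tendsto_integral_lineDeriv_radialCutoff hd hg e).congr' ?_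
  filter_upwards [self_mem_nhdsWithin] with ε hε
  exact (hg.integral_lineDeriv_mul_eq (lipschitzWith_radialCutoff hε)
    (hasCompactSupport_radialCutoff hε) e).symm


/-! ### The law of the directions, and gradients of smoothed functions. -/

theorem sq_integral_le_integral_sq {α : Type*} [MeasurableSpace α] {P : Measure α}
    [IsProbabilityMeasure P] {f : α → ℝ} (hf : MemLp f 2 P) :
    (∫ a, f a ∂P) ^ 2 ≤ ∫ a, f a ^ 2 ∂P := by
  have h := variance_nonneg f P
  rw [variance_eq_sub hf] at h
  simpa using h

theorem integral_sphereLaw {d : ℕ} {F : Type*} [NormedAddCommGroup F]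
    [NormedSpace ℝ F] {η : ℝ} (hη : 0 < η) (f : Vec d → F) :
    ∫ v, f v ∂sphereLaw d η =
      ((d : ℝ) * (volume : Measure (Vec d)).real (Metric.ball 0 1))⁻¹ •
        ∫ u, f (η • (u : Vec d)) ∂(volume : Measure (Vec d)).toSphere := by
  have hemb : MeasurableEmbedding (fun u : Metric.sphere (0 : Vec d) 1 => η • (u : Vec d)) :=
    (measurableEmbedding_const_smul₀ hη.ne').comp
      (MeasurableEmbedding.subtype_coe Metric.isClosed_sphere.measurableSet)
  rw [sphereLaw, hemb.integral_map, integral_smul_measure]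
  simp [measureReal_def]

/-- Positive dimension is essential: for `d = 0` the unit sphere is empty and the normalized measure
is zero. -/
theorem isProbabilityMeasure_sphereLaw {d : ℕ} (hd : 1 ≤ d) (η : ℝ) :
    IsProbabilityMeasure (sphereLaw d η) := by
  have : Nonempty (Fin d) := ⟨⟨0, hd⟩⟩
  have hm : Measurable (fun u : Metric.sphere (0 : Vec d) 1 => η • (u : Vec d)) := by fun_prop
  constructor
  rw [sphereLaw, Measure.map_apply hm MeasurableSet.univ, Set.preimage_univ, Measure.smul_apply,
    smul_eq_mul, ENNReal.inv_mul_cancel]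
  · exact Measure.measure_univ_ne_zero.2 (Measure.toSphere_ne_zero _)
  · exact measure_ne_top _ _

theorem ae_norm_sphereLaw {d : ℕ} {η : ℝ} (hη : 0 < η) : ∀ᵐ v ∂sphereLaw d η, ‖v‖ = η := by
  have hm : Measurable (fun u : Metric.sphere (0 : Vec d) 1 => η • (u : Vec d)) := by fun_prop
  rw [sphereLaw, ae_map_iff hm.aemeasurable (measurableSet_eq_fun measurable_norm measurable_const)]
  refine Eventually.of_forall fun u => ?_
  rw [norm_smul, norm_eq_of_mem_sphere, mul_one, Real.norm_eq_abs, abs_of_pos hη]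

theorem integrable_sphereLaw {d : ℕ} (hd : 1 ≤ d) {F : Type*} [NormedAddCommGroup F]
    {η : ℝ} (hη : 0 < η) {f : Vec d → F} (hf : Continuous f) :
    Integrable f (sphereLaw d η) := by
  have := isProbabilityMeasure_sphereLaw hd η
  obtain ⟨B, hB⟩ := (isCompact_sphere (0 : Vec d) η).exists_bound_of_continuousOn hf.continuousOn
  refine Integrable.of_bound hf.aestronglyMeasurable B ?_
  filter_upwards [ae_norm_sphereLaw hη] with v hv using hB v (by simpa using hv)

theorem integrable_smoothing {d : ℕ} (η : ℝ) {f : Vec d → ℝ} (hf : Continuous f) (x : Vec d) :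
    IntegrableOn (fun u => f (x + η • u)) (Metric.closedBall (0 : Vec d) 1) :=
  (hf.comp (by fun_prop)).continuousOn.integrableOn_compact (isCompact_closedBall _ _)

theorem lipschitzWith_smoothing {d : ℕ} (η : ℝ) {C : NNReal} {g : Vec d → ℝ}
    (hg : LipschitzWith C g) : LipschitzWith C (smoothing η g) := by
  refine LipschitzWith.of_dist_le_mul fun x y => ?_
  rw [dist_eq_norm, smoothing, smoothing, setAverage_eq, setAverage_eq, ← smul_sub,
    ← integral_sub (integrable_smoothing η hg.continuous x)
      (integrable_smoothing η hg.continuous y), norm_smul]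
  set V := (volume : Measure (Vec d)).real (Metric.closedBall 0 1)
  have hV : 0 < V := ENNReal.toReal_pos (Metric.measure_closedBall_pos _ _ one_pos).ne'
    (isCompact_closedBall _ _).measure_lt_top.ne
  have : ‖∫ u in Metric.closedBall (0 : Vec d) 1, (g (x + η • u) - g (y + η • u))‖ ≤
      (C * dist x y) * V := by
    refine norm_setIntegral_le_of_norm_le_const (isCompact_closedBall _ _).measure_lt_top
      fun u _ => ?_
    have := hg.dist_le_mul (x + η • u) (y + η • u)
    rwa [dist_add_right, dist_eq_norm] at this
  calc _ ≤ ‖V⁻¹‖ * ((C * dist x y) * V) := by gcongr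
    _ = C * dist x y := by
      rw [norm_inv, Real.norm_eq_abs, abs_of_pos hV]; field_simp

/-- The gradient of a smoothed Lipschitz function is a spherical mean. -/
theorem hasGradientAt_smoothing {d : ℕ} (hd : 1 ≤ d) {η : ℝ} (hη : 0 < η) {C : NNReal}
    {g : Vec d → ℝ} (hg : LipschitzWith C g) (x : Vec d) :
    HasGradientAt (smoothing η g) ((d / η ^ 2 : ℝ) • ∫ v, g (x + v) • v ∂sphereLaw d η) x := by
  have : Nonempty (Fin d) := ⟨⟨0, hd⟩⟩
  have hd0 : (d : ℝ) ≠ 0 := by positivity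
  rw [hasGradientAt_iff_hasFDerivAt]
  -- For a Lipschitz function, line derivatives that depend linearly on the direction already give
  -- Fréchet differentiability.
  refine (lipschitzWith_smoothing η hg).hasFDerivAt_of_hasLineDerivAt_of_closure
    (s := Set.univ) (by simp) fun e _ => ?_
  set G : Vec d → ℝ := fun u => g (x + η • u)
  have hG : LipschitzWith (C * Real.toNNReal η) G := by
    refine LipschitzWith.of_dist_le_mul fun u v => ?_
    have := hg.dist_le_mul (x + η • u) (x + η • v)
    rw [dist_add_left, dist_smul₀, Real.norm_eq_abs, abs_of_pos hη] at this
    simpa [G, Real.coe_toNNReal _ hη.le, mul_assoc] using this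
  -- Differentiation under the integral: `C ‖e‖` dominates the quotients, and a Lipschitz function
  -- is a.e. line differentiable. The direction is rescaled to `η⁻¹ • e` because `G` is `g` read in
  -- the coordinate `u` of the unit ball.
  have key : HasDerivAt (fun t : ℝ => ∫ u in Metric.closedBall (0 : Vec d) 1,
      g (x + t • e + η • u)) (∫ u in Metric.closedBall (0 : Vec d) 1, lineDeriv ℝ G u (η⁻¹ • e)) 0 := by
    refine (hasDerivAt_integral_of_dominated_loc_of_lip (bound := fun _ => (C : ℝ) * ‖e‖)
      (F := fun t u => g (x + t • e + η • u)) (s := Set.univ) univ_mem ?_ ?_ ?_ ?_ ?_ ?_).2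
    · exact Eventually.of_forall fun t =>
        (hg.continuous.comp (by fun_prop)).aestronglyMeasurable
    · simpa [IntegrableOn] using integrable_smoothing η hg.continuous x
    · exact (aestronglyMeasurable_lineDeriv hG.continuous _)
    · refine Eventually.of_forall fun u => ?_
      refine LipschitzWith.lipschitzOnWith (LipschitzWith.of_dist_le_mul fun s t => ?_)
      refine (hg.dist_le_mul _ _).trans ?_
      rw [dist_add_right, dist_add_left, dist_eq_norm, ← sub_smul, norm_smul]
      simp only [Real.dist_eq, Real.norm_eq_abs, Real.coe_nnabs, abs_mul, abs_norm, NNReal.abs_eq]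
      exact le_of_eq (by ring)
    · exact integrableOn_const (isCompact_closedBall _ _).measure_lt_top.ne
    · refine ae_restrict_of_ae ?_
      filter_upwards [hG.ae_lineDifferentiableAt (η⁻¹ • e)] with u hu
      have := hu.hasLineDerivAt
      unfold HasLineDerivAt at this
      refine this.congr_of_eventuallyEq (Eventually.of_forall fun t => ?_)
      simp only [G, smul_add, smul_smul]
      congr 1
      rw [mul_left_comm, mul_inv_cancel₀ hη.ne', mul_one]; abel
  rw [setIntegral_lineDeriv_closedBall hd hG] at key
  unfold HasLineDerivAt smoothing
  simp only [setAverage_eq]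
  have key2 := key.const_mul ((volume : Measure (Vec d)).real (Metric.closedBall 0 1))⁻¹
  simp only [smul_eq_mul]
  refine key2.congr_deriv ?_
  symm
  have hi : Integrable (fun v : Vec d => g (x + v) • v) (sphereLaw d η) :=
    integrable_sphereLaw hd hη ((hg.continuous.comp (by fun_prop)).smul continuous_id)
  rw [InnerProductSpace.toDual_apply_apply, inner_smul_left, real_inner_comm, ← integral_inner hi,
    integral_sphereLaw hη]
  simp only [inner_smul_right, G, smul_eq_mul, RCLike.conj_to_real]
  have : ∀ u : Vec d, g (x + η • u) * (η⁻¹ * ⟪u, e⟫) = η⁻¹ * (g (x + η • u) * ⟪u, e⟫) :=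
    fun _ => by ring
  simp only [this, integral_const_mul]
  have : ∀ u : Vec d, g (x + η • u) * (η * ⟪e, u⟫) = η * (g (x + η • u) * ⟪u, e⟫) :=
    fun _ => by rw [real_inner_comm]; ring
  simp only [this, integral_const_mul]
  have : (volume : Measure (Vec d)).real (Metric.closedBall 0 1) =
    (volume : Measure (Vec d)).real (Metric.ball 0 1) := by
    rw [measureReal_def, Measure.addHaar_closedBall_eq_addHaar_ball, measureReal_def]
  rw [this]
  field_simp

/-- The gradient formula applied to the linear form `⟪e, ·⟫`: smoothing changes it only by a
constant, so its gradient is `e`, and pairing the formula with `e` evaluates the second moment. -/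
theorem integral_inner_sq_sphereLaw {d : ℕ} (hd : 1 ≤ d) {η : ℝ} (hη : 0 < η) (e : Vec d) :
    ∫ v, ⟪v, e⟫ ^ 2 ∂sphereLaw d η = η ^ 2 / d * ‖e‖ ^ 2 := by
  have hd0 : (d : ℝ) ≠ 0 := by positivity
  have hl : LipschitzWith ‖innerSL ℝ e‖₊ (fun v : Vec d => ⟪e, v⟫) := (innerSL ℝ e).lipschitz
  have h := hasGradientAt_smoothing hd hη hl 0
  have h2 : smoothing η (fun v : Vec d => ⟪e, v⟫) =
      fun x => ⟪e, x⟫ + smoothing η (fun v : Vec d => ⟪e, v⟫) 0 := by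
    ext x
    have hV : (volume : Measure (Vec d)).real (Metric.closedBall 0 1) ≠ 0 :=
      (ENNReal.toReal_pos (Metric.measure_closedBall_pos _ _ one_pos).ne'
        (isCompact_closedBall _ _).measure_lt_top.ne).ne'
    simp only [smoothing, setAverage_eq, inner_add_right, zero_add]
    rw [integral_add]
    · simp only [setIntegral_const, smul_eq_mul, mul_add, ← mul_assoc, inv_mul_cancel₀ hV, one_mul]
    · exact integrableOn_const (isCompact_closedBall _ _).measure_lt_top.ne
    · simpa [IntegrableOn] using integrable_smoothing η hl.continuous 0
  have h3 : HasGradientAt (smoothing η (fun v : Vec d => ⟪e, v⟫)) e 0 := by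
    rw [h2, hasGradientAt_iff_hasFDerivAt]
    exact ((innerSL ℝ e).hasFDerivAt).add_const _
  have h4 := h.unique h3
  have hi : Integrable (fun v : Vec d => ⟪e, 0 + v⟫ • v) (sphereLaw d η) :=
    integrable_sphereLaw hd hη (by fun_prop)
  have h5 : ⟪e, (d / η ^ 2 : ℝ) • ∫ v, ⟪e, 0 + v⟫ • v ∂sphereLaw d η⟫ = ⟪e, e⟫ := by rw [h4]
  rw [inner_smul_right, ← integral_inner hi, real_inner_self_eq_norm_sq] at h5
  rw [← h5]
  simp only [zero_add, inner_smul_right, real_inner_comm e, ← sq]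
  field_simp

/-- The spherical mean representing the gradient of `smoothing η g`. -/
noncomputable def sphereGrad {d : ℕ} (η : ℝ) (g : Vec d → ℝ) (x : Vec d) : Vec d :=
  (d / η ^ 2 : ℝ) • ∫ v, g (x + v) • v ∂sphereLaw d η

/-- Pairing the difference `e` of the two gradients with itself leaves the integral of `|⟪v, e⟫|`,
which by Cauchy–Schwarz and the exact second moment is at most `η ‖e‖ / √d`. This turns the naive
factor `d / η` into `√d / η`. -/
theorem norm_sphereGrad_sub_le {d : ℕ} (hd : 1 ≤ d) {η : ℝ} (hη : 0 < η) {C : NNReal}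
    {g : Vec d → ℝ} (hg : LipschitzWith C g) (x y : Vec d) :
    ‖sphereGrad η g x - sphereGrad η g y‖ ≤ C * Real.sqrt d / η * ‖x - y‖ := by
  have := isProbabilityMeasure_sphereLaw hd η
  have hdp : (0 : ℝ) < d := by positivity
  have hc : ∀ z : Vec d, Continuous fun v => g (z + v) := fun z => hg.continuous.comp (by fun_prop)
  have hi : ∀ z : Vec d, Integrable (fun v : Vec d => g (z + v) • v) (sphereLaw d η) :=
    fun z => integrable_sphereLaw hd hη ((hc z).smul continuous_id)
  set e := sphereGrad η g x - sphereGrad η g y with he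
  rcases eq_or_ne e 0 with h0 | h0
  · rw [h0, norm_zero]; positivity
  have hep : 0 < ‖e‖ := norm_pos_iff.2 h0
  have h1 : e = (d / η ^ 2 : ℝ) • ∫ v, (g (x + v) - g (y + v)) • v ∂sphereLaw d η := by
    simp only [he, sphereGrad, ← smul_sub, sub_smul]
    rw [integral_sub (hi x) (hi y)]
  have hi2 : Integrable (fun v : Vec d => (g (x + v) - g (y + v)) • v) (sphereLaw d η) :=
    integrable_sphereLaw hd hη (((hc x).sub (hc y)).smul continuous_id)
  have h2 : ‖e‖ ^ 2 = (d / η ^ 2) * ∫ v, (g (x + v) - g (y + v)) * ⟪v, e⟫ ∂sphereLaw d η := by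
    rw [← real_inner_self_eq_norm_sq]
    nth_rewrite 2 [h1]
    rw [inner_smul_right, ← integral_inner hi2]
    simp only [inner_smul_right, real_inner_comm e]
  set D := C * ‖x - y‖
  have hbd : ∀ v, |g (x + v) - g (y + v)| ≤ D := fun v => by
    have := hg.norm_sub_le (x + v) (y + v)
    simpa using this
  have h3 : ∫ v, (g (x + v) - g (y + v)) * ⟪v, e⟫ ∂sphereLaw d η ≤ D * (η * ‖e‖ / Real.sqrt d) := by
    have hcs : (∫ v, |⟪v, e⟫| ∂sphereLaw d η) ≤ η * ‖e‖ / Real.sqrt d := by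
      refine abs_le_of_sq_le_sq' ?_ (by positivity) |>.2
      refine (sq_integral_le_integral_sq ?_).trans ?_
      · rw [memLp_two_iff_integrable_sq (by fun_prop)]
        exact integrable_sphereLaw hd hη (by fun_prop)
      · simp only [sq_abs]
        rw [integral_inner_sq_sphereLaw hd hη, div_pow, Real.sq_sqrt hdp.le]
        exact le_of_eq (by ring)
    calc _ ≤ ∫ v, D * |⟪v, e⟫| ∂sphereLaw d η := by
          refine integral_mono (integrable_sphereLaw hd hη (((hc x).sub (hc y)).mul (by fun_prop)))
            (integrable_sphereLaw hd hη (by fun_prop)) fun v => ?_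
          refine (le_abs_self _).trans ?_
          rw [abs_mul]
          gcongr
          exact hbd v
      _ ≤ _ := by rw [integral_const_mul]; gcongr
  have h4 : ‖e‖ * ‖e‖ ≤ (C * Real.sqrt d / η * ‖x - y‖) * ‖e‖ := by
    rw [← sq, h2]
    calc _ ≤ (d / η ^ 2) * (D * (η * ‖e‖ / Real.sqrt d)) := by gcongr
      _ = _ := by
        simp only [D]
        have hs : 0 < Real.sqrt d := Real.sqrt_pos.2 hdp
        have := Real.sq_sqrt hdp.le
        field_simp
        rw [this]; ring
  exact le_of_mul_le_mul_right h4 hep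

/-- Reflection symmetry: apply the gradient formula to `z ↦ g (-z)` at `-x` and use uniqueness of
the gradient. It handles the backward half of the two-point estimator. -/
theorem integral_sub_smul_sphereLaw {d : ℕ} (hd : 1 ≤ d) {η : ℝ} (hη : 0 < η) {C : NNReal}
    {g : Vec d → ℝ} (hg : LipschitzWith C g) (x : Vec d) :
    (d / η ^ 2 : ℝ) • ∫ v, g (x - v) • v ∂sphereLaw d η = -sphereGrad η g x := by
  have hg' : LipschitzWith C fun z => g (-z) := by
    have := hg.comp (f := g) (g := fun z : Vec d => -z) (LipschitzWith.id.neg)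
    rwa [mul_one] at this
  have h := hasGradientAt_smoothing hd hη hg' (-x)
  have hs : smoothing η (fun z => g (-z)) = fun z => smoothing η g (-z) := by
    ext z
    simp only [smoothing, setAverage_eq]
    congr 1
    rw [← integral_indicator measurableSet_closedBall, ← integral_indicator measurableSet_closedBall,
      ← integral_neg_eq_self]
    congr 1; ext u
    simp [Set.indicator, add_comm]
  have h2 : HasGradientAt (fun z => smoothing η g (-z)) (-sphereGrad η g x) (-x) := by
    have h3 := hasGradientAt_smoothing hd hη hg x
    rw [hasGradientAt_iff_hasFDerivAt] at h3 ⊢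
    rw [← neg_neg x] at h3
    have := HasFDerivAt.comp (f := fun z : Vec d => -z) (-x) h3 ((hasFDerivAt_id (𝕜 := ℝ) (-x)).neg)
    refine this.congr_fderiv ?_
    ext v
    simp [sphereGrad]
  rw [hs] at h
  have := h.unique h2
  simpa [sub_eq_add_neg, add_comm] using this


/-! ### Euclidean projections, including projections onto products. -/

section Projection

variable {E : Type*} [NormedAddCommGroup E] [InnerProductSpace ℝ E] [FiniteDimensional ℝ E]
  {K : Set E}

theorem proj_spec (hK : IsClosed K) (hne : K.Nonempty) (x : E) :
    proj K x ∈ K ∧ ∀ q ∈ K, ‖x - proj K x‖ ≤ ‖x - q‖ := by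
  have hex : ∃ p, p ∈ K ∧ ∀ q ∈ K, ‖x - p‖ ≤ ‖x - q‖ := by
    have : ProperSpace E := FiniteDimensional.proper ℝ E
    obtain ⟨p, hp, hd⟩ := hK.exists_infDist_eq_dist hne x
    refine ⟨p, hp, fun q hq => ?_⟩
    rw [← dist_eq_norm, ← dist_eq_norm, ← hd]
    exact Metric.infDist_le_dist_of_mem hq
  exact Classical.epsilon_spec hex

theorem proj_mem (hK : IsClosed K) (hne : K.Nonempty) (x : E) : proj K x ∈ K :=
  (proj_spec hK hne x).1

theorem inner_sub_proj_le (hK : IsClosed K) (hc : Convex ℝ K) (hne : K.Nonempty) (x : E) {z : E}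
    (hz : z ∈ K) : ⟪x - proj K x, z - proj K x⟫ ≤ 0 := by
  obtain ⟨hp, hmin⟩ := proj_spec hK hne x
  refine (norm_eq_iInf_iff_real_inner_le_zero hc hp).1 ?_ z hz
  have : Nonempty K := ⟨⟨_, hp⟩⟩
  refine le_antisymm (le_ciInf fun w => hmin w w.2) ?_
  exact ciInf_le ⟨0, by rintro _ ⟨w, rfl⟩; exact norm_nonneg _⟩ (⟨_, hp⟩ : K)

theorem norm_proj_sub_proj_le (hK : IsClosed K) (hc : Convex ℝ K) (hne : K.Nonempty) (x y : E) :
    ‖proj K x - proj K y‖ ≤ ‖x - y‖ := by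
  have h1 := inner_sub_proj_le hK hc hne x (proj_mem hK hne y)
  have h2 := inner_sub_proj_le hK hc hne y (proj_mem hK hne x)
  have h3 : ‖proj K x - proj K y‖ * ‖proj K x - proj K y‖ ≤
      ‖x - y‖ * ‖proj K x - proj K y‖ := by
    rw [← real_inner_self_eq_norm_mul_norm]
    refine le_trans ?_ (real_inner_le_norm _ _)
    simp only [inner_sub_left, inner_sub_right] at h1 h2 ⊢
    linarith [real_inner_comm (proj K x) (proj K y)]
  rcases (norm_nonneg (proj K x - proj K y)).eq_or_lt with h | h
  · rw [← h]; exact norm_nonneg _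
  · exact le_of_mul_le_mul_right h3 h

theorem continuous_proj (hK : IsClosed K) (hc : Convex ℝ K) (hne : K.Nonempty) :
    Continuous (proj K) :=
  (LipschitzWith.of_dist_le_mul (K := 1) fun x y => by
    simpa [dist_eq_norm] using norm_proj_sub_proj_le hK hc hne x y).continuous

theorem proj_eq_self (hK : IsClosed K) {x : E} (hx : x ∈ K) : proj K x = x := by
  have := (proj_spec hK ⟨x, hx⟩ x).2 x hx
  rw [sub_self, norm_zero] at this
  exact (sub_eq_zero.1 (norm_le_zero_iff.1 this)).symm

theorem eq_proj_of_inner_le (hK : IsClosed K) (hne : K.Nonempty) {x p : E}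
    (hp : p ∈ K) (h : ∀ z ∈ K, ⟪x - p, z - p⟫ ≤ 0) (hc : Convex ℝ K) : p = proj K x := by
  have h1 := h _ (proj_mem hK hne x)
  have h2 := inner_sub_proj_le hK hc hne x hp
  have h3 : ⟪p - proj K x, p - proj K x⟫ ≤ 0 := by
    simp only [inner_sub_left, inner_sub_right] at h1 h2 ⊢
    linarith [real_inner_comm (proj K x) p]
  rw [real_inner_self_eq_norm_sq] at h3
  have : ‖p - proj K x‖ = 0 := by nlinarith [norm_nonneg (p - proj K x)]
  exact sub_eq_zero.1 (norm_eq_zero.1 this)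

end Projection

theorem isClosed_feasible {N : ℕ} {Ξ : Type*} [MeasurableSpace Ξ] {G : Game N Ξ}
    (h : ∀ i, IsClosed (G.X i)) : IsClosed G.feasible := by
  have : G.feasible = ⋂ i, (fun x : Profile G.n => x i) ⁻¹' G.X i := by
    ext x; simp [Game.feasible]
  rw [this]
  exact isClosed_iInter fun i => (h i).preimage (by fun_prop)

theorem convex_feasible {N : ℕ} {Ξ : Type*} [MeasurableSpace Ξ] {G : Game N Ξ}
    (h : ∀ i, Convex ℝ (G.X i)) : Convex ℝ G.feasible := by
  intro x hx y hy a b ha hb hab i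
  exact h i (hx i) (hy i) ha hb hab

theorem isCompact_feasible {N : ℕ} {Ξ : Type*} [MeasurableSpace Ξ] {G : Game N Ξ}
    (h : ∀ i, IsCompact (G.X i)) : IsCompact G.feasible := by
  have h1 : IsCompact (Set.pi Set.univ G.X) := isCompact_univ_pi h
  have h2 := h1.image (PiLp.continuous_toLp 2 (fun i : Fin N => Vec (G.n i)))
  convert h2 using 1
  ext x
  constructor
  · intro hx
    exact ⟨x.ofLp, fun i _ => hx i, rfl⟩
  · rintro ⟨y, hy, rfl⟩ i
    exact hy i trivial

/-- The projection onto a product of strategy sets acts componentwise. -/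
theorem proj_feasible {N : ℕ} {Ξ : Type*} [MeasurableSpace Ξ] {G : Game N Ξ}
    (hcl : ∀ i, IsClosed (G.X i)) (hc : ∀ i, Convex ℝ (G.X i)) (hne : ∀ i, (G.X i).Nonempty)
    (x : Profile G.n) : proj G.feasible x = WithLp.toLp 2 (fun i => proj (G.X i) (x i)) := by
  have hmem : (WithLp.toLp 2 (fun i => proj (G.X i) (x i)) : Profile G.n) ∈ G.feasible :=
    fun i => proj_mem (hcl i) (hne i) _
  refine (eq_proj_of_inner_le (isClosed_feasible hcl) ⟨_, hmem⟩ hmem (fun z hz => ?_)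
    (convex_feasible hc)).symm
  rw [PiLp.inner_apply]
  exact Finset.sum_nonpos fun i _ => inner_sub_proj_le (hcl i) (hc i) (hne i) (x i) (hz i)


/-! ### Integrating out an independent draw. -/

section Fresh

variable {Ω α β F : Type*} [MeasurableSpace Ω] [MeasurableSpace α] [MeasurableSpace β]
  [NormedAddCommGroup F] [MeasurableSpace F] [BorelSpace F]
  [SecondCountableTopology F] {P : Measure Ω} [IsProbabilityMeasure P]
  {X : Ω → α} {W : Ω → β} {ρ : Measure β} {f : α × β → F}

/-- A function of `X` and an independent `W` with uniformly bounded sections in `L¹(law of W)` is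
integrable. -/
theorem integrable_of_indepFun (hX : Measurable X) (hW : Measurable W) (hρ : P.map W = ρ)
    (hind : IndepFun X W P) (hf : Measurable f) {C : ℝ}
    (hint : ∀ a, Integrable (fun b => f (a, b)) ρ) (hC : ∀ a, ∫ b, ‖f (a, b)‖ ∂ρ ≤ C) :
    Integrable (fun ω => f (X ω, W ω)) P := by
  have hmap := (indepFun_iff_map_prod_eq_prod_map_map hX.aemeasurable hW.aemeasurable).1 hind
  have := Measure.isProbabilityMeasure_map (μ := P) hX.aemeasurable
  have hρ' : IsProbabilityMeasure ρ := hρ ▸ Measure.isProbabilityMeasure_map (μ := P) hW.aemeasurable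
  have h : Integrable f (P.map fun ω => (X ω, W ω)) := by
    rw [hmap, hρ, integrable_prod_iff hf.aestronglyMeasurable]
    refine ⟨Eventually.of_forall hint, ?_⟩
    refine Integrable.of_bound
      (hf.norm.stronglyMeasurable.integral_prod_right').aestronglyMeasurable C
      (Eventually.of_forall fun a => ?_)
    rw [Real.norm_eq_abs, abs_of_nonneg (integral_nonneg fun _ => norm_nonneg _)]
    exact hC a
  exact (integrable_map_measure hf.aestronglyMeasurable (hX.prodMk hW).aemeasurable).1 h

variable [NormedSpace ℝ F]

/-- Integrate out a draw that is independent of the rest. -/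
theorem integral_of_indepFun (hX : Measurable X) (hW : Measurable W) (hρ : P.map W = ρ)
    (hind : IndepFun X W P) (hf : Measurable f) (hint : Integrable (fun ω => f (X ω, W ω)) P) :
    ∫ ω, f (X ω, W ω) ∂P = ∫ ω, ∫ b, f (X ω, b) ∂ρ ∂P := by
  have hmap := (indepFun_iff_map_prod_eq_prod_map_map hX.aemeasurable hW.aemeasurable).1 hind
  have := Measure.isProbabilityMeasure_map (μ := P) hX.aemeasurable
  have hρ' : IsProbabilityMeasure ρ := hρ ▸ Measure.isProbabilityMeasure_map (μ := P) hW.aemeasurable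
  have h : Integrable f (P.map fun ω => (X ω, W ω)) :=
    (integrable_map_measure hf.aestronglyMeasurable (hX.prodMk hW).aemeasurable).2 hint
  have e1 := integral_map (μ := P) (φ := fun ω => (X ω, W ω)) (hX.prodMk hW).aemeasurable
    (f := f) hf.aestronglyMeasurable
  rw [← e1]
  rw [hmap, hρ] at h ⊢
  rw [integral_prod f h, integral_map hX.aemeasurable]
  exact (hf.stronglyMeasurable.integral_prod_right').aestronglyMeasurable

theorem integrable_integral_of_indepFun (hX : Measurable X) (hW : Measurable W) (hρ : P.map W = ρ)
    (hind : IndepFun X W P) (hf : Measurable f) (hint : Integrable (fun ω => f (X ω, W ω)) P) :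
    Integrable (fun ω => ∫ b, f (X ω, b) ∂ρ) P := by
  have hmap := (indepFun_iff_map_prod_eq_prod_map_map hX.aemeasurable hW.aemeasurable).1 hind
  have := Measure.isProbabilityMeasure_map (μ := P) hX.aemeasurable
  have hρ' : IsProbabilityMeasure ρ := hρ ▸ Measure.isProbabilityMeasure_map (μ := P) hW.aemeasurable
  have h : Integrable f (P.map fun ω => (X ω, W ω)) :=
    (integrable_map_measure hf.aestronglyMeasurable (hX.prodMk hW).aemeasurable).2 hint
  rw [hmap, hρ] at h
  exact (integrable_map_measure (hf.stronglyMeasurable.integral_prod_right').aestronglyMeasurable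
    hX.aemeasurable).1 h.integral_prod_left

/-- Bound on the mean of a function of `X` and an independent draw. -/
theorem integral_le_of_indepFun {f : α × β → ℝ} (hX : Measurable X) (hW : Measurable W)
    (hρ : P.map W = ρ) (hind : IndepFun X W P) (hf : Measurable f) (hnn : ∀ p, 0 ≤ f p) {C : ℝ}
    (hint : ∀ a, Integrable (fun b => f (a, b)) ρ) (hC : ∀ a, ∫ b, f (a, b) ∂ρ ≤ C) :
    Integrable (fun ω => f (X ω, W ω)) P ∧ ∫ ω, f (X ω, W ω) ∂P ≤ C := by
  have h1 : Integrable (fun ω => f (X ω, W ω)) P :=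
    integrable_of_indepFun hX hW hρ hind hf hint (C := C) fun a => by
      simpa only [Real.norm_eq_abs, abs_of_nonneg (hnn _)] using hC a
  refine ⟨h1, ?_⟩
  rw [integral_of_indepFun hX hW hρ hind hf h1]
  calc _ ≤ ∫ _ω, C ∂P := integral_mono (integrable_integral_of_indepFun hX hW hρ hind hf h1)
        (integrable_const _) fun ω => hC _
    _ = C := by simp

end Fresh

theorem indepFun_of_indep {Ω α β : Type*} {mΩ : MeasurableSpace Ω} [MeasurableSpace α]
    [MeasurableSpace β] {P : Measure Ω} {m₁ m₂ : MeasurableSpace Ω} {X : Ω → α} {W : Ω → β}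
    (h : Indep m₁ m₂ P) (hX : Measurable[m₁] X) (hW : Measurable[m₂] W) : IndepFun X W P := by
  rw [IndepFun_iff_Indep]
  exact indep_of_indep_of_le_left (indep_of_indep_of_le_right h hW.comap_le) hX.comap_le

/-- The Robbins–Monro recursion for a bounded sequence of errors. -/
theorem le_of_robbinsMonro {e : ℕ → ℝ} {a A c Γ : ℝ} (hΓ : 0 < Γ) (ha : 1 < a) (hc : 0 ≤ c)
    (hA : A ≤ c * (a - 1)) (h0 : e 0 ≤ c / Γ) (hb : ∀ t, e t ≤ 16 * c / a)
    (hrec : ∀ t : ℕ, e (t + 1) ≤ e t - a / (t + Γ) * e t + A / (t + Γ) ^ 2) (t : ℕ) :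
    e t ≤ 32 * c / (t + Γ) := by
  induction t with
  | zero =>
    refine h0.trans ?_
    rw [Nat.cast_zero, zero_add]
    gcongr; linarith
  | succ t ih =>
    have hs : 0 < (t : ℝ) + Γ := by positivity
    push_cast
    rw [add_right_comm]
    set s := (t : ℝ) + Γ
    -- The contraction factor `1 - a / s` is nonnegative only when `a ≤ s`; then `(s - 1) / s² ≤ 1 /
    -- (s + 1)` closes the induction. For the early steps `s < a` the a priori bound `16 c / a`
    -- suffices, since `s + 1 ≤ 2 a`. This is the origin of the constant `32`.
    rcases le_or_gt a s with h | h
    · have h1 : 0 ≤ 1 - a / s := by rw [sub_nonneg, div_le_one hs]; exact h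
      have h2 : e t - a / s * e t ≤ (1 - a / s) * (32 * c / s) := by
        have := mul_le_mul_of_nonneg_left ih h1
        linarith
      have h3 : A / s ^ 2 ≤ 32 * c * (a - 1) / s ^ 2 := by
        gcongr
        nlinarith
      calc e (t + 1) ≤ (1 - a / s) * (32 * c / s) + 32 * c * (a - 1) / s ^ 2 := by
            linarith [hrec t]
        _ = 32 * c * ((s - 1) / s ^ 2) := by field_simp; ring
        _ ≤ 32 * c * (1 / (s + 1)) := by
            gcongr 32 * c * ?_
            rw [div_le_div_iff₀ (by positivity) (by positivity)]
            nlinarith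
        _ = _ := by ring
    · refine (hb (t + 1)).trans ?_
      rw [div_le_div_iff₀ (by linarith) (by positivity)]
      nlinarith

/-- The projection is nonexpansive and fixes `z`; the right-hand side is the expanded square. -/
theorem norm_proj_sub_sq_le {E : Type*} [NormedAddCommGroup E] [InnerProductSpace ℝ E]
    [FiniteDimensional ℝ E] {K : Set E} (hK : IsClosed K) (hc : Convex ℝ K) {z : E} (hz : z ∈ K)
    (y f : E) (α : ℝ) :
    ‖proj K (y - α • f) - z‖ ^ 2 ≤
      ‖y - z‖ ^ 2 - 2 * α * ⟪f, y - z⟫ + α ^ 2 * ‖f‖ ^ 2 := by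
  have h := norm_proj_sub_proj_le hK hc ⟨z, hz⟩ (y - α • f) z
  rw [proj_eq_self hK hz] at h
  calc _ ≤ ‖y - α • f - z‖ ^ 2 := by gcongr
    _ = ‖(y - z) - α • f‖ ^ 2 := by congr 2; abel
    _ = _ := by
      rw [norm_sub_sq_real, inner_smul_right, norm_smul, mul_pow, Real.norm_eq_abs, sq_abs,
        real_inner_comm]
      ring

/-! ### The lower-level iteration and measurability of its solution. -/

namespace Assumptions

variable {N : ℕ} {Ξ : Type*} [MeasurableSpace Ξ] {G : Game N Ξ} {Q : Params G}
  {K : HiddenConstants} {η : ℝ} (A : Assumptions G Q K η)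
include A

theorem y_mem_lowerSol (i : Fin N) {x : Vec (G.n i)} (hx : x ∈ G.enlarged η i) :
    G.y i x ∈ G.lowerSol i x := Classical.epsilon_spec (A.lower_solvable i x hx)

theorem y_mem (i : Fin N) {x : Vec (G.n i)} (hx : x ∈ G.enlarged η i) : G.y i x ∈ G.Y i :=
  (A.y_mem_lowerSol i hx).1

theorem strong_mono_meanF (i : Fin N) {x : Vec (G.n i)} (hx : x ∈ G.enlarged η i) {y z : Vec (G.d i)}
    (hy : y ∈ G.Y i) (hz : z ∈ G.Y i) :
    Q.μ i * ‖y - z‖ ^ 2 ≤ ⟪G.meanF i x y - G.meanF i x z, y - z⟫ := by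
  have := A.prob
  have h1 := (A.F_memLp i x hx y hy).integrable (by norm_num)
  have h2 := (A.F_memLp i x hx z hz).integrable (by norm_num)
  simp only [Game.meanF]
  have h3 : Integrable (fun ξ => G.F i x y ξ - G.F i x z ξ) G.law := h1.sub h2
  rw [← integral_sub h1 h2, real_inner_comm, ← integral_inner h3]
  calc _ = ∫ _ξ, Q.μ i * ‖y - z‖ ^ 2 ∂G.law := by simp
    _ ≤ _ := integral_mono (integrable_const _) (h3.const_inner _) fun ξ => by
      simp only
      rw [real_inner_comm]
      exact A.strong_mono i x hx ξ y hy z hz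

/-- Monotonicity towards the lower-level solution. -/
theorem inner_meanF_ge (i : Fin N) {x : Vec (G.n i)} (hx : x ∈ G.enlarged η i) {y : Vec (G.d i)}
    (hy : y ∈ G.Y i) : Q.μ i * ‖y - G.y i x‖ ^ 2 ≤ ⟪G.meanF i x y, y - G.y i x⟫ := by
  have h1 := A.strong_mono_meanF i hx hy (A.y_mem i hx)
  have h2 := (A.y_mem_lowerSol i hx).2 y hy
  rw [inner_sub_left] at h1
  linarith

theorem one_lt_rate (i : Fin N) : 1 < 2 * Q.μ i * Q.α0 := by
  have := A.α0_large i
  have hμ := A.μ_pos i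
  rw [div_lt_iff₀ (by positivity)] at this
  linarith

theorem α0_pos (i : Fin N) : 0 < Q.α0 :=
  lt_trans (by have := A.μ_pos i; positivity) (A.α0_large i)

theorem variance_const_le (i : Fin N) :
    (Q.cF i ^ 2 + Q.vF i ^ 2) * Q.α0 ^ 2 ≤ K.cmax * (2 * Q.μ i * Q.α0 - 1) :=
  (div_le_iff₀ (by linarith [A.one_lt_rate i])).1 (A.cmax_var i)

theorem enlarged_nonempty (hη : 0 ≤ η) (i : Fin N) : (G.enlarged η i).Nonempty :=
  ⟨Q.x0 i + 0, Set.add_mem_add (A.x0_mem i) (by simpa using hη)⟩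

/-- A strongly monotone map with bounded values forces a bounded domain: `μ ‖y - z‖ ≤ 2 c_F`. The
`c_max` condition then bounds `c_F² α₀²`, which puts the diameter in the form `16 c / a`, `a = 2 μ
α₀`, needed as the a priori bound in `le_of_robbinsMonro`. -/
theorem norm_sub_sq_le_of_mem_Y (hη : 0 ≤ η) (i : Fin N) {y z : Vec (G.d i)} (hy : y ∈ G.Y i)
    (hz : z ∈ G.Y i) : ‖y - z‖ ^ 2 ≤ 16 * K.cmax / (2 * Q.μ i * Q.α0) := by
  obtain ⟨x, hx⟩ := A.enlarged_nonempty hη i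
  have hμ := A.μ_pos i
  have hα := A.α0_pos i
  have h1 := A.strong_mono_meanF i hx hy hz
  have h2 : ⟪G.meanF i x y - G.meanF i x z, y - z⟫ ≤ (2 * Q.cF i) * ‖y - z‖ :=
    (real_inner_le_norm _ _).trans (by
      gcongr
      exact (norm_sub_le _ _).trans (by linarith [A.F_mean i x hx y hy, A.F_mean i x hx z hz]))
  have h3 : Q.μ i * ‖y - z‖ ≤ 2 * Q.cF i := by
    rcases (norm_nonneg (y - z)).eq_or_lt with h | h
    · rw [← h, mul_zero]
      linarith [norm_nonneg (G.meanF i x y), A.F_mean i x hx y hy]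
    · refine le_of_mul_le_mul_right ?_ h
      nlinarith
  have h4 : (Q.μ i * ‖y - z‖) ^ 2 ≤ (2 * Q.cF i) ^ 2 := by gcongr
  have h5 := A.variance_const_le i
  rw [le_div_iff₀ (by positivity)]
  have h6 : (Q.μ i * ‖y - z‖) ^ 2 * Q.α0 ^ 2 ≤ (2 * Q.cF i) ^ 2 * Q.α0 ^ 2 := by gcongr
  have h7 : 0 ≤ Q.vF i ^ 2 * Q.α0 ^ 2 := by positivity
  have hk := K.cmax_pos
  have h8 : (‖y - z‖ ^ 2 * (2 * Q.μ i * Q.α0)) * (2 * Q.μ i * Q.α0) ≤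
      (16 * K.cmax) * (2 * Q.μ i * Q.α0) := by nlinarith
  exact le_of_mul_le_mul_right h8 (by positivity)

/-- Second moment equals variance plus squared mean. -/
theorem integral_norm_F_sq_le (i : Fin N) {x : Vec (G.n i)} (hx : x ∈ G.enlarged η i)
    {y : Vec (G.d i)} (hy : y ∈ G.Y i) :
    ∫ ξ, ‖G.F i x y ξ‖ ^ 2 ∂G.law ≤ Q.cF i ^ 2 + Q.vF i ^ 2 := by
  have := A.prob
  have hm := A.F_memLp i x hx y hy
  have hi := hm.integrable (by norm_num)
  have hs : Integrable (fun ξ => ‖G.F i x y ξ - G.meanF i x y‖ ^ 2) G.law :=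
    (hm.sub (memLp_const _)).integrable_norm_pow (by norm_num)
  have hin : Integrable (fun ξ => ⟪G.meanF i x y, G.F i x y ξ⟫) G.law := hi.const_inner _
  have h1 : ∀ ξ, ‖G.F i x y ξ‖ ^ 2 = ‖G.F i x y ξ - G.meanF i x y‖ ^ 2 +
      (2 * ⟪G.meanF i x y, G.F i x y ξ⟫ - ‖G.meanF i x y‖ ^ 2) := fun ξ => by
    rw [norm_sub_sq_real, real_inner_comm]; ring
  simp only [h1]
  have hd : Integrable (fun ξ => 2 * ⟪G.meanF i x y, G.F i x y ξ⟫ - ‖G.meanF i x y‖ ^ 2) G.law :=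
    (hin.const_mul 2).sub (integrable_const _)
  rw [integral_add hs hd,
    integral_sub (hin.const_mul 2) (integrable_const _), integral_const_mul, integral_inner hi]
  have h2 : ∫ ξ, G.F i x y ξ ∂G.law = G.meanF i x y := rfl
  rw [h2, real_inner_self_eq_norm_sq]
  have h3 := A.F_var i x hx y hy
  have h4 : ‖G.meanF i x y‖ ^ 2 ≤ Q.cF i ^ 2 := by gcongr; exact A.F_mean i x hx y hy
  simp
  linarith

theorem lowerRun_point_mem {Θ : Type*} (i : Fin N) (F : Vec (G.d i) → Θ → Vec (G.d i)) (ζ : ℕ → Θ)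
    (t : ℕ) : (lowerRun (G.Y i) F Q.α0 K.Γ (Q.y0 i) ζ t).point ∈ G.Y i := by
  cases t with
  | zero => exact A.y0_mem i
  | succ t => exact proj_mem (A.Y_closed i) ⟨_, A.y0_mem i⟩ _

theorem norm_y0_sub_sq_le (i : Fin N) {x : Vec (G.n i)} (hx : x ∈ G.enlarged η i) :
    ‖Q.y0 i - G.y i x‖ ^ 2 ≤ K.cmax / K.Γ := by
  rw [le_div_iff₀ K.Γ_pos, mul_comm]
  exact A.cmax_init i _ (A.y_mem i hx)

/-- The lower-level scheme driven by the expected map converges to the lower-level solution. -/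
theorem norm_meanRun_sub_sq_le (hη : 0 ≤ η) (i : Fin N) {x : Vec (G.n i)}
    (hx : x ∈ G.enlarged η i) (t : ℕ) :
    ‖(lowerRun (G.Y i) (fun y (_ : Unit) => G.meanF i x y) Q.α0 K.Γ (Q.y0 i)
      (fun _ => ()) t).point - G.y i x‖ ^ 2 ≤ 32 * K.cmax / (t + K.Γ) := by
  have hm := fun t => A.lowerRun_point_mem i (fun y (_ : Unit) => G.meanF i x y) (fun _ => ()) t
  refine le_of_robbinsMonro (e := fun t => ‖(lowerRun (G.Y i) (fun y (_ : Unit) => G.meanF i x y)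
    Q.α0 K.Γ (Q.y0 i) (fun _ => ()) t).point - G.y i x‖ ^ 2) K.Γ_pos (A.one_lt_rate i)
    K.cmax_pos.le (A.variance_const_le i) (A.norm_y0_sub_sq_le i hx)
    (fun t => A.norm_sub_sq_le_of_mem_Y hη i (hm t) (A.y_mem i hx)) (fun t => ?_) t
  have h := norm_proj_sub_sq_le (A.Y_closed i) (A.Y_convex i) (A.y_mem i hx)
    (lowerRun (G.Y i) (fun y (_ : Unit) => G.meanF i x y) Q.α0 K.Γ (Q.y0 i) (fun _ => ()) t).point
    (G.meanF i x (lowerRun (G.Y i) (fun y (_ : Unit) => G.meanF i x y) Q.α0 K.Γ (Q.y0 i)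
      (fun _ => ()) t).point) (Q.α0 / (t + K.Γ))
  refine h.trans ?_
  have h1 := A.inner_meanF_ge i hx (hm t)
  have h2 := A.F_mean i x hx _ (hm t)
  set p := (lowerRun (G.Y i) (fun y (_ : Unit) => G.meanF i x y) Q.α0 K.Γ (Q.y0 i)
      (fun _ => ()) t).point
  have hs : 0 < (t : ℝ) + K.Γ := by have := K.Γ_pos; positivity
  have hα := A.α0_pos i
  have h3 : ‖G.meanF i x p‖ ^ 2 ≤ Q.cF i ^ 2 + Q.vF i ^ 2 := by
    have : ‖G.meanF i x p‖ ^ 2 ≤ Q.cF i ^ 2 := by gcongr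
    linarith [sq_nonneg (Q.vF i)]
  have h4 : Q.α0 / (t + K.Γ) * (Q.μ i * ‖p - G.y i x‖ ^ 2) ≤
      Q.α0 / (t + K.Γ) * ⟪G.meanF i x p, p - G.y i x⟫ := by gcongr
  have h5 : (Q.α0 / (t + K.Γ)) ^ 2 * ‖G.meanF i x p‖ ^ 2 ≤
      (Q.α0 / (t + K.Γ)) ^ 2 * (Q.cF i ^ 2 + Q.vF i ^ 2) := by gcongr
  have h6 : (Q.α0 / (t + K.Γ)) ^ 2 * (Q.cF i ^ 2 + Q.vF i ^ 2) =
      (Q.cF i ^ 2 + Q.vF i ^ 2) * Q.α0 ^ 2 / (t + K.Γ) ^ 2 := by rw [div_pow]; ring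
  have h7 : 2 * Q.μ i * Q.α0 / (t + K.Γ) * ‖p - G.y i x‖ ^ 2 =
      2 * (Q.α0 / (t + K.Γ) * (Q.μ i * ‖p - G.y i x‖ ^ 2)) := by ring
  rw [h7]
  linarith

theorem measurable_meanF (i : Fin N) :
    Measurable fun p : G.enlarged η i × G.Y i => G.meanF i p.1 p.2 := by
  have := A.prob
  exact ((A.F_meas i).stronglyMeasurable.integral_prod_right' (ν := G.law)).measurable

theorem measurable_proj_Y (i : Fin N) : Measurable (proj (G.Y i)) :=
  (continuous_proj (A.Y_closed i) (A.Y_convex i) ⟨_, A.y0_mem i⟩).measurable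

/-- The noise space `Θ` and the map `F` are left general so that the same induction serves the
stochastic scheme and the deterministic one, where `Θ = Unit`. The iterate stays in `Y_i`, so the
oracle is only evaluated where it is known to be measurable. -/
theorem measurable_lowerRun {Θ : Type*} [MeasurableSpace Θ] (i : Fin N)
    {F : Vec (G.n i) → Vec (G.d i) → Θ → Vec (G.d i)}
    (hF : Measurable fun p : (G.enlarged η i × G.Y i) × Θ => F p.1.1 p.1.2 p.2)
    {Ω : Type*} [MeasurableSpace Ω] {x : Ω → Vec (G.n i)} (hx : Measurable x)
    (hmem : ∀ ω, x ω ∈ G.enlarged η i) {ζ : ℕ → Ω → Θ} {t : ℕ} (hζ : ∀ s < t, Measurable (ζ s)) :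
    Measurable fun ω =>
      (lowerRun (G.Y i) (F (x ω)) Q.α0 K.Γ (Q.y0 i) (fun s => ζ s ω) t).point := by
  induction t with
  | zero => exact measurable_const
  | succ t ih =>
    have ih := ih fun s hs => hζ s (hs.trans (Nat.lt_succ_self t))
    have h : Measurable fun ω => (((⟨x ω, hmem ω⟩ : G.enlarged η i),
        (⟨_, A.lowerRun_point_mem i (F (x ω)) (fun s => ζ s ω) t⟩ : G.Y i)), ζ t ω) :=
      ((hx.subtype_mk).prodMk ih.subtype_mk).prodMk (hζ t (Nat.lt_succ_self t))
    exact (A.measurable_proj_Y i).comp (ih.sub ((hF.comp h).const_smul (Q.α0 / ((t : ℝ) + K.Γ))))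

/-- The lower-level solution is an arbitrary choice from the solution set, with no regularity
assumed. The deterministic scheme driven by the expected map converges to it at every point, so it
is a pointwise limit of measurable maps. -/
theorem measurable_y (hη : 0 ≤ η) (i : Fin N) : Measurable fun x : G.enlarged η i => G.y i x := by
  refine measurable_of_tendsto_metrizable (f := fun t (x : G.enlarged η i) =>
    (lowerRun (G.Y i) (fun y (_ : Unit) => G.meanF i x y) Q.α0 K.Γ (Q.y0 i)
      (fun _ => ()) t).point) (fun t => ?_) ?_
  · exact A.measurable_lowerRun i (F := fun x y (_ : Unit) => G.meanF i x y)
      ((A.measurable_meanF i).comp measurable_fst) measurable_subtype_coe (fun x => x.2)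
      (ζ := fun _ _ => ()) (fun _ _ => measurable_const)
  · rw [tendsto_pi_nhds]
    intro x
    rw [tendsto_iff_norm_sub_tendsto_zero]
    have h0 : Tendsto (fun t : ℕ => Real.sqrt (32 * K.cmax / (t + K.Γ))) atTop (𝓝 0) := by
      rw [← Real.sqrt_zero]
      refine (Real.continuous_sqrt.tendsto 0).comp (Tendsto.div_atTop tendsto_const_nhds ?_)
      exact tendsto_atTop_add_const_right _ _ tendsto_natCast_atTop_atTop
    refine squeeze_zero (fun _ => norm_nonneg _) (fun t => ?_) h0
    exact Real.le_sqrt_of_sq_le (A.norm_meanRun_sub_sq_le hη i x.2 t)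

end Assumptions


/-! ### Elementary facts on enlarged sets and maximal constants. -/

section Basic

variable {N : ℕ} {Ξ : Type*} [MeasurableSpace Ξ]

theorem Game.mem_enlarged_add (G : Game N Ξ) {η : ℝ} {i : Fin N} {x v : Vec (G.n i)}
    (hx : x ∈ G.X i) (hv : ‖v‖ ≤ η) : x + v ∈ G.enlarged η i :=
  Set.add_mem_add hx (by simpa using hv)

theorem Game.mem_enlarged_sub (G : Game N Ξ) {η : ℝ} {i : Fin N} {x v : Vec (G.n i)}
    (hx : x ∈ G.X i) (hv : ‖v‖ ≤ η) : x - v ∈ G.enlarged η i := by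
  rw [sub_eq_add_neg]
  exact G.mem_enlarged_add hx (by rwa [norm_neg])

theorem Game.n_le_nMax (G : Game N Ξ) (i : Fin N) : (G.n i : ℝ) ≤ G.nMax := by
  exact_mod_cast Finset.le_sup (f := G.n) (Finset.mem_univ i)

theorem Params.L_le_Lmax {G : Game N Ξ} (Q : Params G) (i : Fin N) : Q.L i ≤ Q.Lmax :=
  le_ciSup (Set.finite_range Q.L).bddAbove i

theorem Params.Ly_le_LyMax {G : Game N Ξ} (Q : Params G) (i : Fin N) : Q.Ly i ≤ Q.LyMax :=
  le_ciSup (Set.finite_range Q.Ly).bddAbove i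

end Basic

/-! ### Mean-square error of the lower level, and the implicit function. -/

namespace Assumptions

variable {N : ℕ} {Ξ : Type*} [MeasurableSpace Ξ] {G : Game N Ξ} {Q : Params G}
  {K : HiddenConstants} {η : ℝ} (A : Assumptions G Q K η)
include A

theorem measurable_y_comp (hη : 0 ≤ η) (i : Fin N) {Ω : Type*} [MeasurableSpace Ω]
    {x : Ω → Vec (G.n i)} (hx : Measurable x) (hmem : ∀ ω, x ω ∈ G.enlarged η i) :
    Measurable fun ω => G.y i (x ω) := by
  have h1 : Measurable fun ω => (⟨x ω, hmem ω⟩ : G.enlarged η i) := hx.subtype_mk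
  have h2 := (A.measurable_y hη i).comp h1
  exact h2

/-- Mean-square error of the lower-level stochastic approximation scheme. -/
theorem integral_norm_lowerRun_sub_sq_le (hη : 0 ≤ η) (i : Fin N) {Ω : Type*}
    {mΩ : MeasurableSpace Ω} {P : Measure Ω} [IsProbabilityMeasure P] {m : ℕ → MeasurableSpace Ω}
    (hm : ∀ t, m t ≤ mΩ) (hmono : Monotone m) {x : Ω → Vec (G.n i)} (hx : Measurable[m 0] x)
    (hmem : ∀ ω, x ω ∈ G.enlarged η i) {ζ : ℕ → Ω → Ξ} (hζ : ∀ t, Measurable[m (t + 1)] (ζ t))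
    (hlaw : ∀ t, P.map (ζ t) = G.law)
    (hind : ∀ t, Indep (m t) (MeasurableSpace.comap (ζ t) inferInstance) P) (t : ℕ) :
    Integrable (fun ω => ‖(lowerRun (G.Y i) (G.F i (x ω)) Q.α0 K.Γ (Q.y0 i) (fun s => ζ s ω)
      t).point - G.y i (x ω)‖ ^ 2) P ∧
    ∫ ω, ‖(lowerRun (G.Y i) (G.F i (x ω)) Q.α0 K.Γ (Q.y0 i) (fun s => ζ s ω) t).point
      - G.y i (x ω)‖ ^ 2 ∂P ≤ 32 * K.cmax / (t + K.Γ) := by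
  have := A.prob
  set p : ℕ → Ω → Vec (G.d i) := fun t ω =>
    (lowerRun (G.Y i) (G.F i (x ω)) Q.α0 K.Γ (Q.y0 i) (fun s => ζ s ω) t).point with hp
  -- Adaptedness: the iterate at time `t` uses only the samples before `t`, hence is independent of
  -- `ζ t`. The σ-algebra `m t` is passed explicitly in place of the ambient one.
  have hpm : ∀ t, Measurable[m t] (p t) := fun t =>
    @measurable_lowerRun N Ξ _ G Q K η A Ξ _ i (G.F i) (A.F_meas i) Ω (m t) x
      (hx.mono (hmono (Nat.zero_le t)) le_rfl) hmem ζ t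
      fun s hs => (hζ s).mono (hmono hs) le_rfl
  have hpY : ∀ t ω, p t ω ∈ G.Y i := fun t ω => A.lowerRun_point_mem i _ _ t
  have hxm : Measurable x := hx.mono (hm 0) le_rfl
  have hym : Measurable fun ω => G.y i (x ω) := A.measurable_y_comp hη i hxm hmem
  have hyY : ∀ ω, G.y i (x ω) ∈ G.Y i := fun ω => A.y_mem i (hmem ω)
  set B := 16 * K.cmax / (2 * Q.μ i * Q.α0) with hB
  have hbd : ∀ t ω, ‖p t ω - G.y i (x ω)‖ ^ 2 ≤ B := fun t ω =>
    A.norm_sub_sq_le_of_mem_Y hη i (hpY t ω) (hyY ω)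
  have hpm' : ∀ t, Measurable (p t) := fun t => (hpm t).mono (hm t) le_rfl
  have hint : ∀ t, Integrable (fun ω => ‖p t ω - G.y i (x ω)‖ ^ 2) P := fun t =>
    Integrable.of_bound (((hpm' t).sub hym).norm.pow_const 2).aestronglyMeasurable B
      (Eventually.of_forall fun ω => by
        rw [Real.norm_eq_abs, abs_of_nonneg (by positivity)]; exact hbd t ω)
  refine ⟨hint t, ?_⟩
  have hBint : ∀ {f : Ω → ℝ}, Integrable f P → ∀ c, (∀ ω, f ω ≤ c) → ∫ ω, f ω ∂P ≤ c :=
    fun hf c h => by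
      calc _ ≤ ∫ _ω, c ∂P := integral_mono hf (integrable_const _) h
        _ = c := by simp
  refine le_of_robbinsMonro (e := fun t => ∫ ω, ‖p t ω - G.y i (x ω)‖ ^ 2 ∂P) K.Γ_pos
    (A.one_lt_rate i) K.cmax_pos.le (A.variance_const_le i)
    (hBint (hint 0) _ fun ω => A.norm_y0_sub_sq_le i (hmem ω)) (fun t => hBint (hint t) _ (hbd t))
    (fun t => ?_) t
  -- Recording the state in subtypes makes the moment bounds hold at every value, which lets the
  -- independent sample be integrated out without conditional expectations.
  set X : Ω → G.enlarged η i × G.Y i := fun ω => (⟨x ω, hmem ω⟩, ⟨p t ω, hpY t ω⟩) with hX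
  have hXm : Measurable[m t] X := by
    have h1 : Measurable[m t] fun ω => (⟨x ω, hmem ω⟩ : G.enlarged η i) :=
      (hx.mono (hmono (Nat.zero_le t)) le_rfl).subtype_mk
    have h2 : Measurable[m t] fun ω => (⟨p t ω, hpY t ω⟩ : G.Y i) := (hpm t).subtype_mk
    exact h1.prodMk h2
  have hXm' : Measurable X := hXm.mono (hm t) le_rfl
  have hζm : Measurable (ζ t) := (hζ t).mono (hm _) le_rfl
  have hI : IndepFun X (ζ t) P := indepFun_of_indep (hind t) hXm (comap_measurable (ζ t))
  have hF := A.F_meas i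
  have hya : Measurable fun q : (G.enlarged η i × G.Y i) × Ξ => G.y i q.1.1 :=
    (A.measurable_y hη i).comp (measurable_fst.comp measurable_fst)
  have hpa : Measurable fun q : (G.enlarged η i × G.Y i) × Ξ => (q.1.2 : Vec (G.d i)) :=
    measurable_subtype_coe.comp (measurable_snd.comp measurable_fst)
  have m2 : Measurable fun q : (G.enlarged η i × G.Y i) × Ξ => ‖G.F i q.1.1 q.1.2 q.2‖ ^ 2 :=
    hF.norm.pow_const 2
  have s2 : ∀ a : G.enlarged η i × G.Y i, Integrable (fun ξ => ‖G.F i a.1 a.2 ξ‖ ^ 2) G.law :=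
    fun a => (A.F_memLp i a.1 a.1.2 a.2 a.2.2).integrable_norm_pow (by norm_num)
  have s3 : ∀ a : G.enlarged η i × G.Y i, ∫ ξ, ‖G.F i a.1 a.2 ξ‖ ^ 2 ∂G.law ≤
      Q.cF i ^ 2 + Q.vF i ^ 2 := fun a => A.integral_norm_F_sq_le i a.1.2 a.2.2
  have h2 := integral_le_of_indepFun hXm' hζm (hlaw t) hI m2 (fun _ => by positivity) s2 s3
  obtain ⟨i2, b2⟩ := h2
  have m1 : Measurable fun q : (G.enlarged η i × G.Y i) × Ξ =>
      ⟪G.F i q.1.1 q.1.2 q.2, (q.1.2 : Vec (G.d i)) - G.y i q.1.1⟫ := hF.inner (hpa.sub hya)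
  have i1 : Integrable (fun ω => ⟪G.F i (x ω) (p t ω) (ζ t ω), p t ω - G.y i (x ω)⟫) P := by
    refine Integrable.mono' (i2.add (integrable_const B))
      (m1.comp (hXm'.prodMk hζm)).aestronglyMeasurable (Eventually.of_forall fun ω => ?_)
    have h1 := abs_real_inner_le_norm (G.F i (x ω) (p t ω) (ζ t ω)) (p t ω - G.y i (x ω))
    have h2 := hbd t ω
    simp only [Real.norm_eq_abs, Pi.add_apply, hX]
    nlinarith [sq_nonneg (‖G.F i (x ω) (p t ω) (ζ t ω)‖ - ‖p t ω - G.y i (x ω)‖),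
      sq_nonneg (‖G.F i (x ω) (p t ω) (ζ t ω)‖), sq_nonneg ‖p t ω - G.y i (x ω)‖]
  have e1 := integral_of_indepFun hXm' hζm (hlaw t) hI m1 i1
  have ii := integrable_integral_of_indepFun hXm' hζm (hlaw t) hI m1 i1
  -- Integrating out `ζ t` replaces the oracle by its mean, and strong monotonicity of the mean
  -- towards the solution applies pointwise.
  have b1 : Q.μ i * ∫ ω, ‖p t ω - G.y i (x ω)‖ ^ 2 ∂P ≤
      ∫ ω, ⟪G.F i (x ω) (p t ω) (ζ t ω), p t ω - G.y i (x ω)⟫ ∂P := by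
    refine le_of_le_of_eq ?_ e1.symm
    rw [← integral_const_mul]
    refine integral_mono ((hint t).const_mul _) ii fun ω => ?_
    have hFi := (A.F_memLp i (x ω) (hmem ω) (p t ω) (hpY t ω)).integrable (by norm_num)
    have := A.inner_meanF_ge i (hmem ω) (hpY t ω)
    refine this.trans (le_of_eq ?_)
    rw [real_inner_comm, Game.meanF, ← integral_inner hFi]
    simp only [hX]
    congr 1
    ext ξ
    exact real_inner_comm _ _
  have hs : 0 < (t : ℝ) + K.Γ := by have := K.Γ_pos; positivity
  have hα := A.α0_pos i
  set α := Q.α0 / ((t : ℝ) + K.Γ) with hαdef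
  have hα' : 0 < α := by positivity
  have step : ∫ ω, ‖p (t + 1) ω - G.y i (x ω)‖ ^ 2 ∂P ≤
      ∫ ω, (‖p t ω - G.y i (x ω)‖ ^ 2
        - 2 * α * ⟪G.F i (x ω) (p t ω) (ζ t ω), p t ω - G.y i (x ω)⟫
        + α ^ 2 * ‖G.F i (x ω) (p t ω) (ζ t ω)‖ ^ 2) ∂P :=
    integral_mono (hint (t + 1)) (((hint t).sub (i1.const_mul _)).add (i2.const_mul _))
      fun ω => norm_proj_sub_sq_le (A.Y_closed i) (A.Y_convex i) (hyY ω) _ _ _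
  refine step.trans ?_
  have hsub : Integrable (fun ω => ‖p t ω - G.y i (x ω)‖ ^ 2
        - 2 * α * ⟪G.F i (x ω) (p t ω) (ζ t ω), p t ω - G.y i (x ω)⟫) P :=
    (hint t).sub (i1.const_mul _)
  rw [integral_add hsub (i2.const_mul _), integral_sub (hint t) (i1.const_mul _),
    integral_const_mul, integral_const_mul]
  have h4 := mul_le_mul_of_nonneg_left b1 (by positivity : 0 ≤ 2 * α)
  have h5 := mul_le_mul_of_nonneg_left b2 (by positivity : 0 ≤ α ^ 2)
  have h6 : α ^ 2 * (Q.cF i ^ 2 + Q.vF i ^ 2) =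
      (Q.cF i ^ 2 + Q.vF i ^ 2) * Q.α0 ^ 2 / (t + K.Γ) ^ 2 := by rw [hαdef, div_pow]; ring
  have h7 : 2 * Q.μ i * Q.α0 / (t + K.Γ) = 2 * α * Q.μ i := by rw [hαdef]; ring
  simp only
  rw [h7, ← h6]
  simp only [hX] at h5
  linarith

/-! ### The implicit upper-level function -/

/-- The smoothing results require a globally Lipschitz function, while the implicit function is
controlled only on an open set. A Lipschitz extension supplies one; equality of the smoothings on a
neighborhood, not only at `x`, is what transfers gradients. -/
theorem exists_lipschitz_extension (hη : 0 < η) (i : Fin N) :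
    ∃ g : Vec (G.n i) → ℝ, LipschitzWith (Real.toNNReal (Q.L i)) g ∧
      Set.EqOn (G.hval i) g (G.enlarged η i) ∧
      ∀ x ∈ G.X i, smoothing η (G.hval i) =ᶠ[𝓝 x] smoothing η g := by
  have := A.prob
  obtain ⟨O, hO, hsub, hint, hlip⟩ := A.h_lip i
  have hl : LipschitzOnWith (Real.toNNReal (Q.L i)) (G.hval i) O := by
    refine LipschitzOnWith.of_dist_le_mul fun x hx x' hx' => ?_
    rw [Real.coe_toNNReal _ (A.L_nonneg i), dist_eq_norm, dist_eq_norm]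
    simp only [Game.hval]
    rw [← integral_sub (hint x hx) (hint x' hx')]
    refine (norm_integral_le_of_norm_le_const (C := Q.L i * ‖x - x'‖)
      (Eventually.of_forall fun ξ => hlip ξ x hx x' hx')).trans (by simp)
  obtain ⟨g, hg, heq⟩ := hl.extend_real
  refine ⟨g, hg, heq.mono hsub, fun x hx => ?_⟩
  have hc : IsCompact (Metric.closedBall x η) := isCompact_closedBall _ _
  have hcO : Metric.closedBall x η ⊆ O := fun z hz => hsub (by
    have := G.mem_enlarged_add hx (v := z - x) (by simpa [dist_eq_norm] using hz)
    simpa using this)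
  -- The compact ball around `x` has a uniform margin inside the open set, so the balls around
  -- nearby centers also lie in it.
  obtain ⟨δ, hδ, hth⟩ := hc.exists_thickening_subset_open hO hcO
  filter_upwards [Metric.ball_mem_nhds x hδ] with z hz
  simp only [smoothing, setAverage_eq]
  congr 1
  refine setIntegral_congr_fun measurableSet_closedBall fun u hu => heq (hth ?_)
  rw [Metric.mem_thickening_iff]
  refine ⟨x + η • u, ?_, by simpa using hz⟩
  simp [norm_smul, abs_of_pos hη] at hu ⊢
  exact mul_le_of_le_one_right hη.le hu

end Assumptions

/-- Gradient of the smoothed implicit function of player `i`. -/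
noncomputable def Game.gradH {N : ℕ} {Ξ : Type*} [MeasurableSpace Ξ] (G : Game N Ξ) (η : ℝ) (i : Fin N)
    (x : Vec (G.n i)) : Vec (G.n i) := gradient (smoothing η (G.hval i)) x

/-- The two-point estimator with exact lower-level solutions. -/
noncomputable def Game.exactEst {N : ℕ} {Ξ : Type*} [MeasurableSpace Ξ] (G : Game N Ξ) (η : ℝ) (i : Fin N)
    (x v : Vec (G.n i)) (ξ : Ξ) : Vec (G.n i) :=
  ((G.n i : ℝ) / (2 * η) * (G.h i (x + v) (G.y i (x + v)) ξ - G.h i (x - v) (G.y i (x - v)) ξ)) •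
    (‖v‖⁻¹ • v)

/-! ### The two-point estimator with exact lower-level solutions. -/

namespace Assumptions

variable {N : ℕ} {Ξ : Type*} [MeasurableSpace Ξ] {G : Game N Ξ} {Q : Params G}
  {K : HiddenConstants} {η : ℝ} (A : Assumptions G Q K η)
include A

theorem exists_gradH_eq (hη : 0 < η) (i : Fin N) :
    ∃ g : Vec (G.n i) → ℝ, LipschitzWith (Real.toNNReal (Q.L i)) g ∧
      Set.EqOn (G.hval i) g (G.enlarged η i) ∧
      Set.EqOn (smoothing η (G.hval i)) (smoothing η g) (G.X i) ∧
      Set.EqOn (G.gradH η i) (sphereGrad η g) (G.X i) ∧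
      ∀ x ∈ G.X i, HasGradientAt (smoothing η (G.hval i)) (sphereGrad η g x) x := by
  obtain ⟨g, hg, heq, hev⟩ := A.exists_lipschitz_extension hη i
  have key : ∀ x ∈ G.X i, HasGradientAt (smoothing η (G.hval i)) (sphereGrad η g x) x :=
    fun x hx => (hasGradientAt_smoothing (A.dims i) hη hg x).congr_of_eventuallyEq (hev x hx)
  exact ⟨g, hg, heq, fun x hx => (hev x hx).eq_of_nhds, fun x hx => (key x hx).gradient, key⟩

theorem hasGradientAt_gradH (hη : 0 < η) (i : Fin N) {x : Vec (G.n i)} (hx : x ∈ G.X i) :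
    HasGradientAt (smoothing η (G.hval i)) (G.gradH η i x) x := by
  obtain ⟨g, -, -, -, h, h'⟩ := A.exists_gradH_eq hη i
  rw [h hx]; exact h' x hx

theorem norm_gradH_sub_le (hη : 0 < η) (i : Fin N) {x x' : Vec (G.n i)} (hx : x ∈ G.X i)
    (hx' : x' ∈ G.X i) :
    ‖G.gradH η i x - G.gradH η i x'‖ ≤ Q.Lmax * Real.sqrt G.nMax / η * ‖x - x'‖ := by
  obtain ⟨g, hg, -, -, h, -⟩ := A.exists_gradH_eq hη i
  rw [h hx, h hx']
  refine (norm_sphereGrad_sub_le (A.dims i) hη hg x x').trans ?_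
  rw [Real.coe_toNNReal _ (A.L_nonneg i)]
  gcongr
  · exact (A.L_nonneg i).trans (Q.L_le_Lmax i)
  · exact Q.L_le_Lmax i
  · exact Finset.le_sup (f := G.n) (Finset.mem_univ i)

theorem abs_smoothing_sub_le (hη : 0 < η) (i : Fin N) {x x' : Vec (G.n i)} (hx : x ∈ G.X i)
    (hx' : x' ∈ G.X i) :
    |smoothing η (G.hval i) x - smoothing η (G.hval i) x'| ≤ Q.Lmax * ‖x - x'‖ := by
  obtain ⟨g, hg, -, h, -, -⟩ := A.exists_gradH_eq hη i
  rw [h hx, h hx']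
  have := (lipschitzWith_smoothing η hg).dist_le_mul x x'
  rw [Real.coe_toNNReal _ (A.L_nonneg i), dist_eq_norm, dist_eq_norm] at this
  exact this.trans (by gcongr; exact Q.L_le_Lmax i)

/-- The evaluation points are `2η` apart, so the Lipschitz bound `2 η L_i` cancels the factor `1 /
(2 η)`. The bound is independent of `η` and holds surely. -/
theorem norm_exactEst_le (hη : 0 < η) (i : Fin N) {x v : Vec (G.n i)} (hx : x ∈ G.X i)
    (hv : ‖v‖ = η) (ξ : Ξ) : ‖G.exactEst η i x v ξ‖ ≤ G.nMax * Q.Lmax := by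
  obtain ⟨O, -, hsub, -, hlip⟩ := A.h_lip i
  have h1 := hlip ξ _ (hsub (G.mem_enlarged_add hx hv.le)) _ (hsub (G.mem_enlarged_sub hx hv.le))
  have h2 : x + v - (x - v) = (2 : ℝ) • v := by rw [two_smul]; abel
  rw [h2, norm_smul, hv, Real.norm_ofNat] at h1
  have hL := A.L_nonneg i
  rw [Game.exactEst, norm_smul, norm_smul, norm_inv, norm_norm, hv, inv_mul_cancel₀ hη.ne', mul_one,
    norm_mul, Real.norm_eq_abs, Real.norm_eq_abs, abs_of_nonneg (by positivity)]
  calc _ ≤ (G.n i : ℝ) / (2 * η) * (Q.L i * (2 * η)) := by gcongr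
    _ = G.n i * Q.L i := by field_simp
    _ ≤ _ := by
      gcongr
      · exact Finset.le_sup (f := G.n) (Finset.mem_univ i)
      · exact Q.L_le_Lmax i

theorem measurable_h_comp (i : Fin N) {Ω : Type*} [MeasurableSpace Ω] {x : Ω → Vec (G.n i)}
    {y : Ω → Vec (G.d i)} {ξ : Ω → Ξ} (hx : Measurable x) (hmem : ∀ ω, x ω ∈ G.enlarged η i)
    (hy : Measurable y) (hyY : ∀ ω, y ω ∈ G.Y i) (hξ : Measurable ξ) :
    Measurable fun ω => G.h i (x ω) (y ω) (ξ ω) :=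
  (A.h_meas i).comp ((Measurable.prodMk (hx.subtype_mk (h := hmem))
    (hy.subtype_mk (h := hyY))).prodMk hξ)

theorem measurable_exactEst (hη : 0 ≤ η) (i : Fin N) {Ω : Type*} [MeasurableSpace Ω]
    {x v : Ω → Vec (G.n i)} {ξ : Ω → Ξ} (hx : Measurable x) (hmem : ∀ ω, x ω ∈ G.X i)
    (hv : Measurable v) (hvn : ∀ ω, ‖v ω‖ = η) (hξ : Measurable ξ) :
    Measurable fun ω => G.exactEst η i (x ω) (v ω) (ξ ω) := by
  have h1 : ∀ ω, x ω + v ω ∈ G.enlarged η i := fun ω =>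
    G.mem_enlarged_add (hmem ω) (hvn ω).le
  have h2 : ∀ ω, x ω - v ω ∈ G.enlarged η i := fun ω =>
    G.mem_enlarged_sub (hmem ω) (hvn ω).le
  have m1 := A.measurable_h_comp i (hx.add hv) h1 (A.measurable_y_comp hη i (hx.add hv) h1)
    (fun ω => A.y_mem i (h1 ω)) hξ
  have m2 := A.measurable_h_comp i (hx.sub hv) h2 (A.measurable_y_comp hη i (hx.sub hv) h2)
    (fun ω => A.y_mem i (h2 ω)) hξ
  exact ((m1.sub m2).const_mul _).smul (hv.norm.inv.smul hv)

theorem integrable_h_y (i : Fin N) {x : Vec (G.n i)} (hx : x ∈ G.enlarged η i) :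
    Integrable (fun ξ => G.h i x (G.y i x) ξ) G.law := by
  obtain ⟨O, -, hsub, hint, -⟩ := A.h_lip i
  exact hint x (hsub hx)

/-- The exact two-point estimator is an unbiased estimator of the smoothed gradient. -/
theorem integral_integral_exactEst (hη : 0 < η) (i : Fin N) {x : Vec (G.n i)} (hx : x ∈ G.X i) :
    ∫ v, ∫ ξ, G.exactEst η i x v ξ ∂G.law ∂sphereLaw (G.n i) η = G.gradH η i x := by
  obtain ⟨g, hg, heq, -, h, -⟩ := A.exists_gradH_eq hη i
  have hd := A.dims i
  have h1 : ∀ᵐ v ∂sphereLaw (G.n i) η, ∫ ξ, G.exactEst η i x v ξ ∂G.law =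
      ((G.n i : ℝ) / (2 * η ^ 2)) • (g (x + v) • v - g (x - v) • v) := by
    filter_upwards [ae_norm_sphereLaw hη] with v hv
    have e1 := G.mem_enlarged_add hx hv.le
    have e2 := G.mem_enlarged_sub hx hv.le
    simp only [Game.exactEst]
    rw [integral_smul_const, integral_const_mul, integral_sub (A.integrable_h_y i e1)
      (A.integrable_h_y i e2)]
    have g1 : ∫ ξ, G.h i (x + v) (G.y i (x + v)) ξ ∂G.law = g (x + v) := heq e1
    have g2 : ∫ ξ, G.h i (x - v) (G.y i (x - v)) ξ ∂G.law = g (x - v) := heq e2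
    rw [g1, g2, hv, ← sub_smul, smul_smul, smul_smul]
    congr 1
    field_simp
  rw [integral_congr_ae h1, integral_smul, integral_sub]
  · have h2 := integral_sub_smul_sphereLaw hd hη hg x
    rw [h hx]
    -- Forward and backward evaluations each contribute half of the spherical mean, the second
    -- through the reflection identity.
    have hc : (G.n i : ℝ) / (2 * η ^ 2) = 2⁻¹ * (G.n i / η ^ 2) := by field_simp
    rw [hc, mul_smul, smul_sub, h2, sub_neg_eq_add]
    have h3 : ((G.n i : ℝ) / η ^ 2) • ∫ v, g (x + v) • v ∂sphereLaw (G.n i) η = sphereGrad η g x := rfl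
    rw [h3, ← two_smul ℝ, smul_smul]
    norm_num
  · exact integrable_sphereLaw hd hη ((hg.continuous.comp (by fun_prop)).smul continuous_id)
  · exact integrable_sphereLaw hd hη ((hg.continuous.comp (by fun_prop)).smul continuous_id)

/-- The gradient is a mean of estimates that all obey the sure bound. -/
theorem norm_gradH_le (hη : 0 < η) (i : Fin N) {x : Vec (G.n i)} (hx : x ∈ G.X i) :
    ‖G.gradH η i x‖ ≤ G.nMax * Q.Lmax := by
  have := A.prob
  have := isProbabilityMeasure_sphereLaw (A.dims i) η
  rw [← A.integral_integral_exactEst hη i hx]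
  refine (norm_integral_le_of_norm_le_const (C := G.nMax * Q.Lmax) ?_).trans (by simp)
  filter_upwards [ae_norm_sphereLaw hη] with v hv
  exact (norm_integral_le_of_norm_le_const (C := G.nMax * Q.Lmax)
    (Eventually.of_forall fun ξ => A.norm_exactEst_le hη i hx hv ξ)).trans (by simp)

end Assumptions


/-- The upper-level iteration in which a draw is used (none for the random index). -/
def DrawName.stage {N : ℕ} : DrawName N → Option ℕ
  | .sample k _ _ => some k
  | .direction k _ _ => some k
  | .lower k _ _ _ _ => some k
  | .index => none

/-- The draws used before iteration `k`. -/
def DrawName.past {N : ℕ} (k : ℕ) : Set (DrawName N) := {a | ∃ j < k, a.stage = some j}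

/-- The σ-algebra generated by a set of draws. -/
@[reducible]
def Draws.sig {N : ℕ} {n : Fin N → ℕ} {Ξ Ω : Type*} [MeasurableSpace Ξ] (D : Draws n Ξ Ω)
    (S : Set (DrawName N)) : MeasurableSpace Ω := ⨆ a ∈ S, D.sigma a

/-! ### σ-algebras generated by sets of draws. -/

section Sig

variable {N : ℕ} {n : Fin N → ℕ} {Ξ Ω : Type*} [MeasurableSpace Ξ] {D : Draws n Ξ Ω}

theorem Draws.sigma_le_sig {S : Set (DrawName N)} {a : DrawName N} (ha : a ∈ S) :
    D.sigma a ≤ D.sig S := le_iSup₂_of_le a ha le_rfl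

theorem Draws.sig_mono {S T : Set (DrawName N)} (h : S ⊆ T) : D.sig S ≤ D.sig T :=
  iSup₂_le fun _ ha => Draws.sigma_le_sig (h ha)

theorem Draws.measurable_ξ {S : Set (DrawName N)} {k : ℕ} {i : Fin N} {l : ℕ}
    (h : .sample k i l ∈ S) : Measurable[D.sig S] (D.ξ k i l) :=
  (comap_measurable (D.ξ k i l)).mono (Draws.sigma_le_sig (D := D) h) le_rfl

theorem Draws.measurable_v {S : Set (DrawName N)} {k : ℕ} {i : Fin N} {l : ℕ}
    (h : .direction k i l ∈ S) : Measurable[D.sig S] (D.v k i l) :=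
  (comap_measurable (D.v k i l)).mono (Draws.sigma_le_sig (D := D) h) le_rfl

theorem Draws.measurable_ζ {S : Set (DrawName N)} {k : ℕ} {i : Fin N} {l : ℕ} {b : Bool} {t : ℕ}
    (h : .lower k i l b t ∈ S) : Measurable[D.sig S] (D.ζ k i l b t) :=
  (comap_measurable (D.ζ k i l b t)).mono (Draws.sigma_le_sig (D := D) h) le_rfl

theorem Draws.measurable_R {S : Set (DrawName N)} (h : .index ∈ S) :
    Measurable[D.sig S] D.R :=
  (comap_measurable D.R).mono (Draws.sigma_le_sig (D := D) h) le_rfl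

variable [mΩ : MeasurableSpace Ω] {P : Measure Ω} {law : Measure Ξ} {η : ℝ} {T : ℕ}

theorem Draws.Valid.sigma_le (hD : D.Valid P law η T) (a : DrawName N) : D.sigma a ≤ mΩ := by
  cases a with
  | sample k i l => exact (hD.ξ_meas k i l).comap_le
  | direction k i l => exact (hD.v_meas k i l).comap_le
  | lower k i l b t => exact (hD.ζ_meas k i l b t).comap_le
  | index => exact hD.R_meas.comap_le

theorem Draws.Valid.sig_le (hD : D.Valid P law η T) (S : Set (DrawName N)) : D.sig S ≤ mΩ :=
  iSup₂_le fun a _ => hD.sigma_le a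

/-- Grouping of independent draws: the independence claims about the iterates below reduce to
disjointness of sets of names. -/
theorem Draws.Valid.indep_sig (hD : D.Valid P law η T) {S S' : Set (DrawName N)}
    (h : Disjoint S S') : Indep (D.sig S) (D.sig S') P :=
  indep_iSup_of_disjoint hD.sigma_le hD.indep h

theorem Draws.Valid.indep_sigma (hD : D.Valid P law η T) {S : Set (DrawName N)} {a : DrawName N}
    (h : a ∉ S) : Indep (D.sig S) (D.sigma a) P :=
  indep_of_indep_of_le_right (hD.indep_sig (Set.disjoint_singleton_right.2 h))
    (Draws.sigma_le_sig (Set.mem_singleton a))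

end Sig

/-- Replaces vectors outside the sphere of radius `η` by a fixed vector of norm `η`. -/
noncomputable def sphereFix {d : ℕ} (η : ℝ) (v : Vec d) : Vec d :=
  haveI := Classical.propDecidable
  if ‖v‖ = η then v else WithLp.toLp 2 fun _ => η / Real.sqrt d

theorem norm_sphereFix {d : ℕ} (hd : 1 ≤ d) {η : ℝ} (hη : 0 ≤ η) (v : Vec d) :
    ‖sphereFix η v‖ = η := by
  unfold sphereFix
  split_ifs with h
  · exact h
  · have : (0 : ℝ) < d := by positivity
    rw [EuclideanSpace.norm_eq]
    simp only [Real.norm_eq_abs, sq_abs, div_pow, Finset.sum_const, Finset.card_univ,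
      Fintype.card_fin, nsmul_eq_mul, Real.sq_sqrt this.le]
    rw [mul_div_cancel₀ _ this.ne', Real.sqrt_sq hη]

theorem sphereFix_of_norm_eq {d : ℕ} {η : ℝ} {v : Vec d} (h : ‖v‖ = η) : sphereFix η v = v :=
  if_pos h

theorem measurable_sphereFix {d : ℕ} (η : ℝ) : Measurable (sphereFix (d := d) η) :=
  Measurable.ite (measurableSet_eq_fun measurable_norm measurable_const) measurable_id
    measurable_const

/-- The draws with every direction put on the sphere. -/
noncomputable def Draws.fix {N : ℕ} {n : Fin N → ℕ} {Ξ Ω : Type*} (D : Draws n Ξ Ω) (η : ℝ) :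
    Draws n Ξ Ω := { D with v := fun k i l ω => sphereFix η (D.v k i l ω) }

/-! ### Directions placed on the sphere for every outcome. -/

section Fix

variable {N : ℕ} {n : Fin N → ℕ} {Ξ Ω : Type*} [MeasurableSpace Ξ] {D : Draws n Ξ Ω}
  [mΩ : MeasurableSpace Ω] {P : Measure Ω} {law : Measure Ξ} {η : ℝ} {T : ℕ}

theorem Draws.Valid.ae_norm (hD : D.Valid P law η T) (hη : 0 < η) :
    ∀ᵐ ω ∂P, ∀ k i l, ‖D.v k i l ω‖ = η := by
  simp only [ae_all_iff]
  intro k i l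
  have h := ae_norm_sphereLaw (d := n i) hη
  rw [← hD.v_law k i l] at h
  exact ae_of_ae_map (hD.v_meas k i l).aemeasurable h

theorem Draws.Valid.ae_fix_eq (hD : D.Valid P law η T) (hη : 0 < η) :
    ∀ᵐ ω ∂P, ∀ k i l, (D.fix η).v k i l ω = D.v k i l ω := by
  filter_upwards [hD.ae_norm hη] with ω hω k i l using sphereFix_of_norm_eq (hω k i l)

/-- Directions lie on the sphere only almost surely, but measurability over the enlarged sets
requires evaluation points inside them for every `ω`. The correction changes a null set, so the laws
persist, and it only coarsens the generated σ-algebras, so independence persists. -/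
theorem Draws.Valid.fix (hD : D.Valid P law η T) (hη : 0 < η) : (D.fix η).Valid P law η T where
  ξ_meas := hD.ξ_meas
  v_meas k i l := (measurable_sphereFix η).comp (hD.v_meas k i l)
  ζ_meas := hD.ζ_meas
  R_meas := hD.R_meas
  ξ_law := hD.ξ_law
  v_law k i l := by
    rw [← hD.v_law k i l]
    refine Measure.map_congr ?_
    filter_upwards [hD.ae_fix_eq hη] with ω hω using hω k i l
  ζ_law := hD.ζ_law
  R_law := hD.R_law
  indep := by
    have hle : ∀ a, (D.fix η).sigma a ≤ D.sigma a := by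
      intro a
      cases a with
      | sample k i l => exact le_rfl
      | direction k i l =>
        have h : Measurable[MeasurableSpace.comap (D.v k i l) inferInstance]
            (fun ω => sphereFix η (D.v k i l ω)) :=
          (measurable_sphereFix η).comp (comap_measurable (D.v k i l))
        exact h.comap_le
      | lower k i l b t => exact le_rfl
      | index => exact le_rfl
    rw [iIndep_iff]
    intro s f hf
    exact (iIndep_iff _ _).1 hD.indep s fun i hi => hle i _ (hf i hi)

end Fix

/-! ### Measurability of the iterates -/

namespace Assumptions

variable {N : ℕ} {Ξ : Type*} [MeasurableSpace Ξ] {G : Game N Ξ} {Q : Params G}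
  {K : HiddenConstants} {η : ℝ} (A : Assumptions G Q K η) {Ω : Type*} {D : Draws G.n Ξ Ω}
include A

theorem X_nonempty (i : Fin N) : (G.X i).Nonempty := ⟨_, A.x0_mem i⟩

theorem X_closed (i : Fin N) : IsClosed (G.X i) := (A.X_compact i).isClosed

theorem upperRun_mem (S : ℕ) (ω : Ω) (k : ℕ) : (upperRun Q K η S D ω k).x ∈ G.feasible := by
  cases k with
  | zero => exact A.x0_mem
  | succ k => exact fun i => proj_mem (A.X_closed i) (A.X_nonempty i) _

omit A in
theorem evalPoint_mem (hs : ∀ k i l ω, ‖D.v k i l ω‖ = η) {x : Profile G.n} (hx : x ∈ G.feasible)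
    (ω : Ω) (k : ℕ) (i : Fin N) (l : ℕ) (b : Bool) :
    evalPoint D ω k x i l b ∈ G.enlarged η i := by
  cases b
  · exact G.mem_enlarged_sub (hx i) (hs k i l ω).le
  · exact G.mem_enlarged_add (hx i) (hs k i l ω).le

variable [MeasurableSpace Ω]

omit A in
theorem measurable_evalPoint {x : Ω → Profile G.n} (hx : Measurable x) {k : ℕ} {i : Fin N} {l : ℕ}
    (hv : Measurable (D.v k i l)) (b : Bool) :
    Measurable fun ω => evalPoint D ω k (x ω) i l b := by
  have h1 : Measurable fun ω => x ω i := by fun_prop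
  cases b
  · exact h1.sub hv
  · exact h1.add hv

theorem measurable_zoValue (hs : ∀ k i l ω, ‖D.v k i l ω‖ = η) {x : Ω → Profile G.n}
    (hx : Measurable x) (hmem : ∀ ω, x ω ∈ G.feasible) {k : ℕ} {i : Fin N} {l : ℕ}
    (hξ : Measurable (D.ξ k i l)) (hv : Measurable (D.v k i l))
    (hζ : ∀ b t, Measurable (D.ζ k i l b t)) (b : Bool) :
    Measurable fun ω => zoValue Q K D ω k (x ω) i l b := by
  have he := fun ω => evalPoint_mem hs (hmem ω) ω k i l b
  have h1 := measurable_evalPoint hx hv b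
  have h2 := A.measurable_lowerRun i (A.F_meas i) h1 he (t := lowerIters K.δ k)
    (fun s _ => hζ b s)
  exact A.measurable_h_comp i h1 he h2 (fun ω => A.lowerRun_point_mem i _ _ _) hξ

theorem measurable_gradM_comp {x : Ω → Profile G.n} (hx : Measurable x)
    (hmem : ∀ ω, x ω ∈ G.feasible) (i : Fin N) {ξ : Ω → Ξ} (hξ : Measurable ξ) :
    Measurable fun ω => G.gradM i (x ω) (ξ ω) := by
  have h1 : Measurable fun ω => (⟨x ω, hmem ω⟩ : G.feasible) := hx.subtype_mk
  have h2 := (A.gradM_meas i).comp (h1.prodMk hξ)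
  exact h2

theorem measurable_deltaH (hs : ∀ k i l ω, ‖D.v k i l ω‖ = η) {x : Ω → Profile G.n}
    (hx : Measurable x) (hmem : ∀ ω, x ω ∈ G.feasible) {k : ℕ} {i : Fin N} {l : ℕ}
    (hξ : Measurable (D.ξ k i l)) (hv : Measurable (D.v k i l))
    (hζ : ∀ b t, Measurable (D.ζ k i l b t)) :
    Measurable fun ω => deltaH Q K η D ω k (x ω) i l :=
  (((A.measurable_zoValue hs hx hmem hξ hv hζ true).sub
    (A.measurable_zoValue hs hx hmem hξ hv hζ false)).const_mul _).smul (hv.norm.inv.smul hv)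

theorem measurable_deltaF (hs : ∀ k i l ω, ‖D.v k i l ω‖ = η) {x : Ω → Profile G.n}
    (hx : Measurable x) (hmem : ∀ ω, x ω ∈ G.feasible) {k : ℕ} {i : Fin N}
    (hξ : ∀ l, Measurable (D.ξ k i l)) (hv : ∀ l, Measurable (D.v k i l))
    (hζ : ∀ l b t, Measurable (D.ζ k i l b t)) (S : ℕ) :
    Measurable fun ω => deltaF Q K η S D ω k (x ω) i := by
  have h1 : Measurable fun ω => ∑ l ∈ Finset.range S, deltaH Q K η D ω k (x ω) i l :=
    Finset.measurable_fun_sum _ fun l _ => A.measurable_deltaH hs hx hmem (hξ l) (hv l) (hζ l)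
  have h2 : Measurable fun ω => ∑ l ∈ Finset.range S, G.gradM i (x ω) (D.ξ k i l ω) :=
    Finset.measurable_fun_sum _ fun l _ => A.measurable_gradM_comp hx hmem i (hξ l)
  exact (h1.const_smul ((S : ℝ)⁻¹)).add (h2.const_smul ((S : ℝ)⁻¹))

theorem measurable_step (hs : ∀ k i l ω, ‖D.v k i l ω‖ = η) {x : Ω → Profile G.n}
    (hx : Measurable x) (hmem : ∀ ω, x ω ∈ G.feasible) {k : ℕ}
    (hξ : ∀ i l, Measurable (D.ξ k i l)) (hv : ∀ i l, Measurable (D.v k i l))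
    (hζ : ∀ i l b t, Measurable (D.ζ k i l b t)) (S : ℕ) :
    Measurable fun ω => (WithLp.toLp 2 (fun i =>
        proj (G.X i) (x ω i - Q.γ K η • deltaF Q K η S D ω k (x ω) i)) : Profile G.n) := by
  refine (PiLp.continuous_toLp 2 _).measurable.comp (measurable_pi_lambda _ fun i => ?_)
  have h1 : Measurable fun ω => x ω i := by fun_prop
  have h2 := A.measurable_deltaF hs hx hmem (hξ i) (hv i) (hζ i) S
  exact (continuous_proj (A.X_closed i) (A.X_convex i) (A.X_nonempty i)).measurable.comp
    (h1.sub (h2.const_smul (Q.γ K η)))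

omit [MeasurableSpace Ω] in
-- Measurability with respect to the past is the substantive claim: it makes the iterate independent
-- of all draws of iteration `k` and of the random index. Hence `measurable_step` is used with the
-- smaller σ-algebra in place of the ambient one.
theorem measurable_upperRun (hs : ∀ k i l ω, ‖D.v k i l ω‖ = η) (S k : ℕ) :
    Measurable[D.sig (DrawName.past k)] fun ω => (upperRun Q K η S D ω k).x := by
  induction k with
  | zero => exact measurable_const
  | succ k ih =>
    have hsub : (DrawName.past k : Set (DrawName N)) ⊆ DrawName.past (k + 1) :=
      fun a ⟨j, hj, h⟩ => ⟨j, hj.trans (Nat.lt_succ_self k), h⟩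
    have hx := ih.mono (Draws.sig_mono (D := D) hsub) le_rfl
    exact @measurable_step N Ξ _ G Q K η A Ω D (D.sig (DrawName.past (k + 1))) hs _ hx
      (fun ω => A.upperRun_mem S ω k) k
      (fun i l => Draws.measurable_ξ ⟨k, Nat.lt_succ_self k, rfl⟩)
      (fun i l => Draws.measurable_v ⟨k, Nat.lt_succ_self k, rfl⟩)
      (fun i l b t => Draws.measurable_ζ ⟨k, Nat.lt_succ_self k, rfl⟩) S

end Assumptions


/-- Partial gradient of the smoothed objective of player `i`. -/
noncomputable def Game.gradF {N : ℕ} {Ξ : Type*} [MeasurableSpace Ξ] (G : Game N Ξ) (η : ℝ) (i : Fin N)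
    (x : Profile G.n) : Vec (G.n i) := G.gradH η i (x i) + ∫ ξ, G.gradM i x ξ ∂G.law

/-- Error of the one-sample estimator with exact lower-level solutions. -/
noncomputable def Game.noise {N : ℕ} {Ξ : Type*} [MeasurableSpace Ξ] (G : Game N Ξ) (η : ℝ) (i : Fin N)
    (x : Profile G.n) (v : Vec (G.n i)) (ξ : Ξ) : Vec (G.n i) :=
  G.exactEst η i (x i) v ξ + G.gradM i x ξ - G.gradF η i x

/-- Bound on the variance of `Game.noise`. -/
noncomputable def Params.noiseBound {N : ℕ} {Ξ : Type*} [MeasurableSpace Ξ] {G : Game N Ξ}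
    (Q : Params G) (K : HiddenConstants) : ℝ :=
  8 * ((G.nMax : ℝ) * Q.Lmax) ^ 2 + 2 * K.σm ^ 2

theorem Params.noiseBound_nonneg {N : ℕ} {Ξ : Type*} [MeasurableSpace Ξ] {G : Game N Ξ}
    (Q : Params G) (K : HiddenConstants) : 0 ≤ Q.noiseBound K := by
  unfold Params.noiseBound; positivity

theorem norm_add_sq_le_two {E : Type*} [SeminormedAddCommGroup E] (a b : E) :
    ‖a + b‖ ^ 2 ≤ 2 * ‖a‖ ^ 2 + 2 * ‖b‖ ^ 2 := by
  have := norm_add_le a b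
  nlinarith [sq_nonneg (‖a‖ - ‖b‖), norm_nonneg (a + b), norm_nonneg a, norm_nonneg b]

/-! ### Mean and variance of a single exact sample. -/

namespace Assumptions

variable {N : ℕ} {Ξ : Type*} [MeasurableSpace Ξ] {G : Game N Ξ} {Q : Params G}
  {K : HiddenConstants} {η : ℝ} (A : Assumptions G Q K η)
include A

theorem measurable_gradF (hη : 0 < η) (i : Fin N) :
    Measurable fun x : G.feasible => G.gradF η i x := by
  have := A.prob
  have h1 : Measurable fun x : G.X i => G.gradH η i x := by
    have : LipschitzWith (Real.toNNReal (Q.Lmax * Real.sqrt G.nMax / η))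
        fun x : G.X i => G.gradH η i x := by
      refine LipschitzWith.of_dist_le_mul fun x y => ?_
      rw [dist_eq_norm, Subtype.dist_eq, dist_eq_norm]
      exact (A.norm_gradH_sub_le hη i x.2 y.2).trans (by gcongr; exact Real.le_coe_toNNReal _)
    exact this.continuous.measurable
  have h2 : Measurable fun x : G.feasible => (⟨x.1 i, x.2 i⟩ : G.X i) := by
    refine Measurable.subtype_mk ?_
    have : Measurable fun x : Profile G.n => x i := by fun_prop
    exact this.comp measurable_subtype_coe
  have h3 := ((A.gradM_meas i).stronglyMeasurable.integral_prod_right' (ν := G.law)).measurable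
  exact (h1.comp h2).add h3

theorem measurable_noise (hη : 0 < η) (i : Fin N) {Ω : Type*} [MeasurableSpace Ω]
    {x : Ω → Profile G.n} (hx : Measurable x) (hmem : ∀ ω, x ω ∈ G.feasible)
    {v : Ω → Vec (G.n i)} (hv : Measurable v) (hvn : ∀ ω, ‖v ω‖ = η) {ξ : Ω → Ξ}
    (hξ : Measurable ξ) : Measurable fun ω => G.noise η i (x ω) (v ω) (ξ ω) := by
  have h0 : Measurable fun ω => x ω i := by fun_prop
  have h1 := A.measurable_exactEst hη.le i h0 (fun ω => hmem ω i) hv hvn hξ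
  have h2 := A.measurable_gradM_comp hx hmem i hξ
  have h3 : Measurable fun ω => (⟨x ω, hmem ω⟩ : G.feasible) := hx.subtype_mk
  have h4 := (A.measurable_gradF hη i).comp h3
  exact (h1.add h2).sub h4

/-- The estimator and its mean are both at most `n_max L_max` in norm, so their squared distance is
at most `4 (n_max L_max)²`; splitting off the `∇ m̃_i` part doubles both terms. The insertion of
`sphereFix` lets the sure bound hold for every direction argument. -/
theorem noise_moments (hη : 0 < η) (i : Fin N) {x : Profile G.n} (hx : x ∈ G.feasible) :
    Integrable (fun w : Vec (G.n i) × Ξ => G.noise η i x (sphereFix η w.1) w.2)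
      ((sphereLaw (G.n i) η).prod G.law) ∧
    ∫ w, G.noise η i x (sphereFix η w.1) w.2 ∂(sphereLaw (G.n i) η).prod G.law = 0 ∧
    Integrable (fun w : Vec (G.n i) × Ξ => ‖G.noise η i x (sphereFix η w.1) w.2‖ ^ 2)
      ((sphereLaw (G.n i) η).prod G.law) ∧
    ∫ w, ‖G.noise η i x (sphereFix η w.1) w.2‖ ^ 2 ∂(sphereLaw (G.n i) η).prod G.law ≤
      Q.noiseBound K := by
  have := A.prob
  have := isProbabilityMeasure_sphereLaw (A.dims i) η
  set ρ := (sphereLaw (G.n i) η).prod G.law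
  have hfn : ∀ w : Vec (G.n i) × Ξ, ‖sphereFix η w.1‖ = η := fun w => norm_sphereFix (A.dims i) hη.le _
  have hfm : Measurable fun w : Vec (G.n i) × Ξ => sphereFix η w.1 :=
    (measurable_sphereFix η).comp measurable_fst
  have hem : Measurable fun w : Vec (G.n i) × Ξ => G.exactEst η i (x i) (sphereFix η w.1) w.2 :=
    A.measurable_exactEst hη.le i measurable_const (fun _ => hx i) hfm hfn measurable_snd
  have hbd : ∀ w : Vec (G.n i) × Ξ, ‖G.exactEst η i (x i) (sphereFix η w.1) w.2‖ ≤
      G.nMax * Q.Lmax := fun w => A.norm_exactEst_le hη i (hx i) (hfn w) w.2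
  have hei : Integrable (fun w : Vec (G.n i) × Ξ => G.exactEst η i (x i) (sphereFix η w.1) w.2) ρ :=
    Integrable.of_bound hem.aestronglyMeasurable _ (Eventually.of_forall hbd)
  have hmean : ∫ w, G.exactEst η i (x i) (sphereFix η w.1) w.2 ∂ρ = G.gradH η i (x i) := by
    rw [integral_prod _ hei, ← A.integral_integral_exactEst hη i (hx i)]
    refine integral_congr_ae ?_
    filter_upwards [ae_norm_sphereLaw hη] with v hv
    simp only [sphereFix_of_norm_eq hv]
  have hgL := A.gradM_memLp i x hx
  have hgi : Integrable (fun ξ => G.gradM i x ξ) G.law := hgL.integrable (by norm_num)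
  set c := ∫ ξ, G.gradM i x ξ ∂G.law with hc
  have hgs : Integrable (fun w : Vec (G.n i) × Ξ => G.gradM i x w.2) ρ := hgi.comp_snd _
  have hgmean : ∫ w, G.gradM i x w.2 ∂ρ = c := by
    rw [integral_fun_snd (μ := sphereLaw (G.n i) η) (ν := G.law) (G.gradM i x)]; simp [hc]
  have hg2 : Integrable (fun ξ => ‖G.gradM i x ξ - c‖ ^ 2) G.law :=
    (hgL.sub (memLp_const c)).integrable_norm_pow (by norm_num)
  have hg2s : Integrable (fun w : Vec (G.n i) × Ξ => ‖G.gradM i x w.2 - c‖ ^ 2) ρ := hg2.comp_snd _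
  have hg2b : ∫ w, ‖G.gradM i x w.2 - c‖ ^ 2 ∂ρ ≤ K.σm ^ 2 := by
    rw [integral_fun_snd (μ := sphereLaw (G.n i) η) (ν := G.law) (fun ξ => ‖G.gradM i x ξ - c‖ ^ 2)]
    have := A.second_moment i x hx
    rw [(A.unbiased i x hx).gradient] at this
    simpa using this
  have hsplit : ∀ w : Vec (G.n i) × Ξ, G.noise η i x (sphereFix η w.1) w.2 =
      (G.exactEst η i (x i) (sphereFix η w.1) w.2 - G.gradH η i (x i)) + (G.gradM i x w.2 - c) :=
    fun w => by simp only [Game.noise, Game.gradF, ← hc]; abel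
  have hpt : ∀ w : Vec (G.n i) × Ξ, ‖G.noise η i x (sphereFix η w.1) w.2‖ ^ 2 ≤
      8 * ((G.nMax : ℝ) * Q.Lmax) ^ 2 + 2 * ‖G.gradM i x w.2 - c‖ ^ 2 := fun w => by
    rw [hsplit]
    refine (norm_add_sq_le_two _ _).trans ?_
    have h1 : ‖G.exactEst η i (x i) (sphereFix η w.1) w.2 - G.gradH η i (x i)‖ ≤
        2 * (G.nMax * Q.Lmax) :=
      (norm_sub_le _ _).trans (by linarith [hbd w, A.norm_gradH_le hη i (hx i)])
    have h2 : ‖G.exactEst η i (x i) (sphereFix η w.1) w.2 - G.gradH η i (x i)‖ ^ 2 ≤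
        (2 * (G.nMax * Q.Lmax)) ^ 2 := by gcongr
    linarith
  have hnm : Measurable fun w : Vec (G.n i) × Ξ => G.noise η i x (sphereFix η w.1) w.2 :=
    A.measurable_noise hη i measurable_const (fun _ => hx) hfm hfn measurable_snd
  have hdom : Integrable (fun w : Vec (G.n i) × Ξ =>
      8 * ((G.nMax : ℝ) * Q.Lmax) ^ 2 + 2 * ‖G.gradM i x w.2 - c‖ ^ 2) ρ :=
    (integrable_const _).add (hg2s.const_mul 2)
  have hsq : Integrable (fun w : Vec (G.n i) × Ξ => ‖G.noise η i x (sphereFix η w.1) w.2‖ ^ 2) ρ :=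
    Integrable.mono' hdom (hnm.norm.pow_const 2).aestronglyMeasurable
      (Eventually.of_forall fun w => by
        rw [Real.norm_eq_abs, abs_of_nonneg (by positivity)]; exact hpt w)
  refine ⟨(hei.add hgs).sub (integrable_const _), ?_, hsq, ?_⟩
  · have h1 : Integrable (fun w : Vec (G.n i) × Ξ =>
        G.exactEst η i (x i) (sphereFix η w.1) w.2 + G.gradM i x w.2) ρ := hei.add hgs
    simp only [Game.noise]
    rw [integral_sub h1 (integrable_const _), integral_add hei hgs, hmean, hgmean]
    simp [Game.gradF, hc]
  · refine (integral_mono hsq hdom hpt).trans ?_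
    have h2 : ∫ w, 2 * ‖G.gradM i x w.2 - c‖ ^ 2 ∂ρ = 2 * ∫ w, ‖G.gradM i x w.2 - c‖ ^ 2 ∂ρ :=
      integral_const_mul _ _
    rw [integral_add (integrable_const _) (hg2s.const_mul 2), h2]
    simp only [integral_const, probReal_univ, smul_eq_mul, one_mul, Params.noiseBound]
    linarith

end Assumptions

/-! ### Noise of the mini-batch estimator -/

theorem integrable_inner_of_memLp {Ω E : Type*} [MeasurableSpace Ω] [NormedAddCommGroup E]
    [InnerProductSpace ℝ E] {P : Measure Ω} {f g : Ω → E} (hf : MemLp f 2 P) (hg : MemLp g 2 P) :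
    Integrable (fun ω => ⟪f ω, g ω⟫) P := by
  refine Integrable.mono' ((hf.integrable_norm_pow (by norm_num)).add
    (hg.integrable_norm_pow (by norm_num))) (hf.1.inner hg.1) (Eventually.of_forall fun ω => ?_)
  have := abs_real_inner_le_norm (f ω) (g ω)
  simp only [Real.norm_eq_abs, Pi.add_apply]
  nlinarith [sq_nonneg (‖f ω‖ - ‖g ω‖), sq_nonneg ‖f ω‖, sq_nonneg ‖g ω‖]

/-- Orthogonality removes all cross terms, so the second moment of the sum grows linearly in `S`.
After division by `S²` this is the gain from batching. -/
theorem integral_norm_sum_sq_le {Ω E : Type*} [MeasurableSpace Ω] [NormedAddCommGroup E]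
    [InnerProductSpace ℝ E] {P : Measure Ω} {Z : ℕ → Ω → E} {S : ℕ} {V : ℝ}
    (hint : ∀ l, MemLp (Z l) 2 P) (hV : ∀ l, ∫ ω, ‖Z l ω‖ ^ 2 ∂P ≤ V)
    (hort : ∀ l l', l ≠ l' → ∫ ω, ⟪Z l ω, Z l' ω⟫ ∂P = 0) :
    ∫ ω, ‖∑ l ∈ Finset.range S, Z l ω‖ ^ 2 ∂P ≤ S * V := by
  have hi : ∀ l l', Integrable (fun ω => ⟪Z l ω, Z l' ω⟫) P := fun l l' =>
    integrable_inner_of_memLp (hint l) (hint l')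
  simp only [← real_inner_self_eq_norm_sq, sum_inner, inner_sum] at hV ⊢
  rw [integral_finsetSum _ fun l _ => integrable_finsetSum _ fun l' _ => hi _ _]
  calc _ ≤ ∑ _l ∈ Finset.range S, V := by
        refine Finset.sum_le_sum fun l hl => ?_
        rw [integral_finsetSum _ fun l' _ => hi _ _, Finset.sum_eq_single_of_mem l hl]
        · exact hV l
        · intro l' _ h
          exact hort _ _ h
    _ = _ := by simp

/-- Convexity only: this serves the biases, which have no reason to be orthogonal. -/
theorem norm_avg_sq_le {E : Type*} [NormedAddCommGroup E] [NormedSpace ℝ E] {S : ℕ} (hS : 1 ≤ S)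
    (b : ℕ → E) : ‖(S : ℝ)⁻¹ • ∑ l ∈ Finset.range S, b l‖ ^ 2 ≤
      (S : ℝ)⁻¹ * ∑ l ∈ Finset.range S, ‖b l‖ ^ 2 := by
  have hS' : (0 : ℝ) < S := by exact_mod_cast hS
  rw [norm_smul, mul_pow, norm_inv, Real.norm_natCast]
  have h1 : ‖∑ l ∈ Finset.range S, b l‖ ^ 2 ≤ S * ∑ l ∈ Finset.range S, ‖b l‖ ^ 2 := by
    calc _ ≤ (∑ l ∈ Finset.range S, ‖b l‖) ^ 2 := by gcongr; exact norm_sum_le _ _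
      _ ≤ _ := by simpa using sq_sum_le_card_mul_sum_sq (s := Finset.range S) (f := fun l => ‖b l‖)
  calc _ ≤ ((S : ℝ)⁻¹) ^ 2 * (S * ∑ l ∈ Finset.range S, ‖b l‖ ^ 2) := by gcongr
    _ = _ := by field_simp

/-- Bound on the mean-square bias caused by `t` lower-level iterations. -/
noncomputable def Params.biasBound {N : ℕ} {Ξ : Type*} [MeasurableSpace Ξ] {G : Game N Ξ} (Q : Params G)
    (K : HiddenConstants) (η : ℝ) (t : ℕ) : ℝ :=
  32 * (G.nMax : ℝ) ^ 2 * Q.LyMax ^ 2 * K.cmax / (η ^ 2 * (t + K.Γ))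

namespace Assumptions

variable {N : ℕ} {Ξ : Type*} [MeasurableSpace Ξ] {G : Game N Ξ} {Q : Params G}
  {K : HiddenConstants} {η : ℝ} (A : Assumptions G Q K η) {Ω : Type*} [mΩ : MeasurableSpace Ω]
  {P : Measure Ω} [IsProbabilityMeasure P] {D : Draws G.n Ξ Ω} {T : ℕ}
include A

/-- The iterate is a function of the past and `(v, ξ)` is fresh, so each moment is computed with the
iterate frozen. For two distinct samples, freezing the iterate together with the first one leaves
the second with mean zero. -/
theorem noise_draw (hη : 0 < η) (hD : D.Valid P G.law η T) (hs : ∀ k i l ω, ‖D.v k i l ω‖ = η)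
    (S k : ℕ) (i : Fin N) (l : ℕ) :
    MemLp (fun ω => G.noise η i (upperRun Q K η S D ω k).x (D.v k i l ω) (D.ξ k i l ω)) 2 P ∧
    ∫ ω, ‖G.noise η i (upperRun Q K η S D ω k).x (D.v k i l ω) (D.ξ k i l ω)‖ ^ 2 ∂P ≤
      Q.noiseBound K ∧
    ∀ l', l ≠ l' → ∫ ω, ⟪G.noise η i (upperRun Q K η S D ω k).x (D.v k i l ω) (D.ξ k i l ω),
      G.noise η i (upperRun Q K η S D ω k).x (D.v k i l' ω) (D.ξ k i l' ω)⟫ ∂P = 0 := by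
  have := A.prob
  have := isProbabilityMeasure_sphereLaw (A.dims i) η
  set x : Ω → Profile G.n := fun ω => (upperRun Q K η S D ω k).x with hx
  have hmem : ∀ ω, x ω ∈ G.feasible := fun ω => A.upperRun_mem S ω k
  have hxs : Measurable[D.sig (DrawName.past k)] x := A.measurable_upperRun hs S k
  have hxm : Measurable x := hxs.mono (hD.sig_le _) le_rfl
  set W : ℕ → Ω → Vec (G.n i) × Ξ := fun l ω => (D.v k i l ω, D.ξ k i l ω) with hW
  set names : ℕ → Set (DrawName N) := fun l => {.direction k i l, .sample k i l} with hnames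
  have hWs : ∀ l, Measurable[D.sig (names l)] (W l) := fun l =>
    Measurable.prodMk (Draws.measurable_v (by simp [hnames])) (Draws.measurable_ξ (by simp [hnames]))
  have hWm : ∀ l, Measurable (W l) := fun l => (hWs l).mono (hD.sig_le _) le_rfl
  have hWlaw : ∀ l, P.map (W l) = (sphereLaw (G.n i) η).prod G.law := fun l => by
    have hind : IndepFun (D.v k i l) (D.ξ k i l) P :=
      indepFun_of_indep (hD.indep_sig (S := {.direction k i l}) (S' := {.sample k i l}) (by simp))
        (Draws.measurable_v (by simp)) (Draws.measurable_ξ (by simp))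
    have := (indepFun_iff_map_prod_eq_prod_map_map (hD.v_meas k i l).aemeasurable
      (hD.ξ_meas k i l).aemeasurable).1 hind
    rw [hD.v_law, hD.ξ_law] at this
    exact this
  have hfn : ∀ v : Vec (G.n i), ‖sphereFix η v‖ = η := fun v => norm_sphereFix (A.dims i) hη.le _
  set f : G.feasible × (Vec (G.n i) × Ξ) → Vec (G.n i) :=
    fun p => G.noise η i p.1 (sphereFix η p.2.1) p.2.2 with hf
  have hfm : Measurable f := A.measurable_noise hη i (measurable_subtype_coe.comp measurable_fst)
    (fun p => p.1.2) ((measurable_sphereFix η).comp (measurable_fst.comp measurable_snd))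
    (fun p => hfn _) (measurable_snd.comp measurable_snd)
  set X : Ω → G.feasible := fun ω => ⟨x ω, hmem ω⟩ with hX
  have hXs : Measurable[D.sig (DrawName.past k)] X := hxs.subtype_mk
  have hXm : Measurable X := hXs.mono (hD.sig_le _) le_rfl
  have hfeq : ∀ l ω, G.noise η i (upperRun Q K η S D ω k).x (D.v k i l ω) (D.ξ k i l ω) = f (X ω, W l ω) := fun l ω => by
    simp only [hf, hX, hW, sphereFix_of_norm_eq (hs k i l ω), hx]
  simp only [hfeq]
  have hpast : ∀ l, ∀ a ∈ names l, a ∉ (DrawName.past k : Set (DrawName N)) := fun l a ha => by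
    rintro ⟨j, hj, hja⟩
    rcases ha with rfl | rfl <;> simp [DrawName.stage] at hja <;> omega
  have hIX : ∀ l, IndepFun X (W l) P := fun l =>
    indepFun_of_indep (hD.indep_sig (Set.disjoint_right.2 (hpast l))) hXs (hWs l)
  have hsq : ∀ l, Integrable (fun ω => ‖f (X ω, W l ω)‖ ^ 2) P ∧
      ∫ ω, ‖f (X ω, W l ω)‖ ^ 2 ∂P ≤ Q.noiseBound K := fun l =>
    integral_le_of_indepFun hXm (hWm l) (hWlaw l) (hIX l) (hfm.norm.pow_const 2)
      (fun _ => by positivity) (fun a => (A.noise_moments hη i a.2).2.2.1)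
      (fun a => (A.noise_moments hη i a.2).2.2.2)
  have hL2 : ∀ l, MemLp (fun ω => f (X ω, W l ω)) 2 P := fun l =>
    (memLp_two_iff_integrable_sq_norm
      (hfm.comp (hXm.prodMk (hWm l))).aestronglyMeasurable).2 (hsq l).1
  refine ⟨hL2 l, (hsq l).2, fun l' hl => ?_⟩
  -- The frozen part for the cross term: the iterate and the `l`-th sample, both independent of the
  -- `l'`-th sample.
  set Y : Ω → G.feasible × (Vec (G.n i) × Ξ) := fun ω => (X ω, W l ω) with hY
  have hYs : Measurable[D.sig (DrawName.past k ∪ names l)] Y :=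
    Measurable.prodMk (hXs.mono (Draws.sig_mono (D := D) Set.subset_union_left) le_rfl)
      ((hWs l).mono (Draws.sig_mono (D := D) Set.subset_union_right) le_rfl)
  have hIY : IndepFun Y (W l') P := by
    refine indepFun_of_indep (hD.indep_sig (Set.disjoint_right.2 fun a ha => ?_)) hYs (hWs l')
    rw [Set.mem_union, not_or]
    refine ⟨hpast l' a ha, ?_⟩
    rcases ha with rfl | rfl <;> simp [hnames, hl.symm]
  have hgm : Measurable fun p : (G.feasible × (Vec (G.n i) × Ξ)) × (Vec (G.n i) × Ξ) =>
      ⟪f p.1, f (p.1.1, p.2)⟫ :=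
    (hfm.comp measurable_fst).inner
      (hfm.comp ((measurable_fst.comp measurable_fst).prodMk measurable_snd))
  have hgi : Integrable (fun ω => ⟪f (Y ω), f ((Y ω).1, W l' ω)⟫) P :=
    integrable_inner_of_memLp (hL2 l) (hL2 l')
  have key := integral_of_indepFun (hYs.mono (hD.sig_le _) le_rfl) (hWm l') (hWlaw l') hIY hgm hgi
  refine key.trans ?_
  refine integral_eq_zero_of_ae (Eventually.of_forall fun ω => ?_)
  have hm := A.noise_moments hη i (hmem ω)
  have h0 : ∫ b, f ((Y ω).1, b) ∂(sphereLaw (G.n i) η).prod G.law = 0 := hm.2.1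
  have hi : Integrable (fun b => f ((Y ω).1, b)) ((sphereLaw (G.n i) η).prod G.law) := hm.1
  change ∫ b, ⟪f (Y ω), f ((Y ω).1, b)⟫ ∂(sphereLaw (G.n i) η).prod G.law = (0 : ℝ)
  rw [integral_inner hi, h0, inner_zero_right]

/-- The filtration starts with the past and the direction, which determine the evaluation point, and
gains one lower-level sample per step. The upper-level sample is left out, as the lower run never
sees it. -/
theorem lowerCall_error (hη : 0 < η) (hD : D.Valid P G.law η T)
    (hs : ∀ k i l ω, ‖D.v k i l ω‖ = η) (S k : ℕ) (i : Fin N) (l : ℕ) (b : Bool) :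
    Integrable (fun ω => ‖(lowerCall Q K D ω k (upperRun Q K η S D ω k).x i l b).point -
      G.y i (evalPoint D ω k (upperRun Q K η S D ω k).x i l b)‖ ^ 2) P ∧
    ∫ ω, ‖(lowerCall Q K D ω k (upperRun Q K η S D ω k).x i l b).point -
      G.y i (evalPoint D ω k (upperRun Q K η S D ω k).x i l b)‖ ^ 2 ∂P ≤
      32 * K.cmax / (lowerIters K.δ k + K.Γ) := by
  have hmem : ∀ ω, (upperRun Q K η S D ω k).x ∈ G.feasible := fun ω => A.upperRun_mem S ω k
  set names : ℕ → Set (DrawName N) := fun t => DrawName.past k ∪ ({.direction k i l} ∪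
    {a | ∃ s < t, a = .lower k i l b s}) with hnames
  have hmono : Monotone names := by
    intro t t' htt
    refine Set.union_subset_union_right _ (Set.union_subset_union_right _ ?_)
    rintro a ⟨s, hs, rfl⟩
    exact ⟨s, hs.trans_le htt, rfl⟩
  have hx : Measurable[D.sig (names 0)]
      fun ω => evalPoint D ω k (upperRun Q K η S D ω k).x i l b := by
    have h1 := (A.measurable_upperRun (D := D) hs S k).mono
      (Draws.sig_mono (D := D) (Set.subset_union_left : _ ⊆ names 0)) le_rfl
    have h2 : Measurable[D.sig (names 0)] (D.v k i l) := Draws.measurable_v (by simp [hnames])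
    exact @measurable_evalPoint N Ξ _ G Ω D (D.sig (names 0)) _ h1 k i l h2 b
  exact A.integral_norm_lowerRun_sub_sq_le hη.le i (m := fun t => D.sig (names t))
    (fun t => hD.sig_le _) (fun t t' h => Draws.sig_mono (hmono h)) hx
    (fun ω => evalPoint_mem hs (hmem ω) ω k i l b) (ζ := fun t => D.ζ k i l b t)
    (fun t => Draws.measurable_ζ (Or.inr (Or.inr ⟨t, Nat.lt_succ_self t, rfl⟩)))
    (fun t => hD.ζ_law k i l b t)
    (fun t => hD.indep_sigma (a := .lower k i l b t) (by
      rintro (⟨j, hj, h⟩ | h | ⟨s, hs, h⟩)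
      · simp [DrawName.stage] at h; omega
      · simp at h
      · simp at h; omega)) (lowerIters K.δ k)

/-- Both estimators use the same direction and sample, so they differ only through `h̃_i` in its
lower-level argument, where `L^y_max` times the lower-level error controls it. -/
theorem bias_draw (hη : 0 < η) (hD : D.Valid P G.law η T)
    (hs : ∀ k i l ω, ‖D.v k i l ω‖ = η) (S k : ℕ) (i : Fin N) (l : ℕ) :
    Integrable (fun ω => ‖deltaH Q K η D ω k (upperRun Q K η S D ω k).x i l -
      G.exactEst η i ((upperRun Q K η S D ω k).x i) (D.v k i l ω) (D.ξ k i l ω)‖ ^ 2) P ∧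
    ∫ ω, ‖deltaH Q K η D ω k (upperRun Q K η S D ω k).x i l -
      G.exactEst η i ((upperRun Q K η S D ω k).x i) (D.v k i l ω) (D.ξ k i l ω)‖ ^ 2 ∂P ≤
      Q.biasBound K η (lowerIters K.δ k) := by
  set x : Ω → Profile G.n := fun ω => (upperRun Q K η S D ω k).x with hx
  have hmem : ∀ ω, x ω ∈ G.feasible := fun ω => A.upperRun_mem S ω k
  have hxm : Measurable x := (A.measurable_upperRun hs S k).mono (hD.sig_le _) le_rfl
  have hxi : Measurable fun ω => x ω i := by fun_prop
  have hmd := A.measurable_deltaH hs hxm hmem (hD.ξ_meas k i l) (hD.v_meas k i l)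
    (hD.ζ_meas k i l)
  have hme := A.measurable_exactEst hη.le i hxi (fun ω => hmem ω i) (hD.v_meas k i l)
    (hs k i l) (hD.ξ_meas k i l)
  set r : Bool → Ω → ℝ := fun b ω => ‖(lowerCall Q K D ω k (x ω) i l b).point -
      G.y i (evalPoint D ω k (x ω) i l b)‖ with hr
  obtain ⟨it, bt⟩ := A.lowerCall_error hη hD hs S k i l true
  obtain ⟨jf, bf⟩ := A.lowerCall_error hη hD hs S k i l false
  have hLy := A.Ly_nonneg i
  have hzo : ∀ b ω, |zoValue Q K D ω k (x ω) i l b - G.h i (evalPoint D ω k (x ω) i l b)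
      (G.y i (evalPoint D ω k (x ω) i l b)) (D.ξ k i l ω)| ≤ Q.LyMax * r b ω := fun b ω => by
    have he := evalPoint_mem hs (hmem ω) ω k i l b
    refine (A.h_lip_y i _ he (D.ξ k i l ω) _ (A.lowerRun_point_mem i _ _ _) _
      (A.y_mem i he)).trans ?_
    exact mul_le_mul_of_nonneg_right (Q.Ly_le_LyMax i) (norm_nonneg _)
  have hLM : 0 ≤ Q.LyMax := hLy.trans (Q.Ly_le_LyMax i)
  -- From `(n_max / (2η))² · 2 (L^y_max)²`: the factor `2` comes from squaring a difference of two
  -- errors.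
  set c : ℝ := (G.nMax : ℝ) ^ 2 * Q.LyMax ^ 2 / (2 * η ^ 2) with hc
  have hpt : ∀ ω, ‖deltaH Q K η D ω k (x ω) i l -
      G.exactEst η i (x ω i) (D.v k i l ω) (D.ξ k i l ω)‖ ^ 2 ≤
      c * (r true ω ^ 2 + r false ω ^ 2) := fun ω => by
    have e1 : deltaH Q K η D ω k (x ω) i l -
        G.exactEst η i (x ω i) (D.v k i l ω) (D.ξ k i l ω) =
        ((G.n i : ℝ) / (2 * η) * ((zoValue Q K D ω k (x ω) i l true -
          G.h i (evalPoint D ω k (x ω) i l true) (G.y i (evalPoint D ω k (x ω) i l true))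
            (D.ξ k i l ω)) - (zoValue Q K D ω k (x ω) i l false -
          G.h i (evalPoint D ω k (x ω) i l false) (G.y i (evalPoint D ω k (x ω) i l false))
            (D.ξ k i l ω)))) • (‖D.v k i l ω‖⁻¹ • D.v k i l ω) := by
      simp only [deltaH, Game.exactEst, evalPoint, if_true, Bool.false_eq_true, if_false]
      rw [← sub_smul]
      congr 1
      ring
    rw [e1, norm_smul, norm_smul, norm_inv, norm_norm, hs, inv_mul_cancel₀ hη.ne', mul_one,
      Real.norm_eq_abs, sq_abs, mul_pow]
    have h1 := hzo true ω
    have h2 := hzo false ω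
    set a1 := zoValue Q K D ω k (x ω) i l true - G.h i (evalPoint D ω k (x ω) i l true)
      (G.y i (evalPoint D ω k (x ω) i l true)) (D.ξ k i l ω)
    set a2 := zoValue Q K D ω k (x ω) i l false - G.h i (evalPoint D ω k (x ω) i l false)
      (G.y i (evalPoint D ω k (x ω) i l false)) (D.ξ k i l ω)
    have h3 : (a1 - a2) ^ 2 ≤ Q.LyMax ^ 2 * (2 * (r true ω ^ 2 + r false ω ^ 2)) := by
      have h4 : a1 ^ 2 ≤ (Q.LyMax * r true ω) ^ 2 := sq_le_sq' (abs_le.1 h1).1 (abs_le.1 h1).2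
      have h5 : a2 ^ 2 ≤ (Q.LyMax * r false ω) ^ 2 := sq_le_sq' (abs_le.1 h2).1 (abs_le.1 h2).2
      nlinarith [sq_nonneg (a1 + a2)]
    calc _ ≤ ((G.nMax : ℝ) / (2 * η)) ^ 2 *
          (Q.LyMax ^ 2 * (2 * (r true ω ^ 2 + r false ω ^ 2))) := by
            gcongr
            exact Finset.le_sup (f := G.n) (Finset.mem_univ i)
      _ = _ := by rw [hc]; field_simp
  have hdom : Integrable (fun ω => c * (r true ω ^ 2 + r false ω ^ 2)) P := (it.add jf).const_mul c
  have hi : Integrable (fun ω => ‖deltaH Q K η D ω k (x ω) i l -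
      G.exactEst η i (x ω i) (D.v k i l ω) (D.ξ k i l ω)‖ ^ 2) P :=
    Integrable.mono' hdom ((hmd.sub hme).norm.pow_const 2).aestronglyMeasurable
      (Eventually.of_forall fun ω => by
        rw [Real.norm_eq_abs, abs_of_nonneg (by positivity)]; exact hpt ω)
  refine ⟨hi, (integral_mono hi hdom hpt).trans ?_⟩
  rw [integral_const_mul, integral_add it jf]
  have hΓ := K.Γ_pos
  calc _ ≤ c * (32 * K.cmax / (lowerIters K.δ k + K.Γ) + 32 * K.cmax / (lowerIters K.δ k + K.Γ)) := by
        gcongr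
    _ = _ := by rw [hc, Params.biasBound]; field_simp; ring

/-- Mean-square error of the mini-batch gradient. -/
theorem integral_norm_deltaF_sub_sq_le (hη : 0 < η) (hD : D.Valid P G.law η T)
    (hs : ∀ k i l ω, ‖D.v k i l ω‖ = η) {S : ℕ} (hS : 1 ≤ S) (k : ℕ) (i : Fin N) :
    Integrable (fun ω => ‖deltaF Q K η S D ω k (upperRun Q K η S D ω k).x i -
      G.gradF η i (upperRun Q K η S D ω k).x‖ ^ 2) P ∧
    ∫ ω, ‖deltaF Q K η S D ω k (upperRun Q K η S D ω k).x i -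
      G.gradF η i (upperRun Q K η S D ω k).x‖ ^ 2 ∂P ≤
      2 * Q.noiseBound K / S + 2 * Q.biasBound K η (lowerIters K.δ k) := by
  have hS' : (0 : ℝ) < S := by exact_mod_cast hS
  set x : Ω → Profile G.n := fun ω => (upperRun Q K η S D ω k).x with hx
  have hmem : ∀ ω, x ω ∈ G.feasible := fun ω => A.upperRun_mem S ω k
  have hxm : Measurable x := (A.measurable_upperRun hs S k).mono (hD.sig_le _) le_rfl
  set Z : ℕ → Ω → Vec (G.n i) := fun l ω => G.noise η i (x ω) (D.v k i l ω) (D.ξ k i l ω) with hZ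
  set b : ℕ → Ω → Vec (G.n i) := fun l ω => deltaH Q K η D ω k (x ω) i l -
      G.exactEst η i (x ω i) (D.v k i l ω) (D.ξ k i l ω) with hb
  have hZd := A.noise_draw hη hD hs S k i
  have hbd := A.bias_draw hη hD hs S k i
  -- Zero-mean noise of the exact estimator plus bias of the inexact lower level. The two averages
  -- are bounded by different mechanisms, orthogonality and convexity.
  have hsplit : ∀ ω, deltaF Q K η S D ω k (x ω) i - G.gradF η i (x ω) =
      (S : ℝ)⁻¹ • ∑ l ∈ Finset.range S, Z l ω + (S : ℝ)⁻¹ • ∑ l ∈ Finset.range S, b l ω := fun ω => by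
    have h1 : G.gradF η i (x ω) = (S : ℝ)⁻¹ • ∑ _l ∈ Finset.range S, G.gradF η i (x ω) := by
      rw [Finset.sum_const, Finset.card_range, ← Nat.cast_smul_eq_nsmul ℝ, smul_smul,
        inv_mul_cancel₀ hS'.ne', one_smul]
    rw [h1]
    simp only [deltaF, ← smul_add, ← smul_sub, ← Finset.sum_add_distrib, ← Finset.sum_sub_distrib]
    congr 1
    refine Finset.sum_congr rfl fun l _ => ?_
    simp only [hZ, hb, Game.noise]
    abel
  have hpt : ∀ ω, ‖deltaF Q K η S D ω k (x ω) i - G.gradF η i (x ω)‖ ^ 2 ≤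
      2 * (((S : ℝ)⁻¹) ^ 2 * ‖∑ l ∈ Finset.range S, Z l ω‖ ^ 2) +
      2 * ((S : ℝ)⁻¹ * ∑ l ∈ Finset.range S, ‖b l ω‖ ^ 2) := fun ω => by
    rw [hsplit]
    refine (norm_add_sq_le_two _ _).trans ?_
    have h1 := norm_avg_sq_le hS fun l => b l ω
    rw [norm_smul, mul_pow, norm_inv, Real.norm_natCast]
    linarith
  have hZsum : Integrable (fun ω => ‖∑ l ∈ Finset.range S, Z l ω‖ ^ 2) P := by
    have : MemLp (fun ω => ∑ l ∈ Finset.range S, Z l ω) 2 P := memLp_finsetSum _ fun l _ => (hZd l).1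
    exact this.integrable_norm_pow (by norm_num)
  have hbsum : Integrable (fun ω => ∑ l ∈ Finset.range S, ‖b l ω‖ ^ 2) P :=
    integrable_finsetSum _ fun l _ => (hbd l).1
  have hdom : Integrable (fun ω => 2 * (((S : ℝ)⁻¹) ^ 2 * ‖∑ l ∈ Finset.range S, Z l ω‖ ^ 2) +
      2 * ((S : ℝ)⁻¹ * ∑ l ∈ Finset.range S, ‖b l ω‖ ^ 2)) P :=
    ((hZsum.const_mul _).const_mul 2).add ((hbsum.const_mul _).const_mul 2)
  have hm1 := A.measurable_deltaF hs hxm hmem (hD.ξ_meas k i) (hD.v_meas k i) (hD.ζ_meas k i) S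
  have hm2 : Measurable fun ω => G.gradF η i (x ω) := by
    have h3 : Measurable fun ω => (⟨x ω, hmem ω⟩ : G.feasible) := hxm.subtype_mk
    have h4 := (A.measurable_gradF hη i).comp h3
    exact h4
  have hi : Integrable (fun ω => ‖deltaF Q K η S D ω k (x ω) i - G.gradF η i (x ω)‖ ^ 2) P :=
    Integrable.mono' hdom ((hm1.sub hm2).norm.pow_const 2).aestronglyMeasurable
      (Eventually.of_forall fun ω => by
        rw [Real.norm_eq_abs, abs_of_nonneg (by positivity)]; exact hpt ω)
  refine ⟨hi, (integral_mono hi hdom hpt).trans ?_⟩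
  rw [integral_add ((hZsum.const_mul _).const_mul 2) ((hbsum.const_mul _).const_mul 2),
    integral_const_mul, integral_const_mul, integral_const_mul, integral_const_mul,
    integral_finsetSum _ fun l _ => (hbd l).1]
  have h1 := integral_norm_sum_sq_le (S := S) (fun l => (hZd l).1) (fun l => (hZd l).2.1)
    (fun l => (hZd l).2.2)
  have h2 : ∑ l ∈ Finset.range S, ∫ ω, ‖b l ω‖ ^ 2 ∂P ≤ S * Q.biasBound K η (lowerIters K.δ k) := by
    refine (Finset.sum_le_sum fun l _ => (hbd l).2).trans ?_
    simp
  calc _ ≤ 2 * (((S : ℝ)⁻¹) ^ 2 * (S * Q.noiseBound K)) +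
        2 * ((S : ℝ)⁻¹ * (S * Q.biasBound K η (lowerIters K.δ k))) := by gcongr
    _ = _ := by field_simp

end Assumptions


/-- Descent inequality along a segment. -/
theorem le_add_inner_add_of_gradient_lipschitz {E : Type*} [NormedAddCommGroup E]
    [InnerProductSpace ℝ E] [CompleteSpace E] {s : Set E} (hs : Convex ℝ s) {φ : E → ℝ} {g : E → E}
    {L : ℝ} (hφ : ∀ x ∈ s, HasGradientAt φ (g x) x)
    (hg : ∀ x ∈ s, ∀ y ∈ s, ‖g x - g y‖ ≤ L * ‖x - y‖) {x y : E} (hx : x ∈ s) (hy : y ∈ s) :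
    φ y ≤ φ x + ⟪g x, y - x⟫ + L / 2 * ‖y - x‖ ^ 2 := by
  set w := y - x with hw
  have hmem : ∀ t ∈ Set.Icc (0 : ℝ) 1, x + t • w ∈ s := fun t ht =>
    hs.add_smul_sub_mem hx hy ht
  -- The defect of the inequality along the segment. The Lipschitz bound on `g` makes its derivative
  -- nonpositive, and `ψ 1 ≤ ψ 0` is the claim.
  set ψ : ℝ → ℝ := fun t => φ (x + t • w) - t * ⟪g x, w⟫ - L / 2 * ‖w‖ ^ 2 * t ^ 2 with hψ
  have hd : ∀ t ∈ Set.Icc (0 : ℝ) 1,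
      HasDerivAt ψ (⟪g (x + t • w), w⟫ - ⟪g x, w⟫ - L * ‖w‖ ^ 2 * t) t := fun t ht => by
    have h1 : HasDerivAt (fun t : ℝ => x + t • w) w t := by
      simpa using ((hasDerivAt_id t).smul_const w).const_add x
    have h2 : HasDerivAt (fun t : ℝ => φ (x + t • w)) ⟪g (x + t • w), w⟫ t := by
      have := (hφ _ (hmem t ht)).hasFDerivAt.comp_hasDerivAt t h1
      simpa [Function.comp_def] using this
    have h3 := (h2.sub ((hasDerivAt_id t).mul_const ⟪g x, w⟫)).sub
      (((hasDerivAt_id t).pow 2).const_mul (L / 2 * ‖w‖ ^ 2))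
    refine (h3.congr_deriv ?_).congr_of_eventuallyEq (Eventually.of_forall fun t => ?_)
    · simp; ring
    · simp [hψ]
  have hanti : AntitoneOn ψ (Set.Icc 0 1) := by
    refine antitoneOn_of_deriv_nonpos (convex_Icc _ _)
      (fun t ht => (hd t ht).continuousAt.continuousWithinAt)
      (fun t ht => (hd t (interior_subset ht)).differentiableAt.differentiableWithinAt)
      fun t ht => ?_
    have ht' := interior_subset ht
    rw [(hd t ht').deriv]
    have h1 : ⟪g (x + t • w) - g x, w⟫ ≤ L * ‖w‖ ^ 2 * t := by
      refine (real_inner_le_norm _ _).trans ?_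
      have := hg _ (hmem t ht') _ hx
      rw [add_sub_cancel_left, norm_smul, Real.norm_of_nonneg ht'.1] at this
      nlinarith [norm_nonneg w]
    rw [inner_sub_left] at h1
    linarith
  have := hanti (Set.left_mem_Icc.2 zero_le_one) (Set.right_mem_Icc.2 zero_le_one) zero_le_one
  simp only [hψ, hw] at this
  simp at this
  linarith

/-- One projected step with an inexact gradient decreases `φ` by the squared residual, up to the
squared error. -/
theorem norm_residual_sq_le {E : Type*} [NormedAddCommGroup E] [InnerProductSpace ℝ E]
    [FiniteDimensional ℝ E] {s : Set E} (hs : IsClosed s) (hc : Convex ℝ s) {φ : E → ℝ} {L : ℝ}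
    (hL : 0 < L) {x g e : E} (hx : x ∈ s)
    (hdesc : φ (proj s (x - (1 / (2 * L)) • (g + e))) ≤ φ x +
      ⟪g, proj s (x - (1 / (2 * L)) • (g + e)) - x⟫ +
      L / 2 * ‖proj s (x - (1 / (2 * L)) • (g + e)) - x‖ ^ 2) :
    ‖(1 / (2 * L))⁻¹ • (x - proj s (x - (1 / (2 * L)) • g))‖ ^ 2 ≤
      8 * L * (φ x - φ (proj s (x - (1 / (2 * L)) • (g + e)))) + 6 * ‖e‖ ^ 2 := by
  set γ := 1 / (2 * L) with hγ
  have hγ0 : 0 < γ := by positivity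
  have hob := inner_sub_proj_le hs hc ⟨x, hx⟩ (x - γ • (g + e)) hx
  have hne := norm_proj_sub_proj_le hs hc ⟨x, hx⟩ (x - γ • (g + e)) (x - γ • g)
  set p := proj s (x - γ • (g + e))
  set q := proj s (x - γ • g)
  -- The obtuse-angle property of the projection, tested at the feasible point `x`.
  have h1 : ‖x - p‖ ^ 2 ≤ γ * ⟪g + e, x - p⟫ := by
    have : x - γ • (g + e) - p = (x - p) - γ • (g + e) := by abel
    rw [this, inner_sub_left, real_inner_self_eq_norm_sq, real_inner_smul_left] at hob
    linarith
  have h2 : 2 * L * ‖x - p‖ ^ 2 ≤ ⟪g + e, x - p⟫ := by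
    have : 2 * L * (γ * ⟪g + e, x - p⟫) = ⟪g + e, x - p⟫ := by rw [hγ]; field_simp
    rw [← this]; gcongr
  rw [inner_add_left] at h2
  have h3 : ⟪e, x - p⟫ ≤ ‖e‖ * ‖x - p‖ := real_inner_le_norm _ _
  have h4 : ⟪g, p - x⟫ = -⟪g, x - p⟫ := by rw [← inner_neg_right, neg_sub]
  rw [h4, norm_sub_rev p x] at hdesc
  have h5 : ‖x - q‖ ≤ ‖x - p‖ + γ * ‖e‖ := by
    have h6 : x - q = (x - p) + (p - q) := by abel
    have h7 : x - γ • (g + e) - (x - γ • g) = -(γ • e) := by rw [smul_add]; abel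
    rw [h7, norm_neg, norm_smul, Real.norm_of_nonneg hγ0.le] at hne
    rw [h6]
    exact (norm_add_le _ _).trans (by linarith)
  have h6 : ‖γ⁻¹ • (x - q)‖ ≤ 2 * L * ‖x - p‖ + ‖e‖ := by
    rw [norm_smul, norm_inv, Real.norm_of_nonneg hγ0.le]
    calc γ⁻¹ * ‖x - q‖ ≤ γ⁻¹ * (‖x - p‖ + γ * ‖e‖) := by gcongr
      _ = _ := by rw [hγ]; field_simp
  have h7 : ‖γ⁻¹ • (x - q)‖ ^ 2 ≤ (2 * L * ‖x - p‖ + ‖e‖) ^ 2 := by gcongr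
  -- With `a = L ‖x - p‖` and `b = ‖e‖`, the potential drop times `8 L` is at least `12 a² - 8 a b`.
  -- The remaining inequality is `8 a² - 12 a b + 5 b² = 4 (a - b)² + (2 a - b)² ≥ 0`.
  nlinarith [sq_nonneg (L * ‖x - p‖ - ‖e‖), sq_nonneg (2 * L * ‖x - p‖ - ‖e‖)]

theorem deviate_eq_add {N : ℕ} {n : Fin N → ℕ} (x : Profile n) (i : Fin N) (z : Vec (n i)) :
    deviate x i z = x + WithLp.toLp 2 (Pi.single i (z - x i)) := by
  ext j : 1
  rcases eq_or_ne j i with rfl | h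
  · simp [deviate]
  · simp [deviate, h]

theorem inner_toLp_single {N : ℕ} {n : Fin N → ℕ} (a : Profile n) (i : Fin N) (w : Vec (n i)) :
    ⟪a, (WithLp.toLp 2 (Pi.single i w) : Profile n)⟫ = ⟪a i, w⟫ := by
  rw [PiLp.inner_apply, Finset.sum_eq_single i]
  · simp
  · intro j _ h; simp [h]
  · simp

/-! ### The potential as a descent function. -/

namespace Assumptions

variable {N : ℕ} {Ξ : Type*} [MeasurableSpace Ξ] {G : Game N Ξ} {Q : Params G}
  {K : HiddenConstants} {η : ℝ} (A : Assumptions G Q K η)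
include A

theorem gradMap_apply (hη : 0 < η) {x : Profile G.n} (hx : x ∈ G.feasible) (i : Fin N) :
    G.gradMap η x i = G.gradF η i x := by
  have h1 := (A.hasGradientAt_gradH hη i (hx i)).hasFDerivAt
  have h2 := (A.unbiased i x hx).hasFDerivAt
  have h3 : HasGradientAt (fun z => G.fSmooth η i (deviate x i z)) (G.gradF η i x) (x i) := by
    rw [hasGradientAt_iff_hasFDerivAt, Game.gradF, map_add]
    refine (h1.add h2).congr_of_eventuallyEq (Eventually.of_forall fun z => ?_)
    simp [Game.fSmooth, deviate]
  exact h3.gradient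

/-- The potential identity holds only over `X`, so the partial gradients of `P_m` and `m_i` are
compared only along feasible directions. Along the segment towards `z` the smoothed terms cancel,
`P_m` and `m_i` differ by a constant, and their one-sided derivatives at `0` agree. -/
theorem inner_gradient_Pm (i : Fin N) {x : Profile G.n} (hx : x ∈ G.feasible) {z : Vec (G.n i)}
    (hz : z ∈ G.X i) :
    ⟪gradient Q.Pm x i, z - x i⟫ = ⟪∫ ξ, G.gradM i x ξ ∂G.law, z - x i⟫ := by
  set w := z - x i with hw
  have hline : HasDerivAt (fun t : ℝ => x i + t • w) w 0 := by
    simpa using ((hasDerivAt_id (0 : ℝ)).smul_const w).const_add (x i)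
  have h1 : HasDerivAt (fun t : ℝ => G.mval i (deviate x i (x i + t • w)))
      ⟪∫ ξ, G.gradM i x ξ ∂G.law, w⟫ 0 := by
    have h := A.unbiased i x hx
    rw [show x i = x i + (0 : ℝ) • w by simp] at h
    have := h.hasFDerivAt.comp_hasDerivAt (0 : ℝ) hline
    simpa [Function.comp_def] using this
  have h2 : HasDerivAt (fun t : ℝ => Q.Pm (deviate x i (x i + t • w)))
      ⟪gradient Q.Pm x i, w⟫ 0 := by
    have hl : HasDerivAt (fun t : ℝ => x + t • (WithLp.toLp 2 (Pi.single i w) : Profile G.n))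
        (WithLp.toLp 2 (Pi.single i w)) 0 := by
      simpa using ((hasDerivAt_id (0 : ℝ)).smul_const
        (WithLp.toLp 2 (Pi.single i w) : Profile G.n)).const_add x
    have h := (A.Pm_diff x hx).hasGradientAt
    have h' : HasGradientAt Q.Pm (gradient Q.Pm x)
        (x + (0 : ℝ) • (WithLp.toLp 2 (Pi.single i w) : Profile G.n)) := by simpa using h
    have := h'.hasFDerivAt.comp_hasDerivAt (0 : ℝ) hl
    rw [InnerProductSpace.toDual_apply_apply, inner_toLp_single] at this
    refine this.congr_of_eventuallyEq (Eventually.of_forall fun t => ?_)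
    simp only [Function.comp_apply, deviate_eq_add, add_sub_cancel_left]
    congr 2
    ext j : 1
    rcases eq_or_ne j i with rfl | hj
    · simp
    · simp [hj]
  have heq : ∀ t ∈ Set.Icc (0 : ℝ) 1, Q.Pm (deviate x i (x i + t • w)) =
      G.mval i (deviate x i (x i + t • w)) + (Q.Pm x - G.mval i x) := fun t ht => by
    have hm : x i + t • w ∈ G.X i := (A.X_convex i).add_smul_sub_mem (hx i) hz ht
    have := A.is_potential x hx i _ hm
    simp only [Game.potential, Game.fSmooth] at this
    have hs : ∑ j, smoothing η (G.hval j) (deviate x i (x i + t • w) j) -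
        ∑ j, smoothing η (G.hval j) (x j) =
        smoothing η (G.hval i) (deviate x i (x i + t • w) i) - smoothing η (G.hval i) (x i) := by
      rw [← Finset.sum_sub_distrib, Finset.sum_eq_single i]
      · intro j _ hj; simp [deviate, hj]
      · simp
    linarith
  have hu : UniqueDiffWithinAt ℝ (Set.Icc (0 : ℝ) 1) 0 :=
    uniqueDiffOn_Icc zero_lt_one 0 (Set.left_mem_Icc.2 zero_le_one)
  refine hu.eq_deriv _ h2.hasDerivWithinAt ?_
  exact (h1.add_const _).hasDerivWithinAt.congr heq (heq 0 (Set.left_mem_Icc.2 zero_le_one))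

theorem Lmax_pos : 0 < Q.Lmax := K.Lmin_pos.trans_le A.Lmin_le_Lmax

theorem one_le_N : (1 : ℝ) ≤ N := by exact_mod_cast A.players

theorem one_le_nMax : (1 : ℝ) ≤ G.nMax := by
  refine le_trans ?_ (G.n_le_nMax ⟨0, A.players⟩)
  exact_mod_cast A.dims _

theorem LHI_pos (hη : 0 < η) : 0 < Q.LHI K η := by
  have h1 := A.Lmax_pos
  have h2 := A.one_le_N
  have h3 := A.one_le_nMax
  have h4 := K.Lm1_nonneg
  unfold Params.LHI
  positivity

/-- Add the descent inequalities of `P_m` and of the separate smoothed terms; separability means no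
factor `√N` is lost, and `L^{HI}(η)` has that factor to spare. Agreement of gradients along feasible
directions suffices to identify the linear term with `gradMap`. -/
theorem potential_le (hη : 0 < η) {x y : Profile G.n} (hx : x ∈ G.feasible)
    (hy : y ∈ G.feasible) :
    G.potential η Q.Pm y ≤ G.potential η Q.Pm x + ⟪G.gradMap η x, y - x⟫ +
      Q.LHI K η / 2 * ‖y - x‖ ^ 2 := by
  have h1 := le_add_inner_add_of_gradient_lipschitz (convex_feasible A.X_convex)
    (fun x hx => (A.Pm_diff x hx).hasGradientAt) A.Pm_smooth hx hy
  have h2 : ∀ i, smoothing η (G.hval i) (y i) ≤ smoothing η (G.hval i) (x i) +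
      ⟪G.gradH η i (x i), y i - x i⟫ +
      Q.Lmax * Real.sqrt G.nMax / η / 2 * ‖y i - x i‖ ^ 2 := fun i =>
    le_add_inner_add_of_gradient_lipschitz (A.X_convex i)
      (fun x hx => A.hasGradientAt_gradH hη i hx) (fun a ha b hb => A.norm_gradH_sub_le hη i ha hb)
      (hx i) (hy i)
  have h3 := Finset.sum_le_sum fun i (_ : i ∈ Finset.univ) => h2 i
  rw [Finset.sum_add_distrib, Finset.sum_add_distrib, ← Finset.mul_sum] at h3
  have h4 : ∑ i, ‖y i - x i‖ ^ 2 = ‖y - x‖ ^ 2 := by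
    rw [PiLp.norm_sq_eq_of_L2]; simp
  have h5 : ⟪G.gradMap η x, y - x⟫ =
      ⟪gradient Q.Pm x, y - x⟫ + ∑ i, ⟪G.gradH η i (x i), y i - x i⟫ := by
    rw [PiLp.inner_apply, PiLp.inner_apply, ← Finset.sum_add_distrib]
    refine Finset.sum_congr rfl fun i _ => ?_
    rw [A.gradMap_apply hη hx, Game.gradF, inner_add_left, add_comm]
    congr 1
    exact (A.inner_gradient_Pm i hx (hy i)).symm
  have h6 : K.Lm1 + Q.Lmax * Real.sqrt G.nMax / η ≤ Q.LHI K η := by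
    have := A.Lmax_pos
    have h7 : 1 ≤ Real.sqrt N := by rw [Real.one_le_sqrt]; exact A.one_le_N
    have h8 : Q.Lmax * Real.sqrt G.nMax / η ≤ Q.Lmax * Real.sqrt G.nMax * Real.sqrt N / η :=
      div_le_div_of_nonneg_right (le_mul_of_one_le_right (by positivity) h7) hη.le
    unfold Params.LHI
    linarith
  rw [h4] at h3
  simp only [Game.potential]
  nlinarith [mul_le_mul_of_nonneg_right h6 (sq_nonneg ‖y - x‖)]

theorem abs_potential_sub_le (hη : 0 < η) {x y : Profile G.n} (hx : x ∈ G.feasible)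
    (hy : y ∈ G.feasible) :
    |G.potential η Q.Pm x - G.potential η Q.Pm y| ≤ (K.Lm0 + Q.Lmax * Real.sqrt N) * ‖x - y‖ := by
  have h1 := A.Pm_lip x hx y hy
  have h2 : |∑ i, (smoothing η (G.hval i) (x i) - smoothing η (G.hval i) (y i))| ≤
      Q.Lmax * (Real.sqrt N * ‖x - y‖) := by
    refine (Finset.abs_sum_le_sum_abs _ _).trans ?_
    refine (Finset.sum_le_sum fun i _ => A.abs_smoothing_sub_le hη i (hx i) (hy i)).trans ?_
    rw [← Finset.mul_sum]
    gcongr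
    · exact A.Lmax_pos.le
    · rw [← Real.sqrt_sq (norm_nonneg (x - y)), ← Real.sqrt_mul (by positivity)]
      refine Real.le_sqrt_of_sq_le ?_
      have := sq_sum_le_card_mul_sum_sq (s := (Finset.univ : Finset (Fin N)))
        (f := fun i => ‖x i - y i‖)
      rw [PiLp.norm_sq_eq_of_L2]
      simpa using this
  have h3 : G.potential η Q.Pm x - G.potential η Q.Pm y = (Q.Pm x - Q.Pm y) +
      ∑ i, (smoothing η (G.hval i) (x i) - smoothing η (G.hval i) (y i)) := by
    simp only [Game.potential, Finset.sum_sub_distrib]; ring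
  rw [h3]
  refine (abs_add_le _ _).trans ?_
  linarith

theorem norm_sub_le_DX {x y : Profile G.n} (hx : x ∈ G.feasible) (hy : y ∈ G.feasible) :
    ‖x - y‖ ≤ K.DX := by
  rw [← dist_eq_norm]
  exact (Metric.dist_le_diam_of_mem (isCompact_feasible A.X_compact).isBounded hx hy).trans A.X_diam

theorem feasible_nonempty : G.feasible.Nonempty := ⟨_, A.x0_mem⟩

theorem abs_potential_sub_le_DX (hη : 0 < η) {x y : Profile G.n} (hx : x ∈ G.feasible)
    (hy : y ∈ G.feasible) :
    |G.potential η Q.Pm x - G.potential η Q.Pm y| ≤ (K.Lm0 + Q.Lmax * Real.sqrt N) * K.DX := by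
  refine (A.abs_potential_sub_le hη hx hy).trans ?_
  have := A.Lmax_pos
  have := K.Lm0_nonneg
  gcongr
  exact A.norm_sub_le_DX hx hy

theorem potential_sub_le_gap (hη : 0 < η) {x y : Profile G.n} (hx : x ∈ G.feasible)
    (hy : y ∈ G.feasible) :
    G.potential η Q.Pm x - G.potential η Q.Pm y ≤ G.potentialGap η Q.Pm := by
  have h := fun z (hz : z ∈ G.feasible) => abs_le.1 (A.abs_potential_sub_le_DX hη hz A.x0_mem)
  have ha : BddAbove (G.potential η Q.Pm '' G.feasible) :=
    ⟨G.potential η Q.Pm Q.x0 + (K.Lm0 + Q.Lmax * Real.sqrt N) * K.DX, by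
      rintro _ ⟨z, hz, rfl⟩; linarith [(h z hz).2]⟩
  have hb : BddBelow (G.potential η Q.Pm '' G.feasible) :=
    ⟨G.potential η Q.Pm Q.x0 - (K.Lm0 + Q.Lmax * Real.sqrt N) * K.DX, by
      rintro _ ⟨z, hz, rfl⟩; linarith [(h z hz).1]⟩
  exact sub_le_sub (le_csSup ha ⟨x, hx, rfl⟩) (csInf_le hb ⟨y, hy, rfl⟩)

theorem potentialGap_le (hη : 0 < η) :
    G.potentialGap η Q.Pm ≤ (K.Lm0 + Q.Lmax * Real.sqrt N) * K.DX := by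
  have hne : (G.potential η Q.Pm '' G.feasible).Nonempty := A.feasible_nonempty.image _
  rw [Game.potentialGap, sub_le_iff_le_add]
  refine csSup_le hne ?_
  rintro _ ⟨x, hx, rfl⟩
  rw [← sub_le_iff_le_add']
  refine le_csInf hne ?_
  rintro _ ⟨y, hy, rfl⟩
  linarith [(abs_le.1 (A.abs_potential_sub_le_DX hη hx hy)).2]

theorem gap_pos : 0 < G.potentialGap η Q.Pm := K.gap_pos.trans_le A.gap_le

/-- The players' separate projections form one projection onto `X`, so the update is an inexact
projected gradient step and the one-step estimate applies for each `ω`. -/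
theorem norm_residual_upperRun_sq_le (hη : 0 < η) {Ω : Type*} (D : Draws G.n Ξ Ω) (ω : Ω)
    (S k : ℕ) :
    ‖G.residual η (Q.γ K η) (upperRun Q K η S D ω k).x‖ ^ 2 ≤
      8 * Q.LHI K η * (G.potential η Q.Pm (upperRun Q K η S D ω k).x -
        G.potential η Q.Pm (upperRun Q K η S D ω (k + 1)).x) +
      6 * ∑ i, ‖deltaF Q K η S D ω k (upperRun Q K η S D ω k).x i -
        G.gradF η i (upperRun Q K η S D ω k).x‖ ^ 2 := by
  have hmem : ∀ k, (upperRun Q K η S D ω k).x ∈ G.feasible := fun k => A.upperRun_mem S ω k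
  set x := (upperRun Q K η S D ω k).x with hx
  set e : Profile G.n := WithLp.toLp 2 (fun i => deltaF Q K η S D ω k x i - G.gradF η i x) with he
  have hstep : (upperRun Q K η S D ω (k + 1)).x =
      proj G.feasible (x - (1 / (2 * Q.LHI K η)) • (G.gradMap η x + e)) := by
    rw [proj_feasible A.X_closed A.X_convex A.X_nonempty]
    simp only [upperRun, ← hx]
    congr 1
    funext i
    congr 1
    have hg : G.gradMap η x i = G.gradF η i x := A.gradMap_apply hη (hmem k) i
    rw [PiLp.sub_apply, PiLp.smul_apply, PiLp.add_apply, hg, he]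
    simp [Params.γ]
  have hsum : ∑ i, ‖deltaF Q K η S D ω k x i - G.gradF η i x‖ ^ 2 = ‖e‖ ^ 2 := by
    rw [PiLp.norm_sq_eq_of_L2]
  rw [hsum, hstep]
  refine norm_residual_sq_le (isClosed_feasible A.X_closed) (convex_feasible A.X_convex)
    (A.LHI_pos hη) (hmem k) ?_
  rw [← hstep]
  exact A.potential_le hη (hmem k) (hmem (k + 1))

end Assumptions


/-- Expectation of a sequence at an independent index, uniform on `{1, …, T}`. -/
theorem integral_uniform_index {Ω : Type*} [MeasurableSpace Ω] {P : Measure Ω}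
    [IsProbabilityMeasure P] {R : Ω → ℕ} {T : ℕ} (hT : 1 ≤ T) (hR : Measurable R)
    (hlaw : ∀ k ∈ Finset.Icc 1 T, P (R ⁻¹' {k}) = (T : ENNReal)⁻¹) {f : ℕ → Ω → ℝ}
    (hf : ∀ k, Integrable (f k) P) (hind : ∀ k, IndepFun (f k) R P) :
    Integrable (fun ω => f (R ω) ω) P ∧
      ∫ ω, f (R ω) ω ∂P = (T : ℝ)⁻¹ * ∑ j ∈ Finset.range T, ∫ ω, f (j + 1) ω ∂P := by
  have hT0 : (T : ENNReal) ≠ 0 := by exact_mod_cast (by omega : T ≠ 0)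
  -- The law of `R` is given only on `{1, …, T}`; those masses add up to one, so no other value has
  -- positive probability.
  have hmem : ∀ᵐ ω ∂P, R ω ∈ Finset.Icc 1 T := by
    have h1 : P (R ⁻¹' (Finset.Icc 1 T : Finset ℕ)) = 1 := by
      have h2 : P (R ⁻¹' (Finset.Icc 1 T : Finset ℕ)) =
          ∑ k ∈ Finset.Icc 1 T, P (R ⁻¹' {k}) := by
        rw [sum_measure_preimage_singleton]
        exact fun k _ => hR (measurableSet_singleton k)
      rw [h2, Finset.sum_congr rfl hlaw]
      simp [ENNReal.mul_inv_cancel hT0 (ENNReal.natCast_ne_top T)]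
    exact (prob_compl_eq_zero_iff (hR (Finset.measurableSet _))).2 h1
  set g : ℕ → Ω → ℝ := fun j ω => f (j + 1) ω * ({j + 1} : Set ℕ).indicator 1 (R ω) with hg
  have hφ : ∀ j : ℕ, Measurable (({j + 1} : Set ℕ).indicator (1 : ℕ → ℝ)) :=
    fun j => measurable_from_nat
  have hint : ∀ j, Integrable (fun ω => ({j + 1} : Set ℕ).indicator (1 : ℕ → ℝ) (R ω)) P := fun j =>
    Integrable.of_bound ((hφ j).comp hR).aestronglyMeasurable 1 (Eventually.of_forall fun ω => by
      by_cases h : R ω ∈ ({j + 1} : Set ℕ) <;> simp [Set.indicator, h])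
  have hi : ∀ j, IndepFun (f (j + 1)) (fun ω => ({j + 1} : Set ℕ).indicator (1 : ℕ → ℝ) (R ω)) P :=
    fun j => (hind (j + 1)).comp measurable_id (hφ j)
  have hgi : ∀ j, Integrable (g j) P := fun j => (hi j).integrable_mul (hf _) (hint j)
  have hgv : ∀ j ∈ Finset.range T, ∫ ω, g j ω ∂P = (T : ℝ)⁻¹ * ∫ ω, f (j + 1) ω ∂P := fun j hj => by
    have h1 : ∫ ω, g j ω ∂P = (∫ ω, f (j + 1) ω ∂P) *
        ∫ ω, ({j + 1} : Set ℕ).indicator (1 : ℕ → ℝ) (R ω) ∂P :=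
      (hi j).integral_mul_eq_mul_integral (hf _).1 (hint j).1
    have h2 : ∫ ω, ({j + 1} : Set ℕ).indicator (1 : ℕ → ℝ) (R ω) ∂P = (T : ℝ)⁻¹ := by
      have h3 : (fun ω => ({j + 1} : Set ℕ).indicator (1 : ℕ → ℝ) (R ω)) =
          (R ⁻¹' {j + 1}).indicator 1 := rfl
      rw [h3, integral_indicator_one (hR (measurableSet_singleton _)), measureReal_def,
        hlaw _ (Finset.mem_Icc.2 ⟨by omega, Finset.mem_range.1 hj⟩)]
      simp
    rw [h1, h2, mul_comm]
  -- Almost surely exactly one indicator is active, namely that of `j + 1 = R`.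
  have heq : (fun ω => f (R ω) ω) =ᵐ[P] fun ω => ∑ j ∈ Finset.range T, g j ω := by
    filter_upwards [hmem] with ω hω
    rw [Finset.mem_Icc] at hω
    rw [Finset.sum_eq_single_of_mem (R ω - 1) (Finset.mem_range.2 (by omega))]
    · have : R ω - 1 + 1 = R ω := by omega
      simp [hg, this]
    · intro j _ hj
      have : R ω ≠ j + 1 := by omega
      simp [hg, this]
  refine ⟨(integrable_finsetSum _ fun j _ => hgi j).congr heq.symm, ?_⟩
  rw [integral_congr_ae heq, integral_finsetSum _ fun j _ => hgi j, Finset.sum_congr rfl hgv,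
    Finset.mul_sum]

/-- `∑_k (k+1)^{-(1+δ)}`. -/
noncomputable def HiddenConstants.zeta (K : HiddenConstants) : ℝ :=
  ∑' k : ℕ, 1 / |(k : ℝ) + 1| ^ (1 + K.δ)

theorem HiddenConstants.summable_zeta (K : HiddenConstants) :
    Summable fun k : ℕ => 1 / |(k : ℝ) + 1| ^ (1 + K.δ) :=
  (Real.summable_one_div_nat_add_rpow 1 _).2 (by linarith [K.δ_pos])

theorem HiddenConstants.zeta_pos (K : HiddenConstants) : 0 < K.zeta :=
  K.summable_zeta.tsum_pos (fun k => by positivity) 0 (by simp)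

/-- The growth of `t_k` makes the biases summable, so their total is bounded independently of `T`.
Iterates `1, …, T` are the ones that count, hence the shift in the index. -/
theorem sum_biasBound_le {N : ℕ} {Ξ : Type*} [MeasurableSpace Ξ] {G : Game N Ξ} (Q : Params G)
    (K : HiddenConstants) {η : ℝ} (hη : 0 < η) (T : ℕ) :
    ∑ j ∈ Finset.range T, Q.biasBound K η (lowerIters K.δ (j + 1)) ≤
      32 * (G.nMax : ℝ) ^ 2 * Q.LyMax ^ 2 * K.cmax / η ^ 2 * K.zeta := by
  have hc := K.cmax_pos
  have hΓ := K.Γ_pos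
  set c : ℝ := 32 * (G.nMax : ℝ) ^ 2 * Q.LyMax ^ 2 * K.cmax / η ^ 2 with hcdef
  have hc0 : 0 ≤ c := by positivity
  have h1 : ∀ j : ℕ, Q.biasBound K η (lowerIters K.δ (j + 1)) ≤
      c * (1 / |((j + 1 : ℕ) : ℝ) + 1| ^ (1 + K.δ)) := fun j => by
    have h2 : |((j + 1 : ℕ) : ℝ) + 1| ^ (1 + K.δ) ≤ lowerIters K.δ (j + 1) + K.Γ := by
      rw [abs_of_pos (by positivity)]
      exact (Nat.le_ceil _).trans (by unfold lowerIters; linarith)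
    have h3 : (0 : ℝ) < |((j + 1 : ℕ) : ℝ) + 1| ^ (1 + K.δ) := by positivity
    calc Q.biasBound K η (lowerIters K.δ (j + 1)) = c * (1 / (lowerIters K.δ (j + 1) + K.Γ)) := by
          rw [hcdef, Params.biasBound]; field_simp
      _ ≤ _ := by gcongr
  refine (Finset.sum_le_sum fun j _ => h1 j).trans ?_
  rw [← Finset.mul_sum]
  gcongr
  have h4 : ∑ j ∈ Finset.range (T + 1), 1 / |(j : ℝ) + 1| ^ (1 + K.δ) ≤ K.zeta :=
    K.summable_zeta.sum_le_tsum _ fun _ _ => by positivity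
  rw [Finset.sum_range_succ'] at h4
  have h5 : (0 : ℝ) ≤ 1 / |((0 : ℕ) : ℝ) + 1| ^ (1 + K.δ) := by positivity
  linarith

/-- Bound on the accumulated mean-square error of the gradient estimates. -/
noncomputable def Params.totalError {N : ℕ} {Ξ : Type*} [MeasurableSpace Ξ] {G : Game N Ξ}
    (Q : Params G) (K : HiddenConstants) (η : ℝ) (S T : ℕ) : ℝ :=
  N * (T * (2 * Q.noiseBound K / S) +
    2 * (32 * (G.nMax : ℝ) ^ 2 * Q.LyMax ^ 2 * K.cmax / η ^ 2 * K.zeta))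

/-- A run depends on the directions only through their values. -/
theorem upperRun_congr {N : ℕ} {Ξ Ω : Type*} [MeasurableSpace Ξ] {G : Game N Ξ} {Q : Params G}
    {K : HiddenConstants} {η : ℝ} {S : ℕ} {D : Draws G.n Ξ Ω} {ω : Ω}
    (h : ∀ k i l, (D.fix η).v k i l ω = D.v k i l ω) (k : ℕ) :
    (upperRun Q K η S (D.fix η) ω k).x = (upperRun Q K η S D ω k).x := by
  induction k with
  | zero => rfl
  | succ k ih =>
    simp only [upperRun]
    rw [ih]
    congr 1
    funext i
    congr 3
    simp only [deltaF, deltaH, zoValue, lowerCall, evalPoint, h]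
    rfl

/-! ### Convergence of the randomly indexed output. -/

namespace Assumptions

variable {N : ℕ} {Ξ : Type*} [MeasurableSpace Ξ] {G : Game N Ξ} {Q : Params G}
  {K : HiddenConstants} {η : ℝ} (A : Assumptions G Q K η)
include A

theorem measurable_residual (hη : 0 < η) (γ : ℝ) :
    Measurable fun x : G.feasible => ‖G.residual η γ x‖ := by
  have h1 : Measurable fun x : G.feasible => G.gradMap η x := by
    have : (fun x : G.feasible => G.gradMap η x) =
        fun x : G.feasible => (WithLp.toLp 2 (fun i => G.gradF η i x) : Profile G.n) := by
      funext x
      ext i : 1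
      exact A.gradMap_apply hη x.2 i
    rw [this]
    exact (PiLp.continuous_toLp 2 _).measurable.comp
      (measurable_pi_lambda _ fun i => A.measurable_gradF hη i)
  have h2 : Measurable fun x : G.feasible => (x : Profile G.n) := measurable_subtype_coe
  have h3 := (continuous_proj (isClosed_feasible A.X_closed) (convex_feasible A.X_convex)
    A.feasible_nonempty).measurable.comp (h2.sub (h1.const_smul γ))
  exact ((h2.sub h3).const_smul γ⁻¹).norm

variable {Ω : Type*} [mΩ : MeasurableSpace Ω] {P : Measure Ω} [IsProbabilityMeasure P]
  {D : Draws G.n Ξ Ω} {T : ℕ}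

/-- Sum the one-step estimate over the iterates `1, …, T`, take expectations, and recognize the
average as the expectation at the independent uniform index. Jensen's inequality passes from the
second moment to the squared mean. -/
theorem residual_output_of_norm_eq (hη : 0 < η) (hD : D.Valid P G.law η T)
    (hs : ∀ k i l ω, ‖D.v k i l ω‖ = η) {S : ℕ} (hS : 1 ≤ S) (hT : 1 ≤ T) :
    Integrable (fun ω => ‖G.residual η (Q.γ K η) (output Q K η S D ω).x‖) P ∧
    (∫ ω, ‖G.residual η (Q.γ K η) (output Q K η S D ω).x‖ ∂P) ^ 2 ≤
      (T : ℝ)⁻¹ * (8 * Q.LHI K η * G.potentialGap η Q.Pm + 6 * Q.totalError K η S T) := by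
  have hmem : ∀ k ω, (upperRun Q K η S D ω k).x ∈ G.feasible := fun k ω => A.upperRun_mem S ω k
  set X : ℕ → Ω → G.feasible := fun k ω => ⟨(upperRun Q K η S D ω k).x, hmem k ω⟩ with hX
  have hXs : ∀ k, Measurable[D.sig (DrawName.past k)] (X k) := fun k =>
    (A.measurable_upperRun (D := D) hs S k).subtype_mk
  have hres := A.measurable_residual hη (Q.γ K η)
  set r : ℕ → Ω → ℝ := fun k ω => ‖G.residual η (Q.γ K η) (upperRun Q K η S D ω k).x‖ with hr
  have hrs : ∀ k, Measurable[D.sig (DrawName.past k)] (r k) := fun k => by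
    have h4 := hres.comp (hXs k)
    exact h4
  have hrm : ∀ k, Measurable (r k) := fun k => (hrs k).mono (hD.sig_le _) le_rfl
  have hind : ∀ k, IndepFun (r k) D.R P := fun k =>
    indepFun_of_indep (hD.indep_sig (S := DrawName.past k) (S' := {.index}) (by
      rw [Set.disjoint_singleton_right]
      rintro ⟨j, -, hj⟩
      simp [DrawName.stage] at hj)) (hrs k) (Draws.measurable_R (by simp))
  set e : ℕ → Ω → ℝ := fun k ω => ∑ i, ‖deltaF Q K η S D ω k (upperRun Q K η S D ω k).x i -
        G.gradF η i (upperRun Q K η S D ω k).x‖ ^ 2 with he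
  have hei : ∀ k, Integrable (e k) P := fun k =>
    integrable_finsetSum _ fun i _ => (A.integral_norm_deltaF_sub_sq_le hη hD hs hS k i).1
  have heb : ∀ k, ∫ ω, e k ω ∂P ≤
      N * (2 * Q.noiseBound K / S + 2 * Q.biasBound K η (lowerIters K.δ k)) := fun k => by
    rw [integral_finsetSum _ fun i _ => (A.integral_norm_deltaF_sub_sq_le hη hD hs hS k i).1]
    refine (Finset.sum_le_sum fun i _ =>
      (A.integral_norm_deltaF_sub_sq_le hη hD hs hS k i).2).trans ?_
    simp [mul_add]
  have hL := A.LHI_pos hη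
  have hpt : ∀ k ω, r k ω ^ 2 ≤ 8 * Q.LHI K η *
      (G.potential η Q.Pm (upperRun Q K η S D ω k).x -
        G.potential η Q.Pm (upperRun Q K η S D ω (k + 1)).x) + 6 * e k ω := fun k ω =>
    A.norm_residual_upperRun_sq_le hη D ω S k
  have hr2 : ∀ k, Integrable (fun ω => r k ω ^ 2) P := fun k => by
    have hdom : Integrable (fun ω => 8 * Q.LHI K η * G.potentialGap η Q.Pm + 6 * e k ω) P :=
      (integrable_const _).add ((hei k).const_mul 6)
    refine Integrable.mono' hdom ((hrm k).pow_const 2).aestronglyMeasurable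
      (Eventually.of_forall fun ω => ?_)
    rw [Real.norm_of_nonneg (by positivity)]
    refine (hpt k ω).trans ?_
    gcongr
    exact A.potential_sub_le_gap hη (hmem k ω) (hmem (k + 1) ω)
  have hrL : ∀ k, MemLp (r k) 2 P := fun k =>
    (memLp_two_iff_integrable_sq (hrm k).aestronglyMeasurable).2 (hr2 k)
  obtain ⟨o1, -⟩ := integral_uniform_index hT hD.R_meas hD.R_law
    (fun k => (hrL k).integrable (by norm_num)) hind
  obtain ⟨o2, o3⟩ := integral_uniform_index (f := fun k ω => r k ω ^ 2) hT hD.R_meas hD.R_law hr2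
    (fun k => (hind k).comp (measurable_id.pow_const 2) measurable_id)
  have hoL : MemLp (fun ω => r (D.R ω) ω) 2 P := (memLp_two_iff_integrable_sq o1.1).2 o2
  refine ⟨o1, (sq_integral_le_integral_sq hoL).trans ?_⟩
  rw [o3]
  gcongr
  rw [← integral_finsetSum _ fun j _ => hr2 (j + 1)]
  have hdom : Integrable (fun ω => 8 * Q.LHI K η * G.potentialGap η Q.Pm +
      6 * ∑ j ∈ Finset.range T, e (j + 1) ω) P :=
    (integrable_const _).add ((integrable_finsetSum _ fun j _ => hei (j + 1)).const_mul 6)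
  refine (integral_mono (integrable_finsetSum _ fun j _ => hr2 (j + 1)) hdom fun ω => ?_).trans ?_
  · refine (Finset.sum_le_sum fun j _ => hpt (j + 1) ω).trans ?_
    -- The potential telescopes from `x^1` to `x^{T+1}`; both are feasible, so the gap bounds the
    -- total drop.
    rw [Finset.sum_add_distrib, ← Finset.mul_sum, ← Finset.mul_sum,
      Finset.sum_range_sub' (fun j => G.potential η Q.Pm (upperRun Q K η S D ω (j + 1)).x)]
    gcongr
    exact A.potential_sub_le_gap hη (hmem _ ω) (hmem _ ω)
  · have h0 : ∫ ω, 6 * ∑ j ∈ Finset.range T, e (j + 1) ω ∂P =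
        6 * ∑ j ∈ Finset.range T, ∫ ω, e (j + 1) ω ∂P := by
      rw [integral_const_mul, integral_finsetSum _ fun j _ => hei (j + 1)]
    rw [integral_add (integrable_const _)
      ((integrable_finsetSum _ fun j _ => hei (j + 1)).const_mul 6), h0]
    have h1 := Finset.sum_le_sum fun j (_ : j ∈ Finset.range T) => heb (j + 1)
    rw [← Finset.mul_sum, Finset.sum_add_distrib, ← Finset.mul_sum] at h1
    have h2 := sum_biasBound_le Q K hη T
    simp only [Finset.sum_const, Finset.card_range, nsmul_eq_mul] at h1
    have h3 : ∑ j ∈ Finset.range T, ∫ ω, e (j + 1) ω ∂P ≤ Q.totalError K η S T :=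
      h1.trans (by unfold Params.totalError; gcongr)
    simp only [integral_const, probReal_univ, smul_eq_mul, one_mul]
    linarith

/-- The corrected and the original draws give the same run almost surely. -/
theorem residual_output (hη : 0 < η) (hD : D.Valid P G.law η T) {S : ℕ} (hS : 1 ≤ S)
    (hT : 1 ≤ T) :
    Integrable (fun ω => ‖G.residual η (Q.γ K η) (output Q K η S D ω).x‖) P ∧
    (∫ ω, ‖G.residual η (Q.γ K η) (output Q K η S D ω).x‖ ∂P) ^ 2 ≤
      (T : ℝ)⁻¹ * (8 * Q.LHI K η * G.potentialGap η Q.Pm + 6 * Q.totalError K η S T) := by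
  have h := A.residual_output_of_norm_eq hη (hD.fix hη)
    (fun k i l ω => norm_sphereFix (A.dims i) hη.le _) hS hT
  have heq : (fun ω => ‖G.residual η (Q.γ K η) (output Q K η S (D.fix η) ω).x‖) =ᵐ[P]
      fun ω => ‖G.residual η (Q.γ K η) (output Q K η S D ω).x‖ := by
    filter_upwards [hD.ae_fix_eq hη] with ω hω
    have : (output Q K η S (D.fix η) ω).x = (output Q K η S D ω).x := upperRun_congr hω _
    rw [this]
  exact ⟨h.1.congr heq, (integral_congr_ae heq) ▸ h.2⟩

end Assumptions


/-! ### Oracle calls -/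

theorem lowerRun_samples {d : ℕ} {Ξ : Type*} (Y : Set (Vec d)) (F : Vec d → Ξ → Vec d) (α0 Γ : ℝ)
    (y0 : Vec d) (ζ : ℕ → Ξ) (t : ℕ) : (lowerRun Y F α0 Γ y0 ζ t).samples = t := by
  induction t with
  | zero => rfl
  | succ t ih => simp [lowerRun, ih]

theorem lowerRun_iters {d : ℕ} {Ξ : Type*} (Y : Set (Vec d)) (F : Vec d → Ξ → Vec d) (α0 Γ : ℝ)
    (y0 : Vec d) (ζ : ℕ → Ξ) (t : ℕ) : (lowerRun Y F α0 Γ y0 ζ t).iters = t := by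
  induction t with
  | zero => rfl
  | succ t ih => simp [lowerRun, ih]

section Counters

variable {N : ℕ} {Ξ Ω : Type*} [MeasurableSpace Ξ] {G : Game N Ξ} (Q : Params G)
  (K : HiddenConstants) (η : ℝ) (S : ℕ) (D : Draws G.n Ξ Ω) (ω : Ω)

theorem upperRun_iters (k : ℕ) : (upperRun Q K η S D ω k).iters = k := by
  induction k with
  | zero => rfl
  | succ k ih => simp [upperRun, ih]

theorem upperRun_zo (k : ℕ) : (upperRun Q K η S D ω k).zo = k * (N * (S * 2)) := by
  induction k with
  | zero => simp [upperRun]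
  | succ k ih => simp [upperRun, ih]; ring

theorem upperRun_fo (k : ℕ) : (upperRun Q K η S D ω k).fo = k * (N * S) := by
  induction k with
  | zero => simp [upperRun]
  | succ k ih => simp [upperRun, ih]; ring

theorem upperRun_lowerSamples (k : ℕ) : (upperRun Q K η S D ω k).lowerSamples =
    N * (S * 2) * ∑ j ∈ Finset.range k, lowerIters K.δ j := by
  induction k with
  | zero => simp [upperRun]
  | succ k ih =>
    simp [upperRun, ih, lowerCall, lowerRun_samples, Finset.sum_range_succ]
    ring

theorem upperRun_lowerIters (k : ℕ) : (upperRun Q K η S D ω k).lowerIters =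
    N * (S * 2) * ∑ j ∈ Finset.range k, lowerIters K.δ j := by
  induction k with
  | zero => simp [upperRun]
  | succ k ih =>
    simp [upperRun, ih, lowerCall, lowerRun_iters, Finset.sum_range_succ]
    ring

end Counters

/-- Every term is at most `T^{1+δ} + 1 ≤ 2 T^{1+δ}`. Bounding each term by this maximum already
gives the order `T^{2+δ}`. -/
theorem sum_lowerIters_le {δ : ℝ} (hδ : 0 < δ) {k T : ℕ} (hk : k ≤ T) :
    ((∑ j ∈ Finset.range k, lowerIters δ j : ℕ) : ℝ) ≤ T * (2 * (T : ℝ) ^ (1 + δ)) := by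
  push_cast
  have h : ∀ j ∈ Finset.range k, (lowerIters δ j : ℝ) ≤ 2 * (T : ℝ) ^ (1 + δ) := fun j hj => by
    have hj' : j + 1 ≤ T := (Finset.mem_range.1 hj).trans_le hk
    have h1 : ((j : ℝ) + 1) ^ (1 + δ) ≤ (T : ℝ) ^ (1 + δ) := by
      apply Real.rpow_le_rpow (by positivity) (by exact_mod_cast hj') (by linarith)
    have h2 : (1 : ℝ) ≤ (T : ℝ) ^ (1 + δ) :=
      Real.one_le_rpow (by exact_mod_cast (by omega : 1 ≤ T)) (by linarith)
    have h3 : (lowerIters δ j : ℝ) < ((j : ℝ) + 1) ^ (1 + δ) + 1 :=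
      Nat.ceil_lt_add_one (by positivity)
    linarith
  refine (Finset.sum_le_card_nsmul _ _ _ h).trans ?_
  rw [Finset.card_range, nsmul_eq_mul]
  gcongr


/-! ### Choice of the budget -/

/-- With batch size `S` and horizon `T` as in the scheme, a large enough budget `B` makes the
residual bound at most `ε²`. -/
theorem residual_bound_le {N gL σ2 V β ε B : ℝ} {S T : ℕ} (hN : 1 ≤ N) (hgL : 0 < gL)
    (hσ : 0 < σ2) (hV : 0 ≤ V) (hβ : 0 ≤ β) (hε : 0 < ε)
    (hS : S = ⌈Real.sqrt σ2 * Real.sqrt (6 * B) / (4 * Real.sqrt gL)⌉₊)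
    (hT : T = ⌊B / (S * N)⌋₊)
    (h1 : 27 / 2 * (N ^ 2 * (8 * gL + 6 * N * β) ^ 2 * σ2) ≤ B * ε ^ 4 * gL)
    (h2 : 6 * N * (8 * gL + 6 * N * β) ≤ B * ε ^ 2)
    (h3 : 3456 * (N ^ 2 * V ^ 2 * gL) ≤ B * ε ^ 4 * σ2)
    (h4 : 4 * N ≤ B) (h5 : 6 * N ^ 2 * σ2 ≤ B * gL) :
    1 ≤ S ∧ 1 ≤ T ∧
      (T : ℝ)⁻¹ * (8 * gL + 6 * (N * (T * (2 * V / S) + β))) ≤ ε ^ 2 := by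
  have hN0 : 0 < N := by linarith
  have hB : 0 < B := by linarith
  set H := 8 * gL + 6 * N * β with hH
  have hH0 : 0 < H := by positivity
  set s := Real.sqrt σ2 * Real.sqrt (6 * B) / (4 * Real.sqrt gL) with hs
  have hs0 : 0 < s := by positivity
  -- Here `s` is the batch size before rounding. The square roots are eliminated by squaring and
  -- using this identity.
  have hs2 : s ^ 2 * (16 * gL) = 6 * σ2 * B := by
    rw [hs, div_pow, mul_pow, mul_pow, Real.sq_sqrt hσ.le, Real.sq_sqrt (by positivity),
      Real.sq_sqrt hgL.le]
    field_simp
    norm_num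
  have hsS : s ≤ S := by rw [hS]; exact Nat.le_ceil _
  have hSs : (S : ℝ) ≤ s + 1 := by rw [hS]; exact (Nat.ceil_lt_add_one hs0.le).le
  have hS0 : (0 : ℝ) < S := hs0.trans_le hsS
  have e1 : 6 * N * H * s ≤ B * ε ^ 2 := by
    rw [← pow_le_pow_iff_left₀ (by positivity) (by positivity) two_ne_zero]
    refine le_of_mul_le_mul_right ?_ (by positivity : 0 < 16 * gL)
    calc (6 * N * H * s) ^ 2 * (16 * gL) = 36 * N ^ 2 * H ^ 2 * (s ^ 2 * (16 * gL)) := by ring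
      _ = 16 * B * (27 / 2 * (N ^ 2 * H ^ 2 * σ2)) := by rw [hs2]; ring
      _ ≤ 16 * B * (B * ε ^ 4 * gL) := by gcongr
      _ = _ := by ring
  have e3 : 36 * N * V ≤ s * ε ^ 2 := by
    rw [← pow_le_pow_iff_left₀ (by positivity) (by positivity) two_ne_zero]
    refine le_of_mul_le_mul_right ?_ (by positivity : 0 < 16 * gL)
    calc (36 * N * V) ^ 2 * (16 * gL) = 6 * (3456 * (N ^ 2 * V ^ 2 * gL)) := by ring
      _ ≤ 6 * (B * ε ^ 4 * σ2) := by gcongr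
      _ = (s ^ 2 * (16 * gL)) * ε ^ 4 := by rw [hs2]; ring
      _ = _ := by ring
  have e4 : 4 * N * s ≤ B := by
    rw [← pow_le_pow_iff_left₀ (by positivity) (by positivity) two_ne_zero]
    refine le_of_mul_le_mul_right ?_ (by positivity : 0 < 16 * gL)
    calc (4 * N * s) ^ 2 * (16 * gL) = 16 * N ^ 2 * (s ^ 2 * (16 * gL)) := by ring
      _ = 16 * B * (6 * N ^ 2 * σ2) := by rw [hs2]; ring
      _ ≤ 16 * B * (B * gL) := by gcongr
      _ = _ := by ring
  -- Leaves room for at least two iterations, so rounding down costs `T` at most a factor `2`.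
  have e5 : 2 * (S * N) ≤ B := by nlinarith
  have hq : 2 ≤ B / (S * N) := by rw [le_div_iff₀ (by positivity)]; exact e5
  have hT1 : 1 ≤ T := by
    rw [hT, Nat.one_le_floor_iff]; linarith
  have hT0 : (0 : ℝ) < T := by exact_mod_cast hT1
  have hTge : B / (S * N) / 2 ≤ T := by
    have := Nat.lt_floor_add_one (B / (S * N))
    rw [← hT] at this
    linarith
  have hTB : B ≤ 2 * N * (s + 1) * T := by
    rw [div_div, div_le_iff₀ (by positivity)] at hTge
    calc B ≤ T * (S * N * 2) := hTge
      _ ≤ T * ((s + 1) * N * 2) := by gcongr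
      _ = _ := by ring
  refine ⟨by exact_mod_cast hS0, hT1, ?_⟩
  -- The share `2/3` of `ε²` goes to the optimization and bias terms, split between the two parts of
  -- `S ≤ s + 1`; the share `1/3` goes to the noise term `12 N V / S`.
  have f1 : (T : ℝ)⁻¹ * H ≤ 2 / 3 * ε ^ 2 := by
    rw [inv_mul_le_iff₀ hT0]
    refine le_of_mul_le_mul_left ?_ hB
    calc B * H ≤ (2 * N * (s + 1) * T) * H := by gcongr
      _ = T / 3 * (6 * N * H * s + 6 * N * H) := by ring
      _ ≤ T / 3 * (B * ε ^ 2 + B * ε ^ 2) := by gcongr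
      _ = _ := by ring
  have f2 : 12 * N * V / S ≤ 1 / 3 * ε ^ 2 := by
    rw [div_le_iff₀ hS0]
    nlinarith [mul_le_mul_of_nonneg_right hsS (sq_nonneg ε)]
  calc (T : ℝ)⁻¹ * (8 * gL + 6 * (N * (T * (2 * V / S) + β))) = (T : ℝ)⁻¹ * H + 12 * N * V / S := by
        rw [hH]; field_simp; ring
    _ ≤ _ := by linarith

/-- With every normalized parameter at least `1`, raising exponents only increases a monomial. -/
theorem monomial_le {A B X u v z w : ℝ} (hA : 1 ≤ A) (hB : 1 ≤ B) (hX : 1 ≤ X) (hu : 1 ≤ u)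
    (hv : 1 ≤ v) (hz : 1 ≤ z) (hw : 1 ≤ w) {i j k l m q r i' j' k' l' m' q' r' : ℕ} (h1 : i ≤ i')
    (h2 : j ≤ j') (h3 : k ≤ k') (h4 : l ≤ l') (h5 : m ≤ m') (h6 : q ≤ q') (h7 : r ≤ r') :
    A ^ i * B ^ j * X ^ k * u ^ l * v ^ m * z ^ q * w ^ r ≤
      A ^ i' * B ^ j' * X ^ k' * u ^ l' * v ^ m' * z ^ q' * w ^ r' := by
  gcongr

set_option maxHeartbeats 1000000 in
/-- The budget `C₀ A² B⁴ X² u¹³ v¹⁰ z⁷ w⁴` meets the requirements of `residual_bound_le`. -/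
theorem budget_requirements {A B X u v z w gL σ2 V β c1 cσ cβ p M : ℝ} (hA : 1 ≤ A) (hB : 1 ≤ B)
    (hX : 1 ≤ X) (hu : 1 ≤ u) (hv : 1 ≤ v) (hz : 1 ≤ z) (hw : 1 ≤ w) (hp : 0 < p) (hc1 : 0 ≤ c1)
    (hcσ : 0 ≤ cσ) (hcβ : 0 ≤ cβ) (hV0 : 0 ≤ V) (hβ0 : 0 ≤ β) (hσ0 : 0 < σ2)
    (hgL : gL ≤ c1 * (A ^ 2 * u * v ^ 2 * z)) (hgL' : p * (A * u * v * z) ≤ gL)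
    (hσ : σ2 ≤ cσ * (X ^ 2 * u ^ 4 * z ^ 2)) (hV : V ≤ u ^ 2 * σ2)
    (hβ : β ≤ cβ * (u ^ 4 * B ^ 2 * z ^ 2))
    (hM : (1728 * c1 * cσ + 972 * cβ ^ 2 * cσ / p + 48 * c1 + 36 * cβ + 3456 * c1 * cσ + 4 +
      6 * cσ / p) * (A ^ 2 * B ^ 4 * X ^ 2 * u ^ 13 * v ^ 10 * z ^ 7 * w ^ 4) ≤ M) :
    27 / 2 * ((v ^ 2) ^ 2 * (8 * gL + 6 * v ^ 2 * β) ^ 2 * σ2) ≤ M * (w⁻¹) ^ 4 * gL ∧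
    6 * v ^ 2 * (8 * gL + 6 * v ^ 2 * β) ≤ M * (w⁻¹) ^ 2 ∧
    3456 * ((v ^ 2) ^ 2 * V ^ 2 * gL) ≤ M * (w⁻¹) ^ 4 * σ2 ∧
    4 * v ^ 2 ≤ M ∧ 6 * (v ^ 2) ^ 2 * σ2 ≤ M * gL := by
  set W := A ^ 2 * B ^ 4 * X ^ 2 * u ^ 13 * v ^ 10 * z ^ 7 * w ^ 4 with hW
  have hA0 : 0 < A := by linarith
  have hB0 : 0 < B := by linarith
  have hX0 : 0 < X := by linarith
  have hu0 : 0 < u := by linarith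
  have hv0 : 0 < v := by linarith
  have hz0 : 0 < z := by linarith
  have hw0 : 0 < w := by linarith
  have hW0 : 0 < W := by positivity
  have hg0 : 0 < gL := lt_of_lt_of_le (by positivity) hgL'
  have mono : ∀ {i j k l m q r : ℕ}, i ≤ 2 → j ≤ 4 → k ≤ 2 → l ≤ 13 → m ≤ 10 → q ≤ 7 → r ≤ 4 →
      A ^ i * B ^ j * X ^ k * u ^ l * v ^ m * z ^ q * w ^ r ≤ W :=
    fun h1 h2 h3 h4 h5 h6 h7 => monomial_le hA hB hX hu hv hz hw h1 h2 h3 h4 h5 h6 h7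
  have a1 : v ^ 4 * (gL * σ2) * w ^ 4 ≤ c1 * cσ * W := by
    calc v ^ 4 * (gL * σ2) * w ^ 4 ≤ v ^ 4 * ((c1 * (A ^ 2 * u * v ^ 2 * z)) *
          (cσ * (X ^ 2 * u ^ 4 * z ^ 2))) * w ^ 4 := by gcongr
      _ = c1 * cσ * (A ^ 2 * B ^ 0 * X ^ 2 * u ^ 5 * v ^ 6 * z ^ 3 * w ^ 4) := by ring
      _ ≤ c1 * cσ * W := by
        gcongr; exact mono (by norm_num) (by norm_num) (by norm_num) (by norm_num) (by norm_num)
          (by norm_num) (by norm_num)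
  have hge : p ≤ gL := by
    refine le_trans ?_ hgL'
    refine le_mul_of_one_le_right hp.le ?_
    have : (1 : ℝ) = 1 * 1 * 1 * 1 := by norm_num
    rw [this]; gcongr
  have a2 : v ^ 8 * (β ^ 2 * σ2) * w ^ 4 ≤ cβ ^ 2 * cσ / p * W * gL := by
    calc v ^ 8 * (β ^ 2 * σ2) * w ^ 4 ≤ v ^ 8 * ((cβ * (u ^ 4 * B ^ 2 * z ^ 2)) ^ 2 *
          (cσ * (X ^ 2 * u ^ 4 * z ^ 2))) * w ^ 4 := by gcongr
      _ = cβ ^ 2 * cσ * (A ^ 0 * B ^ 4 * X ^ 2 * u ^ 12 * v ^ 8 * z ^ 6 * w ^ 4) := by ring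
      _ ≤ cβ ^ 2 * cσ * W := by
        gcongr; exact mono (by norm_num) (by norm_num) (by norm_num) (by norm_num) (by norm_num)
          (by norm_num) (by norm_num)
      _ = cβ ^ 2 * cσ / p * W * p := by field_simp
      _ ≤ _ := by gcongr
  have a3 : v ^ 2 * gL * w ^ 2 ≤ c1 * W := by
    calc v ^ 2 * gL * w ^ 2 ≤ v ^ 2 * (c1 * (A ^ 2 * u * v ^ 2 * z)) * w ^ 2 := by gcongr
      _ = c1 * (A ^ 2 * B ^ 0 * X ^ 0 * u ^ 1 * v ^ 4 * z ^ 1 * w ^ 2) := by ring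
      _ ≤ c1 * W := by
        gcongr; exact mono (by norm_num) (by norm_num) (by norm_num) (by norm_num) (by norm_num)
          (by norm_num) (by norm_num)
  have a4 : v ^ 4 * β * w ^ 2 ≤ cβ * W := by
    calc v ^ 4 * β * w ^ 2 ≤ v ^ 4 * (cβ * (u ^ 4 * B ^ 2 * z ^ 2)) * w ^ 2 := by gcongr
      _ = cβ * (A ^ 0 * B ^ 2 * X ^ 0 * u ^ 4 * v ^ 4 * z ^ 2 * w ^ 2) := by ring
      _ ≤ cβ * W := by
        gcongr; exact mono (by norm_num) (by norm_num) (by norm_num) (by norm_num) (by norm_num)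
          (by norm_num) (by norm_num)
  have a5 : v ^ 4 * u ^ 4 * (gL * σ2) * w ^ 4 ≤ c1 * cσ * W := by
    calc v ^ 4 * u ^ 4 * (gL * σ2) * w ^ 4 ≤ v ^ 4 * u ^ 4 * ((c1 * (A ^ 2 * u * v ^ 2 * z)) *
          (cσ * (X ^ 2 * u ^ 4 * z ^ 2))) * w ^ 4 := by gcongr
      _ = c1 * cσ * (A ^ 2 * B ^ 0 * X ^ 2 * u ^ 9 * v ^ 6 * z ^ 3 * w ^ 4) := by ring
      _ ≤ c1 * cσ * W := by
        gcongr; exact mono (by norm_num) (by norm_num) (by norm_num) (by norm_num) (by norm_num)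
          (by norm_num) (by norm_num)
  have a6 : v ^ 2 ≤ W := by
    have := mono (i := 0) (j := 0) (k := 0) (l := 0) (m := 2) (q := 0) (r := 0) (by norm_num)
      (by norm_num) (by norm_num) (by norm_num) (by norm_num) (by norm_num) (by norm_num)
    simpa using this
  have a7 : v ^ 4 * σ2 ≤ cσ / p * W * gL := by
    calc v ^ 4 * σ2 ≤ v ^ 4 * (cσ * (X ^ 2 * u ^ 4 * z ^ 2)) := by gcongr
      _ = cσ * (A ^ 0 * B ^ 0 * X ^ 2 * u ^ 4 * v ^ 4 * z ^ 2 * w ^ 0) := by ring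
      _ ≤ cσ * W := by
        gcongr; exact mono (by norm_num) (by norm_num) (by norm_num) (by norm_num) (by norm_num)
          (by norm_num) (by norm_num)
      _ = cσ / p * W * p := by field_simp
      _ ≤ _ := by gcongr
  have t1 : 0 ≤ c1 * cσ * W := by positivity
  have t2 : 0 ≤ cβ ^ 2 * cσ / p * W := by positivity
  have t3 : 0 ≤ c1 * W := by positivity
  have t4 : 0 ≤ cβ * W := by positivity
  have t5 : 0 ≤ cσ / p * W := by positivity
  have hM' : 1728 * (c1 * cσ * W) + 972 * (cβ ^ 2 * cσ / p * W) + 48 * (c1 * W) + 36 * (cβ * W) +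
      3456 * (c1 * cσ * W) + 4 * W + 6 * (cσ / p * W) ≤ M := by
    refine le_trans (le_of_eq ?_) hM
    ring
  refine ⟨?_, ?_, ?_, by linarith, ?_⟩
  · have : M * (w⁻¹) ^ 4 * gL = M * gL / w ^ 4 := by field_simp
    rw [this, le_div_iff₀ (by positivity)]
    -- Uses `(p + q)² ≤ 2 p² + 2 q²`. The constants `1728 = 27/2 · 128` and `972 = 27/2 · 72` in the
    -- budget come from here.
    have hsq : (8 * gL + 6 * v ^ 2 * β) ^ 2 ≤ 128 * gL ^ 2 + 72 * v ^ 4 * β ^ 2 := by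
      nlinarith [sq_nonneg (8 * gL - 6 * v ^ 2 * β)]
    calc 27 / 2 * ((v ^ 2) ^ 2 * (8 * gL + 6 * v ^ 2 * β) ^ 2 * σ2) * w ^ 4
        ≤ 27 / 2 * ((v ^ 2) ^ 2 * (128 * gL ^ 2 + 72 * v ^ 4 * β ^ 2) * σ2) * w ^ 4 := by gcongr
      _ = 1728 * (v ^ 4 * (gL * σ2) * w ^ 4) * gL + 972 * (v ^ 8 * (β ^ 2 * σ2) * w ^ 4) := by ring
      _ ≤ 1728 * (c1 * cσ * W) * gL + 972 * (cβ ^ 2 * cσ / p * W * gL) := by gcongr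
      _ = (1728 * (c1 * cσ * W) + 972 * (cβ ^ 2 * cσ / p * W)) * gL := by ring
      _ ≤ M * gL := by gcongr; linarith
  · have : M * (w⁻¹) ^ 2 = M / w ^ 2 := by field_simp
    rw [this, le_div_iff₀ (by positivity)]
    calc 6 * v ^ 2 * (8 * gL + 6 * v ^ 2 * β) * w ^ 2
        = 48 * (v ^ 2 * gL * w ^ 2) + 36 * (v ^ 4 * β * w ^ 2) := by ring
      _ ≤ M := by linarith
  · have : M * (w⁻¹) ^ 4 * σ2 = M * σ2 / w ^ 4 := by field_simp
    rw [this, le_div_iff₀ (by positivity)]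
    calc 3456 * ((v ^ 2) ^ 2 * V ^ 2 * gL) * w ^ 4
        ≤ 3456 * ((v ^ 2) ^ 2 * (u ^ 2 * σ2) ^ 2 * gL) * w ^ 4 := by gcongr
      _ = 3456 * (v ^ 4 * u ^ 4 * (gL * σ2) * w ^ 4) * σ2 := by ring
      _ ≤ 3456 * (c1 * cσ * W) * σ2 := by gcongr
      _ ≤ M * σ2 := by gcongr; linarith
  · calc 6 * (v ^ 2) ^ 2 * σ2 = 6 * (v ^ 4 * σ2) := by ring
      _ ≤ 6 * (cσ / p * W * gL) := by gcongr
      _ = 6 * (cσ / p * W) * gL := by ring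
      _ ≤ M * gL := by gcongr; linarith

/-- The horizon at budget `B`. -/
theorem horizon_sq_le {N gL σ2 B τ : ℝ} {S T : ℕ} (hN : 0 < N) (hgL : 0 < gL) (hσ : 0 < σ2)
    (hB : 0 < B) (hS : S = ⌈Real.sqrt σ2 * Real.sqrt (6 * B) / (4 * Real.sqrt gL)⌉₊)
    (hT : T = ⌊B / (S * N)⌋₊) (hτ : τ ≤ σ2) (hτ0 : 0 < τ) :
    (T : ℝ) ^ 2 * N ^ 2 ≤ 8 / (3 * τ) * (gL * B) := by
  set s := Real.sqrt σ2 * Real.sqrt (6 * B) / (4 * Real.sqrt gL) with hs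
  have hs0 : 0 < s := by positivity
  have hs2 : s ^ 2 * (16 * gL) = 6 * σ2 * B := by
    rw [hs, div_pow, mul_pow, mul_pow, Real.sq_sqrt hσ.le, Real.sq_sqrt (by positivity),
      Real.sq_sqrt hgL.le]
    field_simp
    norm_num
  have hsS : s ≤ S := by rw [hS]; exact Nat.le_ceil _
  have hS0 : (0 : ℝ) < S := hs0.trans_le hsS
  have h1 : (T : ℝ) * (S * N) ≤ B := by
    rw [← le_div_iff₀ (by positivity), hT]; exact Nat.floor_le (by positivity)
  -- Rounding the batch size up only shortens the horizon, so `T s N ≤ B`. Squaring and using `s² =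
  -- 6 σ² B / (16 g L)` gives an upper bound on `T` of order `√(g L B)`.
  have h2 : (T : ℝ) * (s * N) ≤ B := le_trans (by gcongr) h1
  have h3 : ((T : ℝ) * (s * N)) ^ 2 ≤ B ^ 2 := by gcongr
  have h4 : (T : ℝ) ^ 2 * N ^ 2 * (6 * σ2) ≤ 16 * (gL * B) := by
    refine le_of_mul_le_mul_right ?_ hB
    calc (T : ℝ) ^ 2 * N ^ 2 * (6 * σ2) * B = T ^ 2 * N ^ 2 * (6 * σ2 * B) := by ring
      _ = ((T : ℝ) * (s * N)) ^ 2 * (16 * gL) := by rw [← hs2]; ring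
      _ ≤ B ^ 2 * (16 * gL) := by gcongr
      _ = _ := by ring
  have h5 : (T : ℝ) ^ 2 * N ^ 2 * (6 * τ) ≤ 16 * (gL * B) := le_trans (by gcongr) h4
  rw [div_mul_eq_mul_div, le_div_iff₀ (by positivity)]
  linarith


/-! ### The rates in terms of normalized quantities -/

section Rates

variable {l A B X u v z w : ℝ}

/-- Here `A`, `B`, `X`, `u`, `v`, `z`, `w` stand for `L_max/ℓ`, `L^y_max/ℓ`, their sum, `√n_max`,
`√N`, `1/η`, `1/ε`. Writing each positive quantity as an exponential reduces the identity to one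
linear in the logarithms. -/
theorem sample_rate_eq (hl : 0 < l) (hA : 0 < A) (hB : 0 < B) (hX : 0 < X) (hu : 0 < u)
    (hv : 0 < v) (hz : 0 < z) (hw : 0 < w) :
    Real.sqrt (l * A * (l * B) ^ 2 * (l * X)) ^ (4 : ℝ) * (u ^ 2) ^ (13 / 2 : ℝ) *
      (v ^ 2) ^ (5 : ℝ) * z⁻¹ ^ (-7 : ℝ) * w⁻¹ ^ (-4 : ℝ) =
    l ^ (8 : ℝ) * (A ^ 2 * B ^ 4 * X ^ 2 * u ^ 13 * v ^ 10 * z ^ 7 * w ^ 4) := by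
  rw [← Real.exp_log hl, ← Real.exp_log hA, ← Real.exp_log hB, ← Real.exp_log hX,
    ← Real.exp_log hu, ← Real.exp_log hv, ← Real.exp_log hz, ← Real.exp_log hw]
  simp only [Real.sqrt_eq_rpow, ← Real.exp_neg, ← Real.exp_nat_mul, ← Real.exp_add,
    ← Real.exp_mul]
  congr 1
  push_cast
  ring

theorem iteration_rate_eq (hl : 0 < l) (hA : 0 < A) (hB : 0 < B) (hX : 0 < X) (hu : 0 < u)
    (hv : 0 < v) (hz : 0 < z) (hw : 0 < w) :
    Real.sqrt (l * A * (l * B) ^ 2 * (l * X)) ^ (2 : ℝ) * (l * A) * (u ^ 2) ^ (7 / 2 : ℝ) *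
      (v ^ 2) ^ (2 : ℝ) * z⁻¹ ^ (-4 : ℝ) * w⁻¹ ^ (-2 : ℝ) =
    l ^ (5 : ℝ) * (A ^ 2 * B ^ 2 * X * u ^ 7 * v ^ 4 * z ^ 4 * w ^ 2) := by
  rw [← Real.exp_log hl, ← Real.exp_log hA, ← Real.exp_log hB, ← Real.exp_log hX,
    ← Real.exp_log hu, ← Real.exp_log hv, ← Real.exp_log hz, ← Real.exp_log hw]
  simp only [Real.sqrt_eq_rpow, ← Real.exp_neg, ← Real.exp_nat_mul, ← Real.exp_add,
    ← Real.exp_mul]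
  congr 1
  push_cast
  ring

/-- The exponents of `l`, `B` and `w` agree exactly, so positivity suffices for them. The stated
rate has spare exponents `1/2` in `A`, `1` in `X`, `5/2` in `u`, `1/2` in `v` and `1` in `z`, so
these parameters must be at least `1`. -/
theorem lower_rate_le {δ : ℝ} (hl : 0 < l) (hA : 1 ≤ A) (hB : 0 < B) (hX : 1 ≤ X) (hu : 1 ≤ u)
    (hv : 1 ≤ v) (hz : 1 ≤ z) (hw : 0 < w) :
    l ^ (29 / 2 + 5 * δ) * ((A ^ 2 * B ^ 4 * X ^ 2 * u ^ 13 * v ^ 10 * z ^ 7 * w ^ 4) *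
      (A ^ 2 * B ^ 2 * X * u ^ 7 * v ^ 4 * z ^ 4 * w ^ 2) ^ (1 + δ)) ≤
    Real.sqrt (l * A * (l * B) ^ 2 * (l * X)) ^ (8 + 2 * δ) * (l * A) ^ (1 / 2 + δ) *
      (l * B) ^ (-2 : ℝ) * (u ^ 2) ^ (45 / 4 + 7 * δ / 2) * (v ^ 2) ^ (29 / 4 + 2 * δ) *
      z⁻¹ ^ (-(12 + 4 * δ)) * w⁻¹ ^ (-(6 + 2 * δ)) := by
  have h1 := Real.log_nonneg hA
  have h2 := Real.log_nonneg hX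
  have h3 := Real.log_nonneg hu
  have h4 := Real.log_nonneg hv
  have h5 := Real.log_nonneg hz
  rw [← Real.exp_log hl, ← Real.exp_log (zero_lt_one.trans_le hA), ← Real.exp_log hB,
    ← Real.exp_log (zero_lt_one.trans_le hX), ← Real.exp_log (zero_lt_one.trans_le hu),
    ← Real.exp_log (zero_lt_one.trans_le hv), ← Real.exp_log (zero_lt_one.trans_le hz),
    ← Real.exp_log hw]
  simp only [Real.sqrt_eq_rpow, ← Real.exp_neg, ← Real.exp_nat_mul, ← Real.exp_add,
    ← Real.exp_mul]
  rw [Real.exp_le_exp]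
  push_cast
  linarith

end Rates

/-! ### Constants -/

namespace HiddenConstants

variable (K : HiddenConstants)

/-- Coefficient in the upper bound on the potential gap times `L^{HI}(η)`. -/
noncomputable def cGap : ℝ := (K.Lm1 + K.Lmin) * ((K.Lm0 + K.Lmin) * K.DX)

/-- Coefficient in the upper bound on `(σ^{HI})²`. -/
noncomputable def cNoise : ℝ :=
  4 * K.Lmin ^ 2 * K.εup + 64 * Real.sqrt (2 * Real.pi) * K.Lmin ^ 2 + 2 * K.σm ^ 2

/-- Coefficient of the accumulated bias `β`; `64 = 2 · 32` is the doubled Robbins–Monro constant. -/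
noncomputable def cBias : ℝ := 64 * K.cmax * K.zeta * K.Lmin ^ 2

/-- The coefficient in `budget_requirements` for these constants, with `gap · Lmin` as the lower
bound on `gL`. -/
noncomputable def cBudget : ℝ :=
  1728 * K.cGap * K.cNoise + 972 * K.cBias ^ 2 * K.cNoise / (K.gap * K.Lmin) + 48 * K.cGap +
    36 * K.cBias + 3456 * K.cGap * K.cNoise + 4 + 6 * K.cNoise / (K.gap * K.Lmin)

/-- From `horizon_sq_le` with `τ = 2 σ_m²`; the `+ 1` pays for rounding the budget up. -/
noncomputable def cHorizon : ℝ :=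
  Real.sqrt (8 / (3 * (2 * K.σm ^ 2)) * (K.cGap * (K.cBudget + 1)))

theorem cGap_pos : 0 < K.cGap := by
  have := K.Lm0_nonneg; have := K.Lm1_nonneg; have := K.Lmin_pos; have := K.DX_pos
  unfold cGap; positivity

theorem cNoise_pos : 0 < K.cNoise := by
  have := K.Lmin_pos; have := K.εup_pos; have := K.σm_pos
  unfold cNoise; positivity

theorem cBias_pos : 0 < K.cBias := by
  have := K.Lmin_pos; have := K.cmax_pos; have := K.zeta_pos
  unfold cBias; positivity

theorem cBudget_pos : 0 < K.cBudget := by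
  have := K.cGap_pos; have := K.cNoise_pos; have := K.cBias_pos; have := K.gap_pos
  have := K.Lmin_pos
  unfold cBudget; positivity

theorem cHorizon_pos : 0 < K.cHorizon := by
  have := K.cGap_pos; have := K.cBudget_pos; have := K.σm_pos
  unfold cHorizon; positivity

end HiddenConstants

/-! ### Normalized bounds on the parameters of the scheme. -/

section Scheme

variable {N : ℕ} {Ξ : Type*} [MeasurableSpace Ξ] {G : Game N Ξ}

/-- The square of `σ^{HI}`. -/
noncomputable def Params.varHI (Q : Params G) (K : HiddenConstants) (η : ℝ) : ℝ :=
  4 * (G.nMax : ℝ) ^ 2 * Q.LyMax ^ 2 * K.εup / η ^ 2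
    + 64 * Real.sqrt (2 * Real.pi) * Q.Lmax ^ 2 * G.nMax + 2 * K.σm ^ 2

/-- The normalized sample complexity. -/
noncomputable def Params.sampleRate (Q : Params G) (K : HiddenConstants) (η ε : ℝ) : ℝ :=
  (Q.Lmax / K.Lmin) ^ 2 * (Q.LyMax / K.Lmin) ^ 4 * (Q.Lmax / K.Lmin + Q.LyMax / K.Lmin) ^ 2 *
    Real.sqrt G.nMax ^ 13 * Real.sqrt N ^ 10 * η⁻¹ ^ 7 * ε⁻¹ ^ 4

/-- The normalized iteration complexity. -/
noncomputable def Params.iterationRate (Q : Params G) (K : HiddenConstants) (η ε : ℝ) : ℝ :=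
  (Q.Lmax / K.Lmin) ^ 2 * (Q.LyMax / K.Lmin) ^ 2 * (Q.Lmax / K.Lmin + Q.LyMax / K.Lmin) *
    Real.sqrt G.nMax ^ 7 * Real.sqrt N ^ 4 * η⁻¹ ^ 4 * ε⁻¹ ^ 2

/-- The floor commutes with the minimum, so only the scalar budget matters. -/
theorem Params.horizon_eq_floor (Q : Params G) (K : HiddenConstants) (η : ℝ) (M0 M1 : ℕ) :
    Q.horizon K η M0 M1 = ⌊budget M0 M1 / ((Q.batch K η M0 M1 : ℝ) * N)⌋₊ := by
  rw [budget, Params.horizon, ← Nat.floor_mono.map_min, min_div_div_right (by positivity)]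

theorem budget_two_mul (M : ℕ) : budget (2 * M) M = M := by
  simp [budget]

theorem Params.horizon_mul_le (Q : Params G) (K : HiddenConstants) (η : ℝ) (M0 M1 : ℕ) :
    (Q.horizon K η M0 M1 : ℝ) * (Q.batch K η M0 M1 * N) ≤ budget M0 M1 := by
  have hb : 0 ≤ budget M0 M1 := by unfold budget; positivity
  rcases eq_or_lt_of_le (by positivity : 0 ≤ (Q.batch K η M0 M1 : ℝ) * N) with h | h
  · rw [← h, mul_zero]; exact hb
  · rw [← le_div_iff₀ h, Q.horizon_eq_floor]
    exact Nat.floor_le (by positivity)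

variable {Q : Params G} {K : HiddenConstants} {η ε : ℝ}

namespace Assumptions

/-- Since `L D = √(gap · L)`, the gap and `L^{HI}` enter the budget arithmetic only through their
product. -/
theorem batch_eq (A : Assumptions G Q K η) (hη : 0 < η) (M0 M1 : ℕ) :
    Q.batch K η M0 M1 = ⌈Real.sqrt (Q.varHI K η) * Real.sqrt (6 * budget M0 M1) /
      (4 * Real.sqrt (G.potentialGap η Q.Pm * Q.LHI K η))⌉₊ := by
  have hL := A.LHI_pos hη
  have h : Q.LHI K η * Q.DHI K η = Real.sqrt (G.potentialGap η Q.Pm * Q.LHI K η) := by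
    have h1 : G.potentialGap η Q.Pm * Q.LHI K η =
        Q.LHI K η ^ 2 * (G.potentialGap η Q.Pm / Q.LHI K η) := by field_simp
    rw [h1, Real.sqrt_mul (by positivity), Real.sqrt_sq hL.le, Params.DHI]
  rw [Params.batch, mul_assoc 4, h]
  rfl

theorem varHI_ge (Q : Params G) (K : HiddenConstants) (hη : 0 < η) : 2 * K.σm ^ 2 ≤ Q.varHI K η := by
  have := K.εup_pos
  unfold Params.varHI
  have : 0 ≤ 4 * (G.nMax : ℝ) ^ 2 * Q.LyMax ^ 2 * K.εup / η ^ 2 := by positivity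
  have : 0 ≤ 64 * Real.sqrt (2 * Real.pi) * Q.Lmax ^ 2 * G.nMax := by positivity
  linarith

theorem varHI_pos (Q : Params G) (K : HiddenConstants) (hη : 0 < η) : 0 < Q.varHI K η :=
  lt_of_lt_of_le (by have := K.σm_pos; positivity) (varHI_ge Q K hη)

variable (A : Assumptions G Q K η)
include A

theorem one_le_Lmax_div : 1 ≤ Q.Lmax / K.Lmin := by
  rw [one_le_div K.Lmin_pos]; exact A.Lmin_le_Lmax

theorem one_le_LyMax_div : 1 ≤ Q.LyMax / K.Lmin := by
  rw [one_le_div K.Lmin_pos]; exact A.Lmin_le_LyMax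

theorem one_le_sqrt_nMax : 1 ≤ Real.sqrt G.nMax := Real.one_le_sqrt.2 A.one_le_nMax

theorem one_le_sqrt_N : 1 ≤ Real.sqrt N := Real.one_le_sqrt.2 A.one_le_N

theorem one_le_sampleRate (hη : 0 < η) (hη1 : η ≤ 1) (hε : 0 < ε) (hε1 : ε ≤ 1) :
    1 ≤ Q.sampleRate K η ε := by
  have h1 := A.one_le_Lmax_div
  have h2 := A.one_le_LyMax_div
  have h := monomial_le h1 h2 (by linarith : 1 ≤ Q.Lmax / K.Lmin + Q.LyMax / K.Lmin)
    A.one_le_sqrt_nMax A.one_le_sqrt_N ((one_le_inv₀ hη).2 hη1) ((one_le_inv₀ hε).2 hε1)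
    (Nat.zero_le 2) (Nat.zero_le 4) (Nat.zero_le 2) (Nat.zero_le 13) (Nat.zero_le 10)
    (Nat.zero_le 7) (Nat.zero_le 4)
  refine le_trans (le_of_eq ?_) h
  simp

/-- The gap contributes `L_max √N` and the smoothness constant `L_max √n_max √N / η`; the additive
constants are absorbed because all factors are at least `1`. -/
theorem gap_mul_LHI_le (hη : 0 < η) (hη1 : η ≤ 1) :
    G.potentialGap η Q.Pm * Q.LHI K η ≤ K.cGap * ((Q.Lmax / K.Lmin) ^ 2 * Real.sqrt G.nMax *
      Real.sqrt N ^ 2 * η⁻¹) := by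
  have hl := K.Lmin_pos
  have h1 := A.one_le_Lmax_div
  have h2 := A.one_le_sqrt_nMax
  have h3 := A.one_le_sqrt_N
  have h4 : 1 ≤ η⁻¹ := (one_le_inv₀ hη).2 hη1
  have hDX := K.DX_pos
  have hLm0 := K.Lm0_nonneg
  have hLm1 := K.Lm1_nonneg
  have ha : Q.Lmax = K.Lmin * (Q.Lmax / K.Lmin) := by field_simp
  set a := Q.Lmax / K.Lmin
  set u := Real.sqrt G.nMax
  set v := Real.sqrt N
  have e1 : Q.LHI K η ≤ (K.Lm1 + K.Lmin) * (a * u * v * η⁻¹) := by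
    have : 1 ≤ a * u * v * η⁻¹ := by
      have : (1 : ℝ) = 1 * 1 * 1 * 1 := by norm_num
      rw [this]; gcongr
    have h5 : Q.LHI K η = K.Lm1 + K.Lmin * (a * u * v * η⁻¹) := by
      rw [Params.LHI, ha]; ring
    rw [h5]
    nlinarith
  have e2 : G.potentialGap η Q.Pm ≤ (K.Lm0 + K.Lmin) * K.DX * (a * v) := by
    have : 1 ≤ a * v := by
      have : (1 : ℝ) = 1 * 1 := by norm_num
      rw [this]; gcongr
    refine (A.potentialGap_le hη).trans ?_
    rw [ha]
    calc (K.Lm0 + K.Lmin * a * v) * K.DX ≤ (K.Lm0 * (a * v) + K.Lmin * a * v) * K.DX := by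
          gcongr; exact le_mul_of_one_le_right hLm0 this
      _ = _ := by ring
  calc _ ≤ ((K.Lm0 + K.Lmin) * K.DX * (a * v)) * ((K.Lm1 + K.Lmin) * (a * u * v * η⁻¹)) :=
        mul_le_mul e2 e1 (A.LHI_pos hη).le (by positivity)
    _ = _ := by rw [HiddenConstants.cGap]; ring

theorem le_gap_mul_LHI (hη : 0 < η) :
    K.gap * K.Lmin * ((Q.Lmax / K.Lmin) * Real.sqrt G.nMax * Real.sqrt N * η⁻¹) ≤
      G.potentialGap η Q.Pm * Q.LHI K η := by
  have hl := K.Lmin_pos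
  have ha := A.Lmax_pos
  have hg := K.gap_pos
  have h1 : K.Lmin * ((Q.Lmax / K.Lmin) * Real.sqrt G.nMax * Real.sqrt N * η⁻¹) ≤ Q.LHI K η := by
    have : K.Lmin * ((Q.Lmax / K.Lmin) * Real.sqrt G.nMax * Real.sqrt N * η⁻¹) =
        Q.Lmax * Real.sqrt G.nMax * Real.sqrt N / η := by field_simp
    rw [this, Params.LHI]
    linarith [K.Lm1_nonneg]
  rw [mul_assoc]
  exact mul_le_mul A.gap_le h1 (by positivity) A.gap_pos.le

theorem varHI_le (hη : 0 < η) (hη1 : η ≤ 1) : Q.varHI K η ≤ K.cNoise *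
    ((Q.Lmax / K.Lmin + Q.LyMax / K.Lmin) ^ 2 * Real.sqrt G.nMax ^ 4 * η⁻¹ ^ 2) := by
  have hl := K.Lmin_pos
  have h1 := A.one_le_Lmax_div
  have h1' := A.one_le_LyMax_div
  have h2 := A.one_le_sqrt_nMax
  have h4 : 1 ≤ η⁻¹ := (one_le_inv₀ hη).2 hη1
  have hε := K.εup_pos
  have ha : Q.Lmax = K.Lmin * (Q.Lmax / K.Lmin) := by field_simp
  have hb : Q.LyMax = K.Lmin * (Q.LyMax / K.Lmin) := by field_simp
  have hn : (G.nMax : ℝ) = Real.sqrt G.nMax ^ 2 := (Real.sq_sqrt (by positivity)).symm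
  rw [Params.varHI, div_eq_mul_inv _ (η ^ 2), ← inv_pow]
  set a := Q.Lmax / K.Lmin
  set b := Q.LyMax / K.Lmin
  set u := Real.sqrt G.nMax
  set z := η⁻¹
  set c := Real.sqrt (2 * Real.pi)
  have hc : 0 ≤ c := Real.sqrt_nonneg _
  have f1 : b ^ 2 * u ^ 4 * z ^ 2 ≤ (a + b) ^ 2 * u ^ 4 * z ^ 2 := by gcongr; linarith
  have f2 : a ^ 2 * u ^ 2 * 1 ≤ (a + b) ^ 2 * u ^ 4 * z ^ 2 := by
    gcongr
    · linarith
    · norm_num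
    · exact one_le_pow₀ h4
  have f3 : 1 ≤ (a + b) ^ 2 * u ^ 4 * z ^ 2 := by
    have : (1 : ℝ) = 1 * 1 * 1 := by norm_num
    rw [this]
    gcongr
    · exact one_le_pow₀ (by linarith)
    · exact one_le_pow₀ h2
    · exact one_le_pow₀ h4
  set m := (a + b) ^ 2 * u ^ 4 * z ^ 2
  calc _ = 4 * K.Lmin ^ 2 * K.εup * (b ^ 2 * u ^ 4 * z ^ 2) +
        64 * c * K.Lmin ^ 2 * (a ^ 2 * u ^ 2 * 1) + 2 * K.σm ^ 2 * 1 := by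
          rw [ha, hb, hn]; ring
    _ ≤ 4 * K.Lmin ^ 2 * K.εup * m + 64 * c * K.Lmin ^ 2 * m + 2 * K.σm ^ 2 * m := by gcongr
    _ = _ := by rw [HiddenConstants.cNoise]; ring

/-- The sure bound on the estimator gives variance of order `n_max²`, while the term in `(σ^{HI})²`
is of order `n_max`. The extra factor `n_max` is affordable in the budget. -/
theorem noiseBound_le (hη : 0 < η) : Q.noiseBound K ≤ Real.sqrt G.nMax ^ 2 * Q.varHI K η := by
  have hn := A.one_le_nMax
  have hε := K.εup_pos
  rw [Real.sq_sqrt (by positivity), Params.noiseBound, Params.varHI]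
  have h1 : 0 ≤ (G.nMax : ℝ) * (4 * (G.nMax : ℝ) ^ 2 * Q.LyMax ^ 2 * K.εup / η ^ 2) := by positivity
  have h2 : 1 ≤ Real.sqrt (2 * Real.pi) := by
    rw [Real.one_le_sqrt]; linarith [Real.pi_gt_three]
  have h3 : 2 * K.σm ^ 2 ≤ G.nMax * (2 * K.σm ^ 2) := le_mul_of_one_le_left (by positivity) hn
  have h4 : 8 * ((G.nMax : ℝ) * Q.Lmax) ^ 2 ≤
      64 * Real.sqrt (2 * Real.pi) * ((G.nMax : ℝ) * Q.Lmax) ^ 2 := by gcongr; linarith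
  nlinarith

end Assumptions

end Scheme


/-! ### Assembling the complexity bounds. -/

namespace Assumptions

variable {N : ℕ} {Ξ : Type*} [MeasurableSpace Ξ] {G : Game N Ξ} {Q : Params G}
  {K : HiddenConstants} {η ε : ℝ} (A : Assumptions G Q K η)
include A

theorem target_reached (hη : 0 < η) (hη1 : η ≤ 1) (hε : 0 < ε) (hε1 : ε ≤ 1) {M0 M1 : ℕ}
    (hM : K.cBudget * Q.sampleRate K η ε ≤ budget M0 M1) :
    1 ≤ Q.batch K η M0 M1 ∧ 1 ≤ Q.horizon K η M0 M1 ∧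
    (Q.horizon K η M0 M1 : ℝ)⁻¹ * (8 * Q.LHI K η * G.potentialGap η Q.Pm +
      6 * Q.totalError K η (Q.batch K η M0 M1) (Q.horizon K η M0 M1)) ≤ ε ^ 2 := by
  have hl := K.Lmin_pos
  have hc := K.cmax_pos
  have hζ := K.zeta_pos
  have hv2 : Real.sqrt N ^ 2 = N := Real.sq_sqrt (by positivity)
  have hu2 : Real.sqrt G.nMax ^ 2 = G.nMax := Real.sq_sqrt (by positivity)
  have h1 := A.one_le_Lmax_div
  have h2 := A.one_le_LyMax_div
  set β : ℝ := 2 * (32 * (G.nMax : ℝ) ^ 2 * Q.LyMax ^ 2 * K.cmax / η ^ 2 * K.zeta) with hβ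
  have hβ0 : 0 ≤ β := by positivity
  have hβle : β ≤ K.cBias * (Real.sqrt G.nMax ^ 4 * (Q.LyMax / K.Lmin) ^ 2 * η⁻¹ ^ 2) := by
    have : Real.sqrt G.nMax ^ 4 = (G.nMax : ℝ) ^ 2 := by
      calc Real.sqrt G.nMax ^ 4 = (Real.sqrt G.nMax ^ 2) ^ 2 := by ring
        _ = _ := by rw [hu2]
    rw [this, hβ, HiddenConstants.cBias]
    refine le_of_eq ?_
    field_simp
    ring
  have hgL : 0 < G.potentialGap η Q.Pm * Q.LHI K η := mul_pos A.gap_pos (A.LHI_pos hη)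
  obtain ⟨r1, r2, r3, r4, r5⟩ := budget_requirements h1 h2
    (by linarith : 1 ≤ Q.Lmax / K.Lmin + Q.LyMax / K.Lmin) A.one_le_sqrt_nMax A.one_le_sqrt_N
    ((one_le_inv₀ hη).2 hη1) ((one_le_inv₀ hε).2 hε1) (mul_pos K.gap_pos hl) K.cGap_pos.le
    K.cNoise_pos.le K.cBias_pos.le (Q.noiseBound_nonneg K) hβ0 (varHI_pos Q K hη)
    (A.gap_mul_LHI_le hη hη1) (A.le_gap_mul_LHI hη) (A.varHI_le hη hη1) (A.noiseBound_le hη) hβle hM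
  rw [hv2, inv_inv] at r1
  rw [hv2, inv_inv] at r2
  rw [hv2, inv_inv] at r3
  rw [hv2] at r4 r5
  have h := residual_bound_le A.one_le_N hgL (varHI_pos Q K hη) (Q.noiseBound_nonneg K) hβ0 hε
    (A.batch_eq hη M0 M1) (Q.horizon_eq_floor K η M0 M1) r1 r2 r3 r4 r5
  refine ⟨h.1, h.2.1, le_trans (le_of_eq ?_) h.2.2⟩
  rw [Params.totalError, ← hβ]
  ring

theorem horizon_le (hη : 0 < η) (hη1 : η ≤ 1) (hε : 0 < ε) {M : ℕ}
    (hM0 : 1 ≤ M) (hM : (M : ℝ) ≤ (K.cBudget + 1) * Q.sampleRate K η ε) :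
    (Q.horizon K η (2 * M) M : ℝ) ≤ K.cHorizon * Q.iterationRate K η ε := by
  have hMr : (0 : ℝ) < M := by exact_mod_cast hM0
  have hN : (0 : ℝ) < N := by linarith [A.one_le_N]
  have hσ := K.σm_pos
  have hgL : 0 < G.potentialGap η Q.Pm * Q.LHI K η := mul_pos A.gap_pos (A.LHI_pos hη)
  have h1 := horizon_sq_le (S := Q.batch K η (2 * M) M) (T := Q.horizon K η (2 * M) M)
    hN hgL (varHI_pos Q K hη) hMr
    (by rw [A.batch_eq hη, budget_two_mul]) (by rw [Q.horizon_eq_floor, budget_two_mul])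
    (varHI_ge Q K hη) (by positivity)
  have hlm := A.one_le_Lmax_div
  have hly := A.one_le_LyMax_div
  have hcg := K.cGap_pos
  have hcb := K.cBudget_pos
  have hb : 0 ≤ Q.LyMax / K.Lmin := by linarith
  have hI : 0 ≤ Q.iterationRate K η ε := by unfold Params.iterationRate; positivity
  rw [← pow_le_pow_iff_left₀ (by positivity) (mul_nonneg K.cHorizon_pos.le hI) two_ne_zero]
  refine le_of_mul_le_mul_right (h1.trans ?_) (by positivity : (0 : ℝ) < N ^ 2)
  have hv2 : (N : ℝ) = Real.sqrt N ^ 2 := (Real.sq_sqrt (by positivity)).symm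
  calc 8 / (3 * (2 * K.σm ^ 2)) * (G.potentialGap η Q.Pm * Q.LHI K η * M) ≤
      8 / (3 * (2 * K.σm ^ 2)) * ((K.cGap * ((Q.Lmax / K.Lmin) ^ 2 * Real.sqrt G.nMax *
        Real.sqrt N ^ 2 * η⁻¹)) * ((K.cBudget + 1) * Q.sampleRate K η ε)) := by
        exact mul_le_mul_of_nonneg_left (mul_le_mul (A.gap_mul_LHI_le hη hη1) hM hMr.le
          (by positivity)) (by positivity)
    _ = 8 / (3 * (2 * K.σm ^ 2)) * (K.cGap * (K.cBudget + 1)) *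
        (((Q.Lmax / K.Lmin) ^ 2 * Real.sqrt G.nMax * Real.sqrt N ^ 2 * η⁻¹) *
          Q.sampleRate K η ε) := by ring
    _ = K.cHorizon ^ 2 * (((Q.Lmax / K.Lmin) ^ 2 * Real.sqrt G.nMax * Real.sqrt N ^ 2 * η⁻¹) *
          Q.sampleRate K η ε) := by
        have : K.cHorizon ^ 2 = 8 / (3 * (2 * K.σm ^ 2)) * (K.cGap * (K.cBudget + 1)) :=
          Real.sq_sqrt (by positivity)
        rw [this]
    _ = (K.cHorizon * Q.iterationRate K η ε) ^ 2 * (Real.sqrt N ^ 2) ^ 2 := by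
        rw [Params.iterationRate, Params.sampleRate]; ring
    _ = _ := by rw [← hv2]

/-- The first factor `T S N` is at most the budget, and each run takes at most `2 T^{1+δ}` steps;
the two evaluation points supply the other factor `2`. -/
theorem lower_calls_le (hη : 0 < η) (hη1 : η ≤ 1) (hε : 0 < ε) {M : ℕ}
    (hM0 : 1 ≤ M) (hM : (M : ℝ) ≤ (K.cBudget + 1) * Q.sampleRate K η ε) {k : ℕ}
    (hk : k ≤ Q.horizon K η (2 * M) M) :
    ((N * (Q.batch K η (2 * M) M * 2) * ∑ j ∈ Finset.range k, lowerIters K.δ j : ℕ) : ℝ) ≤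
      4 * (K.cBudget + 1) * K.cHorizon ^ (1 + K.δ) *
        (Q.sampleRate K η ε * Q.iterationRate K η ε ^ (1 + K.δ)) := by
  have hδ := K.δ_pos
  have h1 := sum_lowerIters_le hδ hk
  have h2 := Q.horizon_mul_le K η (2 * M) M
  rw [budget_two_mul] at h2
  have h3 := A.horizon_le hη hη1 hε hM0 hM
  set S := Q.batch K η (2 * M) M
  set T := Q.horizon K η (2 * M) M
  have hly : 0 ≤ Q.LyMax / K.Lmin := by linarith [A.one_le_LyMax_div]
  have hla : 0 ≤ Q.Lmax / K.Lmin := by linarith [A.one_le_Lmax_div]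
  have hI : 0 ≤ Q.iterationRate K η ε := by unfold Params.iterationRate; positivity
  have hI' : 0 ≤ Q.sampleRate K η ε := by unfold Params.sampleRate; positivity
  have hcb := K.cBudget_pos
  calc ((N * (S * 2) * ∑ j ∈ Finset.range k, lowerIters K.δ j : ℕ) : ℝ)
      = N * (S * 2) * ((∑ j ∈ Finset.range k, lowerIters K.δ j : ℕ) : ℝ) := by push_cast; ring
    _ ≤ N * (S * 2) * (T * (2 * (T : ℝ) ^ (1 + K.δ))) := by gcongr
    _ = 4 * ((T : ℝ) * (S * N)) * (T : ℝ) ^ (1 + K.δ) := by ring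
    _ ≤ 4 * ((K.cBudget + 1) * Q.sampleRate K η ε) *
        (K.cHorizon * Q.iterationRate K η ε) ^ (1 + K.δ) := by
        have h4 := h2.trans hM
        exact mul_le_mul (by linarith) (Real.rpow_le_rpow (by positivity) h3 (by linarith))
          (by positivity) (by positivity)
    _ = _ := by rw [Real.mul_rpow K.cHorizon_pos.le hI]; ring

omit A in
theorem scriptL_eq : Q.scriptL = Real.sqrt (K.Lmin * (Q.Lmax / K.Lmin) *
    (K.Lmin * (Q.LyMax / K.Lmin)) ^ 2 * (K.Lmin * (Q.Lmax / K.Lmin + Q.LyMax / K.Lmin))) := by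
  have hl := K.Lmin_pos
  rw [Params.scriptL]
  congr 1
  field_simp
  ring

theorem sampleRate_eq (hη : 0 < η) (hε : 0 < ε) :
    Q.scriptL ^ (4 : ℝ) * (G.nMax : ℝ) ^ (13 / 2 : ℝ) * (N : ℝ) ^ (5 : ℝ) * η ^ (-7 : ℝ) *
      ε ^ (-4 : ℝ) = K.Lmin ^ (8 : ℝ) * Q.sampleRate K η ε := by
  have h1 := A.one_le_Lmax_div
  have h2 := A.one_le_LyMax_div
  have h3 := A.one_le_sqrt_nMax
  have h4 := A.one_le_sqrt_N
  have h := sample_rate_eq K.Lmin_pos (zero_lt_one.trans_le h1) (zero_lt_one.trans_le h2)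
    (by linarith : 0 < Q.Lmax / K.Lmin + Q.LyMax / K.Lmin) (zero_lt_one.trans_le h3)
    (zero_lt_one.trans_le h4) (inv_pos.2 hη) (inv_pos.2 hε)
  rwa [inv_inv, inv_inv, Real.sq_sqrt (by positivity), Real.sq_sqrt (by positivity),
    ← scriptL_eq] at h

theorem iterationRate_eq (hη : 0 < η) (hε : 0 < ε) :
    Q.scriptL ^ (2 : ℝ) * Q.Lmax * (G.nMax : ℝ) ^ (7 / 2 : ℝ) * (N : ℝ) ^ (2 : ℝ) * η ^ (-4 : ℝ) *
      ε ^ (-2 : ℝ) = K.Lmin ^ (5 : ℝ) * Q.iterationRate K η ε := by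
  have h1 := A.one_le_Lmax_div
  have h2 := A.one_le_LyMax_div
  have h3 := A.one_le_sqrt_nMax
  have h4 := A.one_le_sqrt_N
  have h := iteration_rate_eq K.Lmin_pos (zero_lt_one.trans_le h1) (zero_lt_one.trans_le h2)
    (by linarith : 0 < Q.Lmax / K.Lmin + Q.LyMax / K.Lmin) (zero_lt_one.trans_le h3)
    (zero_lt_one.trans_le h4) (inv_pos.2 hη) (inv_pos.2 hε)
  rwa [inv_inv, inv_inv, Real.sq_sqrt (by positivity), Real.sq_sqrt (by positivity),
    ← scriptL_eq, mul_div_cancel₀ _ K.Lmin_pos.ne'] at h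

theorem lowerRate_le (hη : 0 < η) (hη1 : η ≤ 1) (hε : 0 < ε) :
    K.Lmin ^ (29 / 2 + 5 * K.δ) * (Q.sampleRate K η ε * Q.iterationRate K η ε ^ (1 + K.δ)) ≤
      Q.scriptL ^ (8 + 2 * K.δ) * Q.Lmax ^ (1 / 2 + K.δ) * Q.LyMax ^ (-2 : ℝ)
        * (G.nMax : ℝ) ^ (45 / 4 + 7 * K.δ / 2) * (N : ℝ) ^ (29 / 4 + 2 * K.δ)
        * η ^ (-(12 + 4 * K.δ)) * ε ^ (-(6 + 2 * K.δ)) := by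
  have h1 := A.one_le_Lmax_div
  have h2 := A.one_le_LyMax_div
  have h := lower_rate_le (δ := K.δ) K.Lmin_pos h1 (zero_lt_one.trans_le h2)
    (by linarith : 1 ≤ Q.Lmax / K.Lmin + Q.LyMax / K.Lmin) A.one_le_sqrt_nMax
    A.one_le_sqrt_N ((one_le_inv₀ hη).2 hη1) (inv_pos.2 hε)
  rwa [inv_inv, inv_inv, Real.sq_sqrt (by positivity), Real.sq_sqrt (by positivity),
    ← scriptL_eq, mul_div_cancel₀ _ K.Lmin_pos.ne', mul_div_cancel₀ _ K.Lmin_pos.ne'] at h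

omit A in
theorem oracle_calls_le {Ω : Type*} (D : Draws G.n Ξ Ω) (ω : Ω) (M0 M1 : ℕ) {k : ℕ}
    (hk : k ≤ Q.horizon K η M0 M1) :
    (upperRun Q K η (Q.batch K η M0 M1) D ω k).zo ≤ M0 ∧
      (upperRun Q K η (Q.batch K η M0 M1) D ω k).fo ≤ M1 := by
  have h := Q.horizon_mul_le K η M0 M1
  have hk' : (k : ℝ) ≤ Q.horizon K η M0 M1 := by exact_mod_cast hk
  have h1 : (k : ℝ) * (Q.batch K η M0 M1 * N) ≤ budget M0 M1 := le_trans (by gcongr) h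
  have h2 := h1.trans (min_le_left _ _)
  have h3 := h1.trans (min_le_right _ _)
  rw [upperRun_zo, upperRun_fo]
  constructor
  · have : (k : ℝ) * (N * (Q.batch K η M0 M1 * 2)) ≤ M0 := by linarith
    exact_mod_cast this
  · have : (k : ℝ) * (N * Q.batch K η M0 M1) ≤ M1 := by linarith
    exact_mod_cast this

end Assumptions

end HierarchicalGame

theorem mainTheorem7 (K : HiddenConstants) :
    ∃ C : ℝ, 0 < C ∧
      ∀ (N : ℕ) (Ξ : Type*) [MeasurableSpace Ξ] (G : Game N Ξ) (Q : Params G) (η ε : ℝ),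
        0 < η → η ≤ 1 → 0 < ε → ε ≤ 1 → Assumptions G Q K η →
        ∃ M : ℕ,
          -- upper-level sample complexity (budgets `M₀ = 2M`, `M₁ = M`)
          ((2 * M + M : ℕ) : ℝ) ≤
            C * (Q.scriptL ^ (4 : ℝ) * (G.nMax : ℝ) ^ (13 / 2 : ℝ) * (N : ℝ) ^ (5 : ℝ)
              * η ^ (-7 : ℝ) * ε ^ (-4 : ℝ)) ∧
          -- upper-level iteration complexity
          (Q.horizon K η (2 * M) M : ℝ) ≤
            C * (Q.scriptL ^ (2 : ℝ) * Q.Lmax * (G.nMax : ℝ) ^ (7 / 2 : ℝ) * (N : ℝ) ^ (2 : ℝ)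
              * η ^ (-4 : ℝ) * ε ^ (-2 : ℝ)) ∧
          -- the target is reached with these budgets, and with all larger ones
          (∀ M0 M1 : ℕ, (M : ℝ) ≤ budget M0 M1 →
            1 ≤ Q.horizon K η M0 M1 ∧
            ∀ (Ω : Type*) [MeasurableSpace Ω] (P : Measure Ω)
              [IsProbabilityMeasure P] (D : Draws G.n Ξ Ω),
              D.Valid P G.law η (Q.horizon K η M0 M1) →
              Integrable (fun ω => ‖G.residual η (Q.γ K η)
                (output Q K η (Q.batch K η M0 M1) D ω).x‖) P ∧
              ∫ ω, ‖G.residual η (Q.γ K η)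
                (output Q K η (Q.batch K η M0 M1) D ω).x‖ ∂P ≤ ε ∧
              -- the oracle budgets are respected
              ∀ ω, ∀ k ≤ Q.horizon K η M0 M1,
                (upperRun Q K η (Q.batch K η M0 M1) D ω k).iters ≤ Q.horizon K η M0 M1 ∧
                (upperRun Q K η (Q.batch K η M0 M1) D ω k).zo ≤ M0 ∧
                (upperRun Q K η (Q.batch K η M0 M1) D ω k).fo ≤ M1) ∧
          -- lower-level sample and iteration complexities
          (∀ (Ω : Type*) (D : Draws G.n Ξ Ω) (ω : Ω), ∀ k ≤ Q.horizon K η (2 * M) M,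
            ((upperRun Q K η (Q.batch K η (2 * M) M) D ω k).lowerSamples : ℝ) ≤
              C * (Q.scriptL ^ (8 + 2 * K.δ) * Q.Lmax ^ (1 / 2 + K.δ) * Q.LyMax ^ (-2 : ℝ)
                * (G.nMax : ℝ) ^ (45 / 4 + 7 * K.δ / 2) * (N : ℝ) ^ (29 / 4 + 2 * K.δ)
                * η ^ (-(12 + 4 * K.δ)) * ε ^ (-(6 + 2 * K.δ))) ∧
            ((upperRun Q K η (Q.batch K η (2 * M) M) D ω k).lowerIters : ℝ) ≤
              C * (Q.scriptL ^ (8 + 2 * K.δ) * Q.Lmax ^ (1 / 2 + K.δ) * Q.LyMax ^ (-2 : ℝ)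
                * (G.nMax : ℝ) ^ (45 / 4 + 7 * K.δ / 2) * (N : ℝ) ^ (29 / 4 + 2 * K.δ)
                * η ^ (-(12 + 4 * K.δ)) * ε ^ (-(6 + 2 * K.δ)))) := by
  have hl := K.Lmin_pos
  have hcb := K.cBudget_pos
  have hch := K.cHorizon_pos
  -- Powers of `K.Lmin` undo the normalization, one power for each of the three rates; the sum of
  -- the constants serves all claims at once.
  set C1 := 3 * (K.cBudget + 1) / K.Lmin ^ (8 : ℝ) with hC1
  set C2 := K.cHorizon / K.Lmin ^ (5 : ℝ) with hC2
  set C3 := 4 * (K.cBudget + 1) * K.cHorizon ^ (1 + K.δ) / K.Lmin ^ (29 / 2 + 5 * K.δ) with hC3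
  have h1 : 0 < C1 := by positivity
  have h2 : 0 < C2 := by positivity
  have h3 : 0 < C3 := by positivity
  refine ⟨C1 + C2 + C3, by positivity, fun N Ξ _ G Q η ε hη hη1 hε hε1 A => ?_⟩
  have hW := A.one_le_sampleRate hη hη1 hε hε1
  have hZ : 0 ≤ Q.iterationRate K η ε := by
    have := A.one_le_Lmax_div
    have := A.one_le_LyMax_div
    have : 0 ≤ Q.Lmax / K.Lmin + Q.LyMax / K.Lmin := by linarith
    unfold Params.iterationRate
    positivity
  -- The least integer meeting the sufficient condition for the target. As the normalized rate is at
  -- least `1`, rounding up is absorbed by `cBudget + 1`.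
  set M := ⌈K.cBudget * Q.sampleRate K η ε⌉₊ with hMdef
  have hMlow : K.cBudget * Q.sampleRate K η ε ≤ M := Nat.le_ceil _
  have hMpos : 1 ≤ M := Nat.ceil_pos.2 (by positivity)
  have hMup : (M : ℝ) ≤ (K.cBudget + 1) * Q.sampleRate K η ε := by
    have := Nat.ceil_lt_add_one (a := K.cBudget * Q.sampleRate K η ε) (by positivity)
    linarith
  refine ⟨M, ?_, ?_, fun M0 M1 hM => ?_, fun Ω D ω k hk => ?_⟩
  · rw [A.sampleRate_eq hη hε]
    calc ((2 * M + M : ℕ) : ℝ) = 3 * M := by push_cast; ring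
      _ ≤ 3 * ((K.cBudget + 1) * Q.sampleRate K η ε) := by gcongr
      _ = C1 * (K.Lmin ^ (8 : ℝ) * Q.sampleRate K η ε) := by rw [hC1]; field_simp
      _ ≤ _ := by gcongr; linarith
  · rw [A.iterationRate_eq hη hε]
    calc (Q.horizon K η (2 * M) M : ℝ) ≤ K.cHorizon * Q.iterationRate K η ε :=
          A.horizon_le hη hη1 hε hMpos hMup
      _ = C2 * (K.Lmin ^ (5 : ℝ) * Q.iterationRate K η ε) := by rw [hC2]; field_simp
      _ ≤ _ := by gcongr; linarith
  · obtain ⟨hS, hT, hb⟩ := A.target_reached hη hη1 hε hε1 (hMlow.trans hM)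
    refine ⟨hT, fun Ω _ P _ D hD => ?_⟩
    obtain ⟨hi, hle⟩ := A.residual_output hη hD hS hT
    refine ⟨hi, ?_, fun ω k hk => ⟨?_, Assumptions.oracle_calls_le D ω M0 M1 hk⟩⟩
    · exact le_of_sq_le_sq (hle.trans hb) hε.le
    · rw [upperRun_iters]; exact hk
  · have hlow := A.lower_calls_le hη hη1 hε hMpos hMup hk
    have hrate := A.lowerRate_le hη hη1 hε
    rw [upperRun_lowerSamples, upperRun_lowerIters]
    rw [and_self_iff]
    refine hlow.trans ?_
    refine le_trans (le_of_eq ?_) (mul_le_mul (by linarith : C3 ≤ C1 + C2 + C3) hrate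
      (by positivity) (by positivity))
    rw [hC3]
    field_simp
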